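/- For a vector $a$ let $\mathrm{ns}(a)=\min\{k\ge 0:\|a\|_1\le\sqrt{k}\,\|a\|_2\}$, and for $A\in\mathbb{R}^{m\times n}$ let $\mathrm{ns}(A)$ be the maximum of $\mathrm{ns}(a)$ over all rows and columns $a$ of $A$, let $\mathrm{sr}(A)=\|A\|_F^2/\|A\|_2^2$ be the stable rank ($\|\cdot\|_2$ the spectral norm, $\mathrm{sr}(0)=0$), and let $\mathrm{nnz}(A)$ be the number of non-zero entries. Write $A_i$, $A^j$ for the rows and columns of $A$ and put $$p^{(1)}_{ij}=\frac{|A_{ij}|}{\sum_{i'j'}|A_{i'j'}|},\qquad p^{(2)}_{ij}=\frac{\|A_i\|_1^2}{\sum_{i'}\|A_{i'}\|_1^2}\cdot\frac{|A_{ij}|}{\|A_i\|_1},\qquad p^{(3)}_{ij}=\frac{\|A^j\|_1^2}{\sum_{j'}\|A^{j'}\|_1^2}\cdot\frac{|A_{ij}|}{\|A^j\|_1}$$ (with $0/0=0$). For every $c>0$ there is a randomized algorithm (a program for a unit-cost real RAM with square root, natural logarithm and uniform random numbers from $[0,1]$) and a constant $C$ depending only on $c$ such that the following holds for all $m\ge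 n$, all $A\in\mathbb{R}^{m\times n}$, given as a list of its non-zero entries in any order, and all $\epsilon>0$. The algorithm always halts, and for some $s\ge 0$ (with $s>0$ if $m\ge 2$) its output $\tilde A$, again given as a list of its non-zero entries, is obtained from $A$ by keeping each entry independently with probability $p_{ij}=\min(1,s\cdot\max\{p^{(1)}_{ij},p^{(2)}_{ij},p^{(3)}_{ij}\})$, replacing a kept entry by $A_{ij}/p_{ij}$ and every other entry by $0$; moreover $$\Pr\big[\|A-\tilde A\|_2\le\epsilon\|A\|_2\big]\ge 1-m^{-c},$$ $$\mathbb{E}\,\mathrm{nnz}(\tilde A)\le C\left(\epsilon^{-2}\,\mathrm{ns}(A)\,\mathrm{sr}(A)\ln m+\epsilon^{-1}\sqrt{\mathrm{ns}(A)\,\mathrm{sr}(A)\,n}\,\ln m\right).$$ Furthermore, for every $c>0$ and $\kappa\ge 1$ there are such an algorithm and a constant $C$, depending only on $c$ and $\kappa$, that achieve the same guarantees in at most $C(\mathrm{nnz}(A)+1)$ steps, for every outcome of the random choices, when the input also contains a number $L$ with $\|A\|_2/\kappa\le L\le\kappa\|A\|_2$. -/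

import Mathlib

open MeasureTheory ProbabilityTheory

namespace Sparsify

noncomputable section

/-! ### Norms and sparsity measures of vectors and matrices -/

/-- The `ℓ₁` norm of a vector. -/
def vecL1 {ι : Type*} [Fintype ι] (a : ι → ℝ) : ℝ := ∑ i, |a i|

/-- The `ℓ₂` norm of a vector. -/
def vecL2 {ι : Type*} [Fintype ι] (a : ι → ℝ) : ℝ := Real.sqrt (∑ i, a i ^ 2)

/-- Numerical sparsity of a vector: the least real `k ≥ 0` with `‖a‖₁ ≤ √k ‖a‖₂`. -/
def vecNs {ι : Type*} [Fintype ι] (a : ι → ℝ) : ℝ :=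
  sInf {k : ℝ | 0 ≤ k ∧ vecL1 a ≤ Real.sqrt k * vecL2 a}

/-- Numerical sparsity of a matrix: the maximum numerical sparsity of its rows and columns. -/
def ns {m n : ℕ} (A : Matrix (Fin m) (Fin n) ℝ) : ℝ :=
  max (⨆ i, vecNs (fun j => A i j)) (⨆ j, vecNs (fun i => A i j))

/-- Spectral norm: the operator norm between Euclidean spaces. -/
def specNorm {m n : ℕ} (A : Matrix (Fin m) (Fin n) ℝ) : ℝ :=
  ‖LinearMap.toContinuousLinearMap (Matrix.toEuclideanLin A)‖

/-- Frobenius norm. -/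
def frobNorm {m n : ℕ} (A : Matrix (Fin m) (Fin n) ℝ) : ℝ :=
  Real.sqrt (∑ i, ∑ j, A i j ^ 2)

/-- Stable rank (it is `0` for the zero matrix). -/
def sr {m n : ℕ} (A : Matrix (Fin m) (Fin n) ℝ) : ℝ := frobNorm A ^ 2 / specNorm A ^ 2

/-- Positions of the non-zero entries. -/
abbrev Supp {m n : ℕ} (A : Matrix (Fin m) (Fin n) ℝ) : Type :=
  {q : Fin m × Fin n // A q.1 q.2 ≠ 0}

/-- Number of non-zero entries. -/
def nnz {m n : ℕ} (A : Matrix (Fin m) (Fin n) ℝ) : ℕ := Nat.card (Supp A)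

/-! ### The sampling distributions -/

/-- Entrywise `ℓ₁` distribution. -/
def prob1 {m n : ℕ} (A : Matrix (Fin m) (Fin n) ℝ) (i : Fin m) (j : Fin n) : ℝ :=
  |A i j| / ∑ i', ∑ j', |A i' j'|

/-- A row is drawn proportionally to its squared `ℓ₁` norm, then an entry of that row
proportionally to its absolute value. -/
def prob2 {m n : ℕ} (A : Matrix (Fin m) (Fin n) ℝ) (i : Fin m) (j : Fin n) : ℝ :=
  vecL1 (fun j' => A i j') ^ 2 / (∑ i', vecL1 (fun j' => A i' j') ^ 2) *
    (|A i j| / vecL1 (fun j' => A i j'))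

/-- A column is drawn proportionally to its squared `ℓ₁` norm, then an entry of that column
proportionally to its absolute value. -/
def prob3 {m n : ℕ} (A : Matrix (Fin m) (Fin n) ℝ) (i : Fin m) (j : Fin n) : ℝ :=
  vecL1 (fun i' => A i' j) ^ 2 / (∑ j', vecL1 (fun i' => A i' j') ^ 2) *
    (|A i j| / vecL1 (fun i' => A i' j))

/-- The probability `min(1, s · max(p⁽¹⁾, p⁽²⁾, p⁽³⁾))` with which an entry is kept. -/
def keepProb {m n : ℕ} (A : Matrix (Fin m) (Fin n) ℝ) (s : ℝ) (i : Fin m) (j : Fin n) : ℝ :=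
  min 1 (s * max (prob1 A i j) (max (prob2 A i j) (prob3 A i j)))

/-- The random matrix `B` arises from `A` by keeping the entries independently, entry `(i, j)`
with probability `p i j`; a kept entry is divided by its probability, the others become `0`. -/
def IsEntrywiseSample {Ω : Type*} [MeasurableSpace Ω] (μ : Measure Ω) {m n : ℕ}
    (A : Matrix (Fin m) (Fin n) ℝ) (p : Fin m → Fin n → ℝ)
    (B : Ω → Matrix (Fin m) (Fin n) ℝ) : Prop :=
  ∃ kept : Fin m × Fin n → Set Ω,
    (∀ q, MeasurableSet (kept q)) ∧
    iIndepSet kept μ ∧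
    (∀ q, μ.real (kept q) = p q.1 q.2) ∧
    ∀ ω i j, (ω ∈ kept (i, j) → B ω i j = A i j / p i j) ∧ (ω ∉ kept (i, j) → B ω i j = 0)

/-! ### Randomized real RAM

A real RAM with unit-cost instructions.  It has registers and arrays of natural numbers (used as
counters, indices and addresses, with addition and truncated subtraction only) and registers and
arrays of real numbers (with field operations, square root and natural logarithm).  A natural
number can be read as a real number, but there is no rounding in the other direction.  A random
instruction returns a fresh independent uniform element of `[0, 1]`.  Programs are finite and are
built with sequencing, branching and loops; every instruction and every test takes one step.
Division by zero returns `0`, so it does not stop the machine. -/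

/-- A memory configuration; `pos` counts the random numbers drawn so far. -/
structure State where
  nreg : ℕ → ℕ
  rreg : ℕ → ℝ
  narr : ℕ → ℕ → ℕ
  rarr : ℕ → ℕ → ℝ
  pos : ℕ

/-- Instructions.  `d` is the destination register and `a`, `b` are source registers; arrays are
named by a constant `X` and are indexed by the content of the natural register `k`. -/
inductive Instr where
  | nconst (d v : ℕ)
  | nadd (d a b : ℕ)
  | nsub (d a b : ℕ)
  | nload (d X k : ℕ)
  | nstore (X k a : ℕ)
  | rconst (d : ℕ) (v : ℚ)
  | rcast (d a : ℕ)
  | radd (d a b : ℕ)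
  | rsub (d a b : ℕ)
  | rmul (d a b : ℕ)
  | rdiv (d a b : ℕ)
  | rsqrt (d a : ℕ)
  | rlog (d a : ℕ)
  | rload (d X k : ℕ)
  | rstore (X k a : ℕ)
  | rrand (d : ℕ)

/-- Overwrite a natural register. -/
def State.setN (σ : State) (d v : ℕ) : State := { σ with nreg := Function.update σ.nreg d v }

/-- Overwrite a real register. -/
def State.setR (σ : State) (d : ℕ) (v : ℝ) : State :=
  { σ with rreg := Function.update σ.rreg d v }

/-- Effect of an instruction when the random source delivers the numbers `ω 0, ω 1, …`. -/
def Instr.step (ω : ℕ → unitInterval) (σ : State) : Instr → State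
  | .nconst d v => σ.setN d v
  | .nadd d a b => σ.setN d (σ.nreg a + σ.nreg b)
  | .nsub d a b => σ.setN d (σ.nreg a - σ.nreg b)
  | .nload d X k => σ.setN d (σ.narr X (σ.nreg k))
  | .nstore X k a =>
      { σ with
        narr := Function.update σ.narr X (Function.update (σ.narr X) (σ.nreg k) (σ.nreg a)) }
  | .rconst d v => σ.setR d (v : ℝ)
  | .rcast d a => σ.setR d (σ.nreg a : ℝ)
  | .radd d a b => σ.setR d (σ.rreg a + σ.rreg b)
  | .rsub d a b => σ.setR d (σ.rreg a - σ.rreg b)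
  | .rmul d a b => σ.setR d (σ.rreg a * σ.rreg b)
  | .rdiv d a b => σ.setR d (σ.rreg a / σ.rreg b)
  | .rsqrt d a => σ.setR d (Real.sqrt (σ.rreg a))
  | .rlog d a => σ.setR d (Real.log (σ.rreg a))
  | .rload d X k => σ.setR d (σ.rarr X (σ.nreg k))
  | .rstore X k a =>
      { σ with
        rarr := Function.update σ.rarr X (Function.update (σ.rarr X) (σ.nreg k) (σ.rreg a)) }
  | .rrand d => { σ.setR d (ω σ.pos : ℝ) with pos := σ.pos + 1 }

/-- Tests: comparison of two natural or of two real registers. -/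
inductive Test where
  | nlt (a b : ℕ)
  | rlt (a b : ℕ)

/-- Truth value of a test. -/
def Test.holds (σ : State) : Test → Prop
  | .nlt a b => σ.nreg a < σ.nreg b
  | .rlt a b => σ.rreg a < σ.rreg b

/-- Programs. -/
inductive Prog where
  | skip
  | instr (c : Instr)
  | seq (P Q : Prog)
  | cond (b : Test) (P Q : Prog)
  | loop (b : Test) (P : Prog)

/-- `Exec ω P σ σ' t`: with random source `ω`, the program `P` started in `σ` halts in `σ'`
after exactly `t` steps. -/
inductive Exec (ω : ℕ → unitInterval) : Prog → State → State → ℕ → Prop where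
  | skip (σ : State) : Exec ω .skip σ σ 1
  | instr (c : Instr) (σ : State) : Exec ω (.instr c) σ (c.step ω σ) 1
  | seq {P Q : Prog} {σ₁ σ₂ σ₃ : State} {t u : ℕ} :
      Exec ω P σ₁ σ₂ t → Exec ω Q σ₂ σ₃ u → Exec ω (.seq P Q) σ₁ σ₃ (t + u)
  | cond_pos {b : Test} {P Q : Prog} {σ₁ σ₂ : State} {t : ℕ} :
      b.holds σ₁ → Exec ω P σ₁ σ₂ t → Exec ω (.cond b P Q) σ₁ σ₂ (t + 1)
  | cond_neg {b : Test} {P Q : Prog} {σ₁ σ₂ : State} {t : ℕ} :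
      ¬ b.holds σ₁ → Exec ω Q σ₁ σ₂ t → Exec ω (.cond b P Q) σ₁ σ₂ (t + 1)
  | loop_stop {b : Test} {P : Prog} {σ : State} :
      ¬ b.holds σ → Exec ω (.loop b P) σ σ 1
  | loop_step {b : Test} {P : Prog} {σ₁ σ₂ σ₃ : State} {t u : ℕ} :
      b.holds σ₁ → Exec ω P σ₁ σ₂ t → Exec ω (.loop b P) σ₂ σ₃ u →
      Exec ω (.loop b P) σ₁ σ₃ (t + u + 1)

/-- The law of the random source: independent uniform numbers in `[0, 1]`. -/
def tapeMeasure : Measure (ℕ → unitInterval) :=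
  Measure.infinitePi (fun _ : ℕ => (volume : Measure unitInterval))

/-- Initial memory: natural registers `0, 1, 2` hold `m`, `n` and `nnz A`, the real registers
`0, 1` hold `ε` and `L`, and the arrays hold the rows, columns and values of the non-zero
entries of `A`, listed in the order `e`.  Everything else is `0`. -/
def inputState {m n : ℕ} (A : Matrix (Fin m) (Fin n) ℝ) (e : Fin (nnz A) ≃ Supp A)
    (ε L : ℝ) : State where
  nreg := fun x => if x = 0 then m else if x = 1 then n else if x = 2 then nnz A else 0
  rreg := fun x => if x = 0 then ε else if x = 1 then L else 0
  narr := fun X k =>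
    if h : k < nnz A then
      if X = 0 then ((e ⟨k, h⟩).1.1 : ℕ) else if X = 1 then ((e ⟨k, h⟩).1.2 : ℕ) else 0
    else 0
  rarr := fun X k =>
    if h : k < nnz A then
      if X = 0 then A (e ⟨k, h⟩).1.1 (e ⟨k, h⟩).1.2 else 0
    else 0
  pos := 0

/-- The final memory contains the matrix `B`: natural register `3` holds `nnz B`, and natural
arrays `2, 3` and real array `1` list the rows, columns and values of the non-zero entries of
`B`, each exactly once and in some order. -/
def Outputs {m n : ℕ} (σ : State) (B : Matrix (Fin m) (Fin n) ℝ) : Prop :=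
  σ.nreg 3 = nnz B ∧
  ∃ e : Fin (nnz B) ≃ Supp B, ∀ k : Fin (nnz B),
    σ.narr 2 k = ((e k).1.1 : ℕ) ∧ σ.narr 3 k = ((e k).1.2 : ℕ) ∧
    σ.rarr 1 k = B (e k).1.1 (e k).1.2

/-- The guarantee for the random output `B`, as a function of the random source: it is the
entrywise sample of `A` for some parameter `s`, it is an `ε`-spectral-norm approximation of `A`
with probability at least `1 - m^{-c}`, and its expected number of non-zero entries is at most `C`
times `ε⁻² ns(A) sr(A) ln m + ε⁻¹ √(ns(A) sr(A) n) ln m`. -/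
def IsGoodSparsifier {m n : ℕ} (A : Matrix (Fin m) (Fin n) ℝ) (ε c C : ℝ)
    (B : (ℕ → unitInterval) → Matrix (Fin m) (Fin n) ℝ) : Prop :=
  (∃ s : ℝ, 0 ≤ s ∧ (2 ≤ m → 0 < s) ∧ IsEntrywiseSample tapeMeasure A (keepProb A s) B) ∧
  1 - (m : ℝ) ^ (-c) ≤ tapeMeasure.real {ω | specNorm (A - B ω) ≤ ε * specNorm A} ∧
  Integrable (fun ω => (nnz (B ω) : ℝ)) tapeMeasure ∧
  ∫ ω, (nnz (B ω) : ℝ) ∂tapeMeasure ≤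
    C * ((ε ^ 2)⁻¹ * ns A * sr A * Real.log m +
      ε⁻¹ * Real.sqrt (ns A * sr A * n) * Real.log m)

end

end Sparsify

/-!
Let `S₁ = ∑ |A i j|` and let `S₂`, `S₃` be the sums of the squared `ℓ₁` norms of the rows and of the
columns.  The algorithm computes the rate `s = K * log m * (S₁ / (ε L) + (S₂ + S₃) / (ε L) ^ 2)`, with
`L` the estimate of the spectral norm, and then decides about each entry by one uniform number.

*Size of the sample.*  Each of the three distributions has total mass at most `1`, so the expected
number of kept entries is at most `3 * s`.  The definition of the numerical sparsity gives
`S₂, S₃ ≤ ns A * ‖A‖_F ^ 2` and, by the Cauchy–Schwarz inequality over the columns,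
`S₁ ≤ √(n * ns A) * ‖A‖_F`; this is the required bound (`three_mul_sampleRate_le`).

*Error.*  The first distribution bounds each entry of `A - B` by `R = S₁ / s`, the other two bound the
sum of the variances over each row and each column by `σ = (S₂ + S₃) / s`.  The tail bound is proved
with moments of the Hermitian dilation `Z` of `A - B`, a sum of independent centred multiples of
matrices `H q` whose squares are diagonal.  Resampling one coordinate at a time, together with the
trace inequality `trace_sub_mul_pow_sub_pow_le`, gives
`𝔼 tr Z ^ (2p) ≤ (2p - 1) / 2 * 𝔼 ∑ v, D v * (Z ^ (2p - 2)) v v` for the diagonal quadratic variation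
`D` (`finExp_trace_pow_le`).  Young's inequality turns this into a bound by `∑ v, 𝔼 (D v) ^ p`
(`finExp_trace_pow_le_diagVar`), and `D v` is a scalar sum of independent bounded terms, whose moments
follow from its exponential moment (`finExp_diagVar_pow_le`).  Markov's inequality with `p` about
`(c + 2) * log m` ends the estimate (`finExp_specNorm_gt_le`, `one_sub_rpow_le_sampleMat`).

*Programs.*  The sampler makes three passes over the list of entries, for the `ℓ₁` norms of the rows
and columns, for `S₂` and `S₃`, and for the sampling itself; each step of a pass takes a bounded number
of instructions (`exec_sampler_outputs`).  Without an estimate of the spectral norm, there is no bound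
on the running time to respect, and the program first replaces `M` by `M * Mᵀ` repeatedly, starting
from `A`, on lists of entries in which a position may occur several times.  After `m` squarings the
squared Frobenius norm is within a factor `m` of `‖A‖₂ ^ (2 ^ (m + 1))`, and `m + 1` square roots reduce
this factor to less than `2` (`exec_normEstimate`, `normEst_le`).
-/

namespace Sparsify

/-! ### Real symmetric matrices -/

section Symmetric

open Matrix Finset

theorem pow_mul_pow_add_le {x y : ℝ} {i j : ℕ} (h : Even (i + j)) :
    x ^ i * y ^ j + x ^ j * y ^ i ≤ x ^ (i + j) + y ^ (i + j) := by
  have key : 0 ≤ (|x| ^ i - |y| ^ i) * (|x| ^ j - |y| ^ j) := by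
    rcases le_total |x| |y| with hxy | hxy
    · exact mul_nonneg_of_nonpos_of_nonpos (sub_nonpos.2 (pow_le_pow_left₀ (abs_nonneg _) hxy _))
        (sub_nonpos.2 (pow_le_pow_left₀ (abs_nonneg _) hxy _))
    · exact mul_nonneg (sub_nonneg.2 (pow_le_pow_left₀ (abs_nonneg _) hxy _))
        (sub_nonneg.2 (pow_le_pow_left₀ (abs_nonneg _) hxy _))
  have h1 : x ^ i * y ^ j ≤ |x| ^ i * |y| ^ j := by
    rw [← abs_pow, ← abs_pow, ← abs_mul]; exact le_abs_self _
  have h2 : x ^ j * y ^ i ≤ |x| ^ j * |y| ^ i := by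
    rw [← abs_pow, ← abs_pow, ← abs_mul]; exact le_abs_self _
  rw [← h.pow_abs x, ← h.pow_abs y, pow_add, pow_add]
  linarith

/-- The scalar case of `trace_sub_mul_pow_sub_pow_le`. -/
theorem sub_mul_pow_sub_pow_le (x y : ℝ) (r : ℕ) :
    (x - y) * (x ^ (2 * r + 1) - y ^ (2 * r + 1)) ≤
      (2 * r + 1) / 2 * ((x - y) ^ 2 * (x ^ (2 * r) + y ^ (2 * r))) := by
  have hg := (Commute.all x y).geom_sum₂_mul (2 * r + 1)
  set S := ∑ i ∈ range (2 * r + 1), x ^ i * y ^ (2 * r + 1 - 1 - i) with hS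
  have hS' : S = ∑ i ∈ range (2 * r + 1), x ^ (2 * r + 1 - 1 - i) * y ^ i := by
    rw [hS, ← Finset.sum_range_reflect]
    refine Finset.sum_congr rfl fun i hi => ?_
    rw [Finset.mem_range] at hi
    congr 2
    omega
  have h2 : 2 * S ≤ (2 * r + 1) * (x ^ (2 * r) + y ^ (2 * r)) := by
    have : 2 * S = ∑ i ∈ range (2 * r + 1),
        (x ^ i * y ^ (2 * r + 1 - 1 - i) + x ^ (2 * r + 1 - 1 - i) * y ^ i) := by
      rw [Finset.sum_add_distrib, ← hS, ← hS']; ring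
    rw [this]
    calc _ ≤ ∑ _i ∈ range (2 * r + 1), (x ^ (2 * r) + y ^ (2 * r)) := by
          refine Finset.sum_le_sum fun i hi => ?_
          rw [Finset.mem_range] at hi
          have e : i + (2 * r + 1 - 1 - i) = 2 * r := by omega
          have := pow_mul_pow_add_le (x := x) (y := y) (i := i) (j := 2 * r + 1 - 1 - i)
            (by rw [e]; exact even_two_mul r)
          rwa [e] at this
      _ = _ := by simp; ring
  rw [← hg]
  nlinarith [mul_le_mul_of_nonneg_left h2 (sq_nonneg (x - y))]

/-- The tangent line of `t ↦ t ^ (r + 1)` at `t` evaluated at `a`, which is the form of Young's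
inequality used for the moments. -/
theorem young_pow {a t : ℝ} (ha : 0 ≤ a) (ht : 0 ≤ t) (r : ℕ) :
    (r + 1) * (a * t ^ r) ≤ a ^ (r + 1) + r * t ^ (r + 1) := by
  rcases ht.eq_or_lt with rfl | ht
  · rcases r with _ | r
    · simp
    · simp; positivity
  · have h := one_add_mul_sub_le_pow (a := a / t) (by have := div_nonneg ha ht.le; linarith) (r + 1)
    have h' := mul_le_mul_of_nonneg_right h (pow_nonneg ht.le (r + 1))
    rw [div_pow, div_mul_cancel₀ _ (by positivity)] at h'
    have e : (1 + ((r + 1 : ℕ) : ℝ) * (a / t - 1)) * t ^ (r + 1) =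
        (r + 1) * (a * t ^ r) - r * t ^ (r + 1) := by
      push_cast
      field_simp
      ring
    linarith

variable {V : Type*} [Fintype V] [DecidableEq V]

theorem exists_diagonalization {Z : Matrix V V ℝ} (hZ : Zᵀ = Z) :
    ∃ (U : Matrix V V ℝ) (d : V → ℝ), U * Uᵀ = 1 ∧ Uᵀ * U = 1 ∧
      ∀ k : ℕ, Z ^ k = U * diagonal (fun i => d i ^ k) * Uᵀ := by
  have hH : Z.IsHermitian := by rw [Matrix.IsHermitian, conjTranspose_eq_transpose_of_trivial, hZ]
  have h1 : (hH.eigenvectorUnitary : Matrix V V ℝ) *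
      (hH.eigenvectorUnitary : Matrix V V ℝ)ᵀ = 1 := by
    have := Unitary.coe_mul_star_self hH.eigenvectorUnitary
    rwa [Unitary.coe_star, star_eq_conjTranspose, conjTranspose_eq_transpose_of_trivial] at this
  have h2 : (hH.eigenvectorUnitary : Matrix V V ℝ)ᵀ *
      (hH.eigenvectorUnitary : Matrix V V ℝ) = 1 := by
    have := Unitary.coe_star_mul_self hH.eigenvectorUnitary
    rwa [star_eq_conjTranspose, conjTranspose_eq_transpose_of_trivial] at this
  have h3 : Z = (hH.eigenvectorUnitary : Matrix V V ℝ) * diagonal hH.eigenvalues *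
      (hH.eigenvectorUnitary : Matrix V V ℝ)ᵀ := by
    have := hH.spectral_theorem
    rw [Unitary.conjStarAlgAut_apply, star_eq_conjTranspose,
      conjTranspose_eq_transpose_of_trivial] at this
    exact this
  refine ⟨_, hH.eigenvalues, h1, h2, fun k => ?_⟩
  generalize (hH.eigenvectorUnitary : Matrix V V ℝ) = U at h1 h2 h3
  generalize hH.eigenvalues = d at h3
  induction k with
  | zero => simp [h1]
  | succ k ih =>
    rw [pow_succ, ih, h3]
    calc _ = U * diagonal (fun i => d i ^ k) * (Uᵀ * U) * diagonal d * Uᵀ := by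
          simp only [Matrix.mul_assoc]
      _ = _ := by
          rw [h2, Matrix.mul_one, Matrix.mul_assoc U, diagonal_mul_diagonal]
          simp only [pow_succ]

theorem trace_mul_transpose_mul_diagonal (M N : Matrix V V ℝ) (d : V → ℝ) :
    trace (M * Nᵀ * diagonal d) = ∑ i, d i * ∑ j, M i j * N i j := by
  rw [trace]
  refine Finset.sum_congr rfl fun i _ => ?_
  rw [diag_apply, mul_diagonal, mul_apply, mul_comm]
  rfl

/-- Mean value trace inequality: in eigenbases of `A` and `B` it reduces to its scalar case, with
the squared entries of the change of basis as weights. -/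
theorem trace_sub_mul_pow_sub_pow_le {A B : Matrix V V ℝ} (hA : Aᵀ = A) (hB : Bᵀ = B) (r : ℕ) :
    trace ((A - B) * (A ^ (2 * r + 1) - B ^ (2 * r + 1))) ≤
      (2 * r + 1) / 2 * trace ((A - B) ^ 2 * (A ^ (2 * r) + B ^ (2 * r))) := by
  obtain ⟨U, d, hU, hU', hAk⟩ := exists_diagonalization hA
  obtain ⟨W, f, hW, hW', hBk⟩ := exists_diagonalization hB
  have hA1 : A = U * diagonal d * Uᵀ := by simpa using hAk 1
  have hB1 : B = W * diagonal f * Wᵀ := by simpa using hBk 1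
  set O := Uᵀ * W with hO
  set G := Uᵀ * (A - B) * W with hG
  have hGe : ∀ i j, G i j = (d i - f j) * O i j := by
    intro i j
    have : G = diagonal d * O - O * diagonal f := by
      rw [hG, Matrix.mul_sub, Matrix.sub_mul, hA1, hB1]
      congr 1
      · calc _ = (Uᵀ * U) * diagonal d * (Uᵀ * W) := by simp only [Matrix.mul_assoc]
          _ = _ := by rw [hU', Matrix.one_mul]
      · calc _ = (Uᵀ * W) * diagonal f * (Wᵀ * W) := by simp only [Matrix.mul_assoc]
          _ = _ := by rw [hW', Matrix.mul_one]
    rw [this, Matrix.sub_apply, diagonal_mul, mul_diagonal]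
    ring
  have hD : (A - B)ᵀ = A - B := by rw [transpose_sub, hA, hB]
  have hGT : Gᵀ = Wᵀ * (A - B) * U := by
    rw [hG, transpose_mul, transpose_mul, hD, transpose_transpose, Matrix.mul_assoc]
  have hOT : Oᵀ = Wᵀ * U := by rw [hO, transpose_mul, transpose_transpose]
  -- the four traces in the two eigenbases
  have t1 : ∀ k, trace ((A - B) * A ^ k) = ∑ i, d i ^ k * ∑ j, G i j * O i j := by
    intro k
    have : trace ((A - B) * A ^ k) = trace (O * Gᵀ * diagonal (fun i => d i ^ k)) := by
      rw [hAk, ← Matrix.mul_assoc, trace_mul_comm, hGT, hO]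
      congr 1
      calc _ = Uᵀ * (A - B) * U * diagonal (fun i => d i ^ k) := by
            simp only [Matrix.mul_assoc]
        _ = Uᵀ * (W * Wᵀ) * (A - B) * U * diagonal (fun i => d i ^ k) := by
            rw [hW, Matrix.mul_one]
        _ = _ := by simp only [Matrix.mul_assoc]
    rw [this, trace_mul_transpose_mul_diagonal]
    exact Finset.sum_congr rfl fun i _ => by
      congr 1; exact Finset.sum_congr rfl fun j _ => mul_comm _ _
  have t2 : ∀ k, trace ((A - B) * B ^ k) = ∑ j, f j ^ k * ∑ i, G i j * O i j := by
    intro k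
    have : trace ((A - B) * B ^ k) = trace (Oᵀ * G * diagonal (fun i => f i ^ k)) := by
      rw [hBk, ← Matrix.mul_assoc, trace_mul_comm, hOT, hG]
      congr 1
      calc _ = Wᵀ * (A - B) * W * diagonal (fun i => f i ^ k) := by
            simp only [Matrix.mul_assoc]
        _ = Wᵀ * (U * Uᵀ) * (A - B) * W * diagonal (fun i => f i ^ k) := by
            rw [hU, Matrix.mul_one]
        _ = _ := by simp only [Matrix.mul_assoc]
    rw [this, ← transpose_transpose G, trace_mul_transpose_mul_diagonal]
    exact Finset.sum_congr rfl fun i _ => by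
      congr 1; exact Finset.sum_congr rfl fun j _ => mul_comm _ _
  have t3 : ∀ k, trace ((A - B) ^ 2 * A ^ k) = ∑ i, d i ^ k * ∑ j, G i j * G i j := by
    intro k
    have : trace ((A - B) ^ 2 * A ^ k) = trace (G * Gᵀ * diagonal (fun i => d i ^ k)) := by
      rw [hAk, ← Matrix.mul_assoc, trace_mul_comm, hGT, hG, pow_two]
      congr 1
      calc _ = Uᵀ * (A - B) * 1 * (A - B) * U * diagonal (fun i => d i ^ k) := by
            simp only [Matrix.mul_assoc, Matrix.one_mul]
        _ = _ := by rw [← hW]; simp only [Matrix.mul_assoc]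
    rw [this, trace_mul_transpose_mul_diagonal]
  have t4 : ∀ k, trace ((A - B) ^ 2 * B ^ k) = ∑ j, f j ^ k * ∑ i, G i j * G i j := by
    intro k
    have : trace ((A - B) ^ 2 * B ^ k) = trace (Gᵀ * G * diagonal (fun i => f i ^ k)) := by
      rw [hBk, ← Matrix.mul_assoc, trace_mul_comm, hGT, hG, pow_two]
      congr 1
      calc _ = Wᵀ * (A - B) * 1 * (A - B) * W * diagonal (fun i => f i ^ k) := by
            simp only [Matrix.mul_assoc, Matrix.one_mul]
        _ = _ := by rw [← hU]; simp only [Matrix.mul_assoc]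
    rw [this, ← transpose_transpose G, trace_mul_transpose_mul_diagonal]
    rfl
  have e1 : trace ((A - B) * (A ^ (2 * r + 1) - B ^ (2 * r + 1))) =
      ∑ i, ∑ j, O i j ^ 2 * ((d i - f j) * (d i ^ (2 * r + 1) - f j ^ (2 * r + 1))) := by
    rw [Matrix.mul_sub, trace_sub, t1, t2]
    simp only [Finset.mul_sum]
    rw [Finset.sum_comm (f := fun j i => f j ^ _ * _), ← Finset.sum_sub_distrib]
    refine Finset.sum_congr rfl fun i _ => ?_
    rw [← Finset.sum_sub_distrib]
    refine Finset.sum_congr rfl fun j _ => ?_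
    rw [hGe]; ring
  have e2 : trace ((A - B) ^ 2 * (A ^ (2 * r) + B ^ (2 * r))) =
      ∑ i, ∑ j, O i j ^ 2 * ((d i - f j) ^ 2 * (d i ^ (2 * r) + f j ^ (2 * r))) := by
    rw [Matrix.mul_add, trace_add, t3, t4]
    simp only [Finset.mul_sum]
    rw [Finset.sum_comm (f := fun j i => f j ^ _ * _), ← Finset.sum_add_distrib]
    refine Finset.sum_congr rfl fun i _ => ?_
    rw [← Finset.sum_add_distrib]
    refine Finset.sum_congr rfl fun j _ => ?_
    rw [hGe]; ring
  rw [e1, e2, Finset.mul_sum]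
  refine Finset.sum_le_sum fun i _ => ?_
  rw [Finset.mul_sum]
  refine Finset.sum_le_sum fun j _ => ?_
  have := mul_le_mul_of_nonneg_left (sub_mul_pow_sub_pow_le (d i) (f j) r) (sq_nonneg (O i j))
  linarith

theorem pow_apply_self {Z U : Matrix V V ℝ} {d : V → ℝ} {k : ℕ}
    (h : Z ^ k = U * diagonal (fun i => d i ^ k) * Uᵀ) (v : V) :
    (Z ^ k) v v = ∑ i, U v i ^ 2 * d i ^ k := by
  rw [h, mul_apply]
  refine Finset.sum_congr rfl fun i _ => ?_
  rw [mul_diagonal, transpose_apply]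
  ring

/-- Young's inequality for a diagonal entry of a power of a symmetric matrix. -/
theorem young_pow_apply_self {Z : Matrix V V ℝ} (hZ : Zᵀ = Z) {a : ℝ} (ha : 0 ≤ a) (r : ℕ) (v : V) :
    (r + 1) * (a * (Z ^ (2 * r)) v v) ≤ a ^ (r + 1) + r * (Z ^ (2 * (r + 1))) v v := by
  obtain ⟨U, d, hU, -, hk⟩ := exists_diagonalization hZ
  have h1 : ∑ i, U v i ^ 2 = 1 := by
    have := congr_fun (congr_fun hU v) v
    rw [mul_apply, one_apply_eq] at this
    rw [← this]
    exact Finset.sum_congr rfl fun i _ => by rw [transpose_apply, pow_two]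
  rw [pow_apply_self (hk _), pow_apply_self (hk _)]
  calc _ = ∑ i, U v i ^ 2 * ((r + 1) * (a * (d i ^ 2) ^ r)) := by
        rw [Finset.mul_sum, Finset.mul_sum]
        refine Finset.sum_congr rfl fun i _ => ?_
        rw [← pow_mul]; ring
    _ ≤ ∑ i, U v i ^ 2 * (a ^ (r + 1) + r * (d i ^ 2) ^ (r + 1)) :=
        Finset.sum_le_sum fun i _ =>
          mul_le_mul_of_nonneg_left (young_pow ha (sq_nonneg _) r) (sq_nonneg _)
    _ = _ := by
        simp only [mul_add, Finset.sum_add_distrib, ← Finset.sum_mul, h1, one_mul]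
        rw [Finset.mul_sum]
        congr 1
        refine Finset.sum_congr rfl fun i _ => ?_
        rw [← pow_mul]; ring

/-- An even moment of the spectrum dominates the corresponding power of the operator norm. -/
theorem mulVec_sq_le_of_trace_pow_le {Z : Matrix V V ℝ} (hZ : Zᵀ = Z) {τ : ℝ} {p : ℕ}
    (hp : p ≠ 0) (h : trace (Z ^ (2 * p)) ≤ τ ^ (2 * p)) (w : V → ℝ) :
    (Z *ᵥ w) ⬝ᵥ (Z *ᵥ w) ≤ τ ^ 2 * (w ⬝ᵥ w) := by
  obtain ⟨U, d, hU, hU', hk⟩ := exists_diagonalization hZ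
  have htr : trace (Z ^ (2 * p)) = ∑ i, (d i ^ 2) ^ p := by
    rw [hk, trace_mul_comm, ← Matrix.mul_assoc, hU', Matrix.one_mul, trace_diagonal]
    simp only [pow_mul]
  have hd : ∀ i, d i ^ 2 ≤ τ ^ 2 := by
    intro i
    refine le_of_pow_le_pow_left₀ hp (sq_nonneg _) ?_
    rw [← pow_mul τ]
    refine le_trans ?_ h
    rw [htr]
    exact Finset.single_le_sum (f := fun i => (d i ^ 2) ^ p) (fun j _ => by positivity)
      (Finset.mem_univ i)
  have e1 : (Z *ᵥ w) ⬝ᵥ (Z *ᵥ w) = ∑ i, d i ^ 2 * (Uᵀ *ᵥ w) i ^ 2 := by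
    have : (Z *ᵥ w) ⬝ᵥ (Z *ᵥ w) = w ⬝ᵥ ((Z ^ 2) *ᵥ w) := by
      rw [pow_two, ← mulVec_mulVec, dotProduct_mulVec w, ← mulVec_transpose, hZ]
    rw [this, hk 2, ← mulVec_mulVec, ← mulVec_mulVec, dotProduct_mulVec, ← mulVec_transpose,
      dotProduct]
    refine Finset.sum_congr rfl fun i _ => ?_
    rw [mulVec_diagonal]; ring
  have e2 : w ⬝ᵥ w = ∑ i, (Uᵀ *ᵥ w) i ^ 2 := by
    have : w ⬝ᵥ w = (Uᵀ *ᵥ w) ⬝ᵥ (Uᵀ *ᵥ w) := by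
      rw [dotProduct_mulVec, ← mulVec_transpose, transpose_transpose, mulVec_mulVec, hU,
        one_mulVec]
    rw [this, dotProduct]
    exact Finset.sum_congr rfl fun i _ => by rw [pow_two]
  rw [e1, e2, Finset.mul_sum]
  exact Finset.sum_le_sum fun i _ => mul_le_mul_of_nonneg_right (hd i) (sq_nonneg _)

end Symmetric

/-! ### Independent coordinates with finitely many values -/

section FiniteProduct

set_option linter.unusedSectionVars false

open Finset Matrix

variable {ι α V : Type*} [Fintype ι] [DecidableEq ι] [Fintype α] [Fintype V] [DecidableEq V]

/-- The probability of the outcome `b` when the coordinates are independent and coordinate `q`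
takes the value `a` with probability `w q a`. -/
noncomputable def prodWeight (w : ι → α → ℝ) (b : ι → α) : ℝ := ∏ q, w q (b q)

/-- The expectation under `prodWeight`. -/
noncomputable def finExp (w : ι → α → ℝ) (f : (ι → α) → ℝ) : ℝ := ∑ b, prodWeight w b * f b

theorem prodWeight_nonneg {w : ι → α → ℝ} (hw : ∀ q a, 0 ≤ w q a) (b : ι → α) :
    0 ≤ prodWeight w b := Finset.prod_nonneg fun q _ => hw q _

theorem finExp_mono {w : ι → α → ℝ} (hw : ∀ q a, 0 ≤ w q a) {f g : (ι → α) → ℝ}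
    (h : ∀ b, prodWeight w b ≠ 0 → f b ≤ g b) : finExp w f ≤ finExp w g := by
  refine Finset.sum_le_sum fun b _ => ?_
  by_cases hb : prodWeight w b = 0
  · simp [hb]
  · exact mul_le_mul_of_nonneg_left (h b hb) (prodWeight_nonneg hw b)

theorem finExp_sum {κ : Type*} (s : Finset κ) (w : ι → α → ℝ) (f : κ → (ι → α) → ℝ) :
    finExp w (fun b => ∑ k ∈ s, f k b) = ∑ k ∈ s, finExp w (f k) := by
  simp only [finExp, Finset.mul_sum]
  exact Finset.sum_comm

theorem finExp_const_mul (w : ι → α → ℝ) (c : ℝ) (f : (ι → α) → ℝ) :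
    finExp w (fun b => c * f b) = c * finExp w f := by
  simp only [finExp, Finset.mul_sum]
  exact Finset.sum_congr rfl fun b _ => by ring

theorem finExp_add (w : ι → α → ℝ) (f g : (ι → α) → ℝ) :
    finExp w (fun b => f b + g b) = finExp w f + finExp w g := by
  simp only [finExp, mul_add, Finset.sum_add_distrib]

/-- The expectation of a product of functions of distinct coordinates factorizes. -/
theorem finExp_prod (w : ι → α → ℝ) (g : ι → α → ℝ) :
    finExp w (fun b => ∏ q, g q (b q)) = ∏ q, ∑ a, w q a * g q a := by
  rw [Fintype.prod_sum]
  exact Finset.sum_congr rfl fun b _ => by rw [prodWeight, ← Finset.prod_mul_distrib]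

theorem prodWeight_update_mul (w : ι → α → ℝ) (b : ι → α) (q : ι) (c : α) :
    prodWeight w (Function.update b q c) * w q (b q) = prodWeight w b * w q c := by
  simp only [prodWeight]
  rw [← Finset.mul_prod_erase _ _ (Finset.mem_univ q),
    ← Finset.mul_prod_erase _ (fun x => w x (b x)) (Finset.mem_univ q), Function.update_self]
  rw [Finset.prod_congr rfl (g := fun x => w x (b x))]
  · ring
  · intro x hx
    rw [Function.update_of_ne (Finset.ne_of_mem_erase hx)]

/-- An outcome and the outcome with coordinate `q` drawn afresh form an exchangeable pair. -/
theorem sum_resample_symm (w : ι → α → ℝ) (q : ι) (F : (ι → α) → α → ℝ) :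
    ∑ b, ∑ c, prodWeight w b * w q c * F b c =
      ∑ b, ∑ c, prodWeight w b * w q c * F (Function.update b q c) (b q) := by
  have inv : Function.Involutive
      (fun x : (ι → α) × α => (Function.update x.1 q x.2, x.1 q)) := by
    rintro ⟨b, c⟩
    simp
  rw [← Fintype.sum_prod_type' (f := fun b c => prodWeight w b * w q c * F b c),
    ← Fintype.sum_prod_type'
      (f := fun b c => prodWeight w b * w q c * F (Function.update b q c) (b q)),
    ← Equiv.sum_comp (Function.Involutive.toPerm _ inv)]
  refine Finset.sum_congr rfl fun x _ => ?_
  simp only [Function.Involutive.coe_toPerm]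
  rw [prodWeight_update_mul]

theorem finExp_mul_eq_resample {w : ι → α → ℝ} {q : ι} (hw : ∑ c, w q c = 1) {x : α → ℝ}
    (hx : ∑ c, w q c * x c = 0) (g : (ι → α) → ℝ) :
    finExp w (fun b => x (b q) * g b) = 1 / 2 * ∑ b, ∑ c, prodWeight w b * w q c *
      ((x (b q) - x c) * (g b - g (Function.update b q c))) := by
  have s1 : ∑ b, ∑ c, prodWeight w b * w q c * (x (b q) * g b) =
      finExp w (fun b => x (b q) * g b) := by
    refine Finset.sum_congr rfl fun b _ => ?_
    calc _ = (∑ c, w q c) * (prodWeight w b * (x (b q) * g b)) := by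
          rw [Finset.sum_mul]; exact Finset.sum_congr rfl fun c _ => by ring
      _ = _ := by rw [hw, one_mul]
  have s2 : ∑ b, ∑ c, prodWeight w b * w q c * (x c * g b) = 0 := by
    refine Finset.sum_eq_zero fun b _ => ?_
    calc _ = (∑ c, w q c * x c) * (prodWeight w b * g b) := by
          rw [Finset.sum_mul]; exact Finset.sum_congr rfl fun c _ => by ring
      _ = _ := by rw [hx, zero_mul]
  have s3 := sum_resample_symm w q (fun b c => x c * g b)
  have s4 := sum_resample_symm w q (fun b _ => x (b q) * g b)
  simp only [Function.update_self] at s3 s4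
  have : ∑ b, ∑ c, prodWeight w b * w q c *
      ((x (b q) - x c) * (g b - g (Function.update b q c))) =
      ∑ b, ∑ c, prodWeight w b * w q c * (x (b q) * g b)
      - ∑ b, ∑ c, prodWeight w b * w q c * (x c * g b)
      - ∑ b, ∑ c, prodWeight w b * w q c * (x (b q) * g (Function.update b q c))
      + ∑ b, ∑ c, prodWeight w b * w q c * (x c * g (Function.update b q c)) := by
    simp only [← Finset.sum_sub_distrib, ← Finset.sum_add_distrib]
    exact Finset.sum_congr rfl fun b _ => Finset.sum_congr rfl fun c _ => by ring
  rw [this, ← s3, ← s4, s1, s2]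
  ring

/-- The random matrix `∑ q, x q • H q` whose coefficients are functions of independent
coordinates. -/
noncomputable def randSum (H : ι → Matrix V V ℝ) (x : ι → α → ℝ) (b : ι → α) : Matrix V V ℝ :=
  ∑ q, x q (b q) • H q

/-- Diagonal entry `v` of `∑ q, (x q ^ 2 + 𝔼 x q ^ 2) • H q ^ 2`, where `H q ^ 2` is the diagonal
matrix with entries `h q`. -/
noncomputable def diagVar (w : ι → α → ℝ) (h : ι → V → ℝ) (x : ι → α → ℝ) (b : ι → α) (v : V) : ℝ :=
  ∑ q, h q v * (x q (b q) ^ 2 + ∑ c, w q c * x q c ^ 2)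

theorem randSum_transpose {H : ι → Matrix V V ℝ} (hH : ∀ q, (H q)ᵀ = H q) (x : ι → α → ℝ)
    (b : ι → α) : (randSum H x b)ᵀ = randSum H x b := by
  rw [randSum, transpose_sum]
  exact Finset.sum_congr rfl fun q _ => by rw [transpose_smul, hH]

theorem randSum_sub_update (H : ι → Matrix V V ℝ) (x : ι → α → ℝ) (b : ι → α) (q : ι) (c : α) :
    randSum H x b - randSum H x (Function.update b q c) = (x q (b q) - x q c) • H q := by
  rw [randSum, randSum, ← Finset.sum_sub_distrib, Finset.sum_eq_single q]
  · rw [Function.update_self, sub_smul]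
  · intro q' _ hq
    rw [Function.update_of_ne hq, sub_self]
  · simp

theorem trace_diagonal_mul (d : V → ℝ) (M : Matrix V V ℝ) :
    trace (diagonal d * M) = ∑ v, d v * M v v := by
  simp [trace, diagonal_mul]

/-- Resampling one coordinate and the mean value trace inequality bound the moment of order
`2 * r + 2` by an average of the moment of order `2 * r` against the diagonal quadratic
variation. -/
theorem finExp_trace_pow_le {w : ι → α → ℝ} (hw0 : ∀ q a, 0 ≤ w q a) (hw1 : ∀ q, ∑ a, w q a = 1)
    {x : ι → α → ℝ} (hx : ∀ q, ∑ c, w q c * x q c = 0)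
    {H : ι → Matrix V V ℝ} (hH : ∀ q, (H q)ᵀ = H q) {h : ι → V → ℝ}
    (hh : ∀ q, H q ^ 2 = diagonal (h q)) (r : ℕ) :
    finExp w (fun b => trace (randSum H x b ^ (2 * (r + 1)))) ≤
      (2 * r + 1) / 2 * finExp w
        (fun b => ∑ v, diagVar w h x b v * (randSum H x b ^ (2 * r)) v v) := by
  set Z := randSum H x with hZ
  set φ : ι → (ι → α) → ℝ := fun q b => ∑ v, h q v * (Z b ^ (2 * r)) v v with hφ
  have e1 : ∀ b, trace (Z b ^ (2 * (r + 1))) =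
      ∑ q, x q (b q) * trace (H q * Z b ^ (2 * r + 1)) := by
    intro b
    have : Z b ^ (2 * (r + 1)) = Z b * Z b ^ (2 * r + 1) := by
      rw [← pow_succ']; rfl
    rw [this]
    nth_rw 1 [hZ]
    rw [randSum, Finset.sum_mul, trace_sum]
    exact Finset.sum_congr rfl fun q _ => by rw [Matrix.smul_mul, trace_smul, smul_eq_mul]
  have key : ∀ q, finExp w (fun b => x q (b q) * trace (H q * Z b ^ (2 * r + 1))) ≤
      (2 * r + 1) / 2 * finExp w
        (fun b => (x q (b q) ^ 2 + ∑ c, w q c * x q c ^ 2) * φ q b) := by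
    intro q
    rw [finExp_mul_eq_resample (hw1 q) (hx q)]
    have bound : ∀ b c, (x q (b q) - x q c) * (trace (H q * Z b ^ (2 * r + 1)) -
        trace (H q * Z (Function.update b q c) ^ (2 * r + 1))) ≤
        (2 * r + 1) / 2 * ((x q (b q) - x q c) ^ 2 * φ q b +
          (x q c - x q (b q)) ^ 2 * φ q (Function.update b q c)) := by
      intro b c
      have h1 := trace_sub_mul_pow_sub_pow_le (randSum_transpose hH x b)
        (randSum_transpose hH x (Function.update b q c)) r
      rw [randSum_sub_update, ← hZ, smul_pow, hh, Matrix.smul_mul, Matrix.smul_mul, trace_smul,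
        trace_smul, smul_eq_mul, smul_eq_mul, Matrix.mul_sub, Matrix.mul_add, trace_sub,
        trace_add, trace_diagonal_mul, trace_diagonal_mul] at h1
      refine h1.trans (le_of_eq ?_)
      simp only [hφ]
      ring
    have step : ∑ b, ∑ c, prodWeight w b * w q c * ((x q (b q) - x q c) *
        (trace (H q * Z b ^ (2 * r + 1)) -
        trace (H q * Z (Function.update b q c) ^ (2 * r + 1)))) ≤
        (2 * r + 1) / 2 * (∑ b, ∑ c, prodWeight w b * w q c * ((x q (b q) - x q c) ^ 2 * φ q b) +
        ∑ b, ∑ c, prodWeight w b * w q c *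
          ((x q c - x q (b q)) ^ 2 * φ q (Function.update b q c))) := by
      rw [← Finset.sum_add_distrib, Finset.mul_sum]
      refine Finset.sum_le_sum fun b _ => ?_
      rw [← Finset.sum_add_distrib, Finset.mul_sum]
      refine Finset.sum_le_sum fun c _ => ?_
      have := mul_le_mul_of_nonneg_left (bound b c)
        (mul_nonneg (prodWeight_nonneg hw0 b) (hw0 q c))
      refine this.trans (le_of_eq ?_)
      ring
    have symm := sum_resample_symm w q (fun b c => (x q (b q) - x q c) ^ 2 * φ q b)
    simp only [Function.update_self] at symm
    rw [← symm] at step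
    have var : ∑ b, ∑ c, prodWeight w b * w q c * ((x q (b q) - x q c) ^ 2 * φ q b) =
        finExp w (fun b => (x q (b q) ^ 2 + ∑ c, w q c * x q c ^ 2) * φ q b) := by
      refine Finset.sum_congr rfl fun b _ => ?_
      change _ = prodWeight w b * ((x q (b q) ^ 2 + ∑ c, w q c * x q c ^ 2) * φ q b)
      generalize φ q b = y
      calc _ = prodWeight w b * y * (x q (b q) ^ 2 * (∑ c, w q c)
            - 2 * x q (b q) * (∑ c, w q c * x q c) + ∑ c, w q c * x q c ^ 2) := by
            rw [Finset.mul_sum (s := univ) (f := fun c => w q c),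
              Finset.mul_sum (s := univ) (f := fun c => w q c * x q c), ← Finset.sum_sub_distrib,
              ← Finset.sum_add_distrib, Finset.mul_sum]
            exact Finset.sum_congr rfl fun c _ => by ring
        _ = _ := by rw [hw1, hx]; ring
    rw [var] at step
    linarith
  simp only [e1]
  rw [finExp_sum]
  refine (Finset.sum_le_sum fun q _ => key q).trans (le_of_eq ?_)
  rw [← Finset.mul_sum, ← finExp_sum]
  congr 2
  funext b
  simp only [hφ, diagVar, Finset.sum_mul, Finset.mul_sum]
  rw [Finset.sum_comm]
  refine Finset.sum_congr rfl fun v _ => Finset.sum_congr rfl fun q _ => ?_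
  ring

theorem diagVar_nonneg {w : ι → α → ℝ} (hw0 : ∀ q a, 0 ≤ w q a) {h : ι → V → ℝ}
    (hh0 : ∀ q v, 0 ≤ h q v) (x : ι → α → ℝ) (b : ι → α) (v : V) : 0 ≤ diagVar w h x b v :=
  Finset.sum_nonneg fun q _ => mul_nonneg (hh0 q v) (add_nonneg (sq_nonneg _)
    (Finset.sum_nonneg fun c _ => mul_nonneg (hw0 q c) (sq_nonneg _)))

/-- Young's inequality absorbs the lower moment, which turns the recursion of
`finExp_trace_pow_le` into a bound by moments of the diagonal quadratic variation. -/
theorem finExp_trace_pow_le_diagVar {w : ι → α → ℝ} (hw0 : ∀ q a, 0 ≤ w q a)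
    (hw1 : ∀ q, ∑ a, w q a = 1)
    {x : ι → α → ℝ} (hx : ∀ q, ∑ c, w q c * x q c = 0)
    {H : ι → Matrix V V ℝ} (hH : ∀ q, (H q)ᵀ = H q) {h : ι → V → ℝ}
    (hh : ∀ q, H q ^ 2 = diagonal (h q)) (hh0 : ∀ q v, 0 ≤ h q v) (r : ℕ) :
    finExp w (fun b => trace (randSum H x b ^ (2 * (r + 1)))) ≤
      ((2 * r + 1) / 2) ^ (r + 1) * ∑ v, finExp w (fun b => diagVar w h x b v ^ (r + 1)) := by
  set T := finExp w (fun b => trace (randSum H x b ^ (2 * (r + 1)))) with hT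
  have h1 := finExp_trace_pow_le hw0 hw1 hx hH hh r
  have h2 : (r + 1) * ((2 * r + 1) / 2 * finExp w
        (fun b => ∑ v, diagVar w h x b v * (randSum H x b ^ (2 * r)) v v)) ≤
      ((2 * r + 1) / 2) ^ (r + 1) * ∑ v, finExp w (fun b => diagVar w h x b v ^ (r + 1)) +
        r * T := by
    rw [← finExp_sum, ← finExp_const_mul, ← finExp_const_mul, hT, ← finExp_const_mul,
      ← finExp_const_mul, ← finExp_add]
    refine finExp_mono hw0 fun b _ => ?_
    rw [trace, Finset.mul_sum, Finset.mul_sum, Finset.mul_sum, Finset.mul_sum,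
      ← Finset.sum_add_distrib]
    refine Finset.sum_le_sum fun v _ => ?_
    have := young_pow_apply_self (randSum_transpose hH x b)
      (a := (2 * r + 1) / 2 * diagVar w h x b v)
      (mul_nonneg (by positivity) (diagVar_nonneg hw0 hh0 x b v)) r v
    rw [mul_pow] at this
    rw [diag_apply]
    refine le_trans (le_of_eq ?_) this
    ring
  have h3 : (r + 1 : ℝ) * T ≤ (r + 1) * ((2 * r + 1) / 2 * finExp w
        (fun b => ∑ v, diagVar w h x b v * (randSum H x b ^ (2 * r)) v v)) :=
    mul_le_mul_of_nonneg_left h1 (by positivity)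
  linarith

/-- Moments of the diagonal quadratic variation, from its exponential moment at
`l = p / (σ + p * R ^ 2)`; this choice makes `l * x ^ 2 ≤ 1` and `l * σ ≤ p`. -/
theorem finExp_diagVar_pow_le {w : ι → α → ℝ} (hw0 : ∀ q a, 0 ≤ w q a)
    (hw1 : ∀ q, ∑ a, w q a = 1) {x : ι → α → ℝ} {h : ι → V → ℝ} (hh0 : ∀ q v, 0 ≤ h q v)
    (hh1 : ∀ q v, h q v ≤ 1) {R σ : ℝ} (hR : 0 < R)
    (hxR : ∀ q a, w q a ≠ 0 → |x q a| ≤ R) (v : V)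
    (hσ : ∑ q, h q v * ∑ c, w q c * x q c ^ 2 ≤ σ) {p : ℕ} (hp : p ≠ 0) :
    finExp w (fun b => diagVar w h x b v ^ p) ≤ (Real.exp 3 * (σ + p * R ^ 2)) ^ p := by
  have hσ0 : 0 ≤ σ := le_trans (Finset.sum_nonneg fun q _ => mul_nonneg (hh0 q v)
    (Finset.sum_nonneg fun c _ => mul_nonneg (hw0 q c) (sq_nonneg _))) hσ
  have hp' : (0 : ℝ) < p := by exact_mod_cast Nat.pos_of_ne_zero hp
  have hpR : 0 < p * R ^ 2 := by positivity
  set M := σ + p * R ^ 2 with hM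
  have hM0 : 0 < M := by positivity
  set l := (p : ℝ) / M with hl
  have hl0 : 0 < l := by positivity
  have hlM : l * M = p := div_mul_cancel₀ _ hM0.ne'
  have hlσ : l * σ ≤ p := by rw [← hlM]; exact mul_le_mul_of_nonneg_left (by linarith) hl0.le
  have hlR : l * R ^ 2 ≤ 1 := by
    have : l * (p * R ^ 2) ≤ p := by
      nth_rw 2 [← hlM]; exact mul_le_mul_of_nonneg_left (by linarith) hl0.le
    have : p * (l * R ^ 2) ≤ p * 1 := by linarith
    exact le_of_mul_le_mul_left this hp'
  set S : ι → ℝ := fun q => ∑ c, w q c * x q c ^ 2 with hS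
  have hD : ∀ b, diagVar w h x b v ≤ ∑ q, h q v * x q (b q) ^ 2 + σ := by
    intro b
    simp only [diagVar, mul_add, Finset.sum_add_distrib]
    linarith
  have pw : ∀ y : ℝ, 0 ≤ y → (l * y) ^ p ≤ p ^ p * Real.exp (l * y) := by
    intro y hy
    have h1 := Real.pow_div_factorial_le_exp (x := l * y) (by positivity) p
    rw [div_le_iff₀ (by positivity)] at h1
    have h2 : ((p.factorial : ℕ) : ℝ) ≤ (p : ℝ) ^ p := by exact_mod_cast Nat.factorial_le_pow p
    calc _ ≤ _ := h1
      _ ≤ Real.exp (l * y) * p ^ p := mul_le_mul_of_nonneg_left h2 (Real.exp_pos _).le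
      _ = _ := mul_comm _ _
  have e1 : finExp w (fun b => (l * diagVar w h x b v) ^ p) ≤
      finExp w (fun b => (p ^ p * Real.exp (l * σ)) *
        ∏ q, Real.exp (l * (h q v * x q (b q) ^ 2))) := by
    refine finExp_mono hw0 fun b _ => ?_
    refine (pw _ (diagVar_nonneg hw0 hh0 x b v)).trans ?_
    rw [mul_assoc, ← Real.exp_sum, ← Real.exp_add, ← Finset.mul_sum, ← mul_add]
    refine mul_le_mul_of_nonneg_left (Real.exp_le_exp.2 (mul_le_mul_of_nonneg_left ?_ hl0.le))
      (by positivity)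
    linarith [hD b]
  have e2 : ∀ q, ∑ a, w q a * Real.exp (l * (h q v * x q a ^ 2)) ≤
      Real.exp (2 * l * (h q v * S q)) := by
    intro q
    calc _ ≤ ∑ a, w q a * (1 + 2 * l * h q v * x q a ^ 2) := by
          refine Finset.sum_le_sum fun a _ => ?_
          by_cases ha : w q a = 0
          · simp [ha]
          refine mul_le_mul_of_nonneg_left ?_ (hw0 q a)
          have hx2 : x q a ^ 2 ≤ R ^ 2 := by
            rw [← sq_abs]; exact pow_le_pow_left₀ (abs_nonneg _) (hxR q a ha) 2
          have hy0 : 0 ≤ l * (h q v * x q a ^ 2) :=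
            mul_nonneg hl0.le (mul_nonneg (hh0 q v) (sq_nonneg _))
          have hy1 : l * (h q v * x q a ^ 2) ≤ 1 := by
            refine le_trans (mul_le_mul_of_nonneg_left ?_ hl0.le) hlR
            calc _ ≤ 1 * x q a ^ 2 := mul_le_mul_of_nonneg_right (hh1 q v) (sq_nonneg _)
              _ ≤ _ := by rw [one_mul]; exact hx2
          have := Real.abs_exp_sub_one_sub_id_le (x := l * (h q v * x q a ^ 2))
            (by rw [abs_of_nonneg hy0]; exact hy1)
          have := (abs_le.1 this).2
          nlinarith
      _ = 1 + 2 * l * (h q v * S q) := by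
          simp only [mul_add, mul_one, Finset.sum_add_distrib, hw1, hS, Finset.mul_sum]
          congr 1
          exact Finset.sum_congr rfl fun a _ => by ring
      _ ≤ _ := by rw [add_comm]; exact Real.add_one_le_exp _
  have e3 : finExp w (fun b => ∏ q, Real.exp (l * (h q v * x q (b q) ^ 2))) ≤
      Real.exp (2 * l * σ) := by
    rw [finExp_prod w (fun q a => Real.exp (l * (h q v * x q a ^ 2)))]
    calc _ ≤ ∏ q, Real.exp (2 * l * (h q v * S q)) :=
          Finset.prod_le_prod (fun q _ => Finset.sum_nonneg fun a _ =>
            mul_nonneg (hw0 q a) (Real.exp_pos _).le) fun q _ => e2 q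
      _ ≤ _ := by
          rw [← Real.exp_sum, ← Finset.mul_sum]
          exact Real.exp_le_exp.2 (mul_le_mul_of_nonneg_left hσ (by positivity))
  have e4 : l ^ p * finExp w (fun b => diagVar w h x b v ^ p) ≤ p ^ p * Real.exp 3 ^ p := by
    rw [← finExp_const_mul]
    simp only [← mul_pow l]
    refine e1.trans ?_
    rw [finExp_const_mul]
    refine (mul_le_mul_of_nonneg_left e3 (by positivity)).trans ?_
    rw [mul_assoc, ← Real.exp_add, ← Real.exp_nat_mul]
    exact mul_le_mul_of_nonneg_left (Real.exp_le_exp.2 (by linarith)) (by positivity)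
  have e5 : l ^ p * (Real.exp 3 * M) ^ p = p ^ p * Real.exp 3 ^ p := by
    rw [← mul_pow, ← mul_pow, ← hlM]; congr 1; ring
  rw [← e5] at e4
  exact le_of_mul_le_mul_left e4 (by positivity)

end FiniteProduct

/-! ### Matrices with independent entries -/

section Concentration

open Finset Matrix

variable {m n : ℕ} {α : Type*}

/-- The Hermitian dilation of the matrix unit at `q`. -/
def dilUnit (q : Fin m × Fin n) : Matrix (Fin m ⊕ Fin n) (Fin m ⊕ Fin n) ℝ :=
  fromBlocks 0 (single q.1 q.2 1) (single q.2 q.1 1) 0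

/-- The diagonal of the square of `dilUnit q`. -/
def dilDiag (q : Fin m × Fin n) : Fin m ⊕ Fin n → ℝ :=
  Sum.elim (Pi.single q.1 1) (Pi.single q.2 1)

theorem dilUnit_transpose (q : Fin m × Fin n) : (dilUnit q)ᵀ = dilUnit q := by
  simp [dilUnit, fromBlocks_transpose]

theorem dilUnit_sq (q : Fin m × Fin n) : dilUnit q ^ 2 = diagonal (dilDiag q) := by
  rw [pow_two, dilUnit, fromBlocks_multiply, dilDiag, ← fromBlocks_diagonal]
  have h : ∀ {k : ℕ} (i : Fin k), single i i (1 : ℝ) = diagonal (Pi.single i 1) := by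
    intro k i
    ext a b
    by_cases hab : a = b
    · subst hab; simp [single_apply, Pi.single_apply, eq_comm]
    · have : ¬ (i = a ∧ i = b) := fun h => hab (h.1.symm.trans h.2)
      simp [hab, this]
  simp [h]

theorem dilDiag_nonneg (q : Fin m × Fin n) (v : Fin m ⊕ Fin n) : 0 ≤ dilDiag q v := by
  rcases v with i | j <;> simp only [dilDiag, Sum.elim_inl, Sum.elim_inr, Pi.single_apply] <;>
    split_ifs <;> norm_num

theorem dilDiag_le_one (q : Fin m × Fin n) (v : Fin m ⊕ Fin n) : dilDiag q v ≤ 1 := by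
  rcases v with i | j <;> simp only [dilDiag, Sum.elim_inl, Sum.elim_inr, Pi.single_apply] <;>
    split_ifs <;> norm_num

theorem randSum_dilUnit (x : Fin m × Fin n → α → ℝ) (b : Fin m × Fin n → α) :
    randSum dilUnit x b = fromBlocks 0 (of fun i j => x (i, j) (b (i, j)))
      (of fun i j => x (i, j) (b (i, j)))ᵀ 0 := by
  ext (i | i) (j | j)
  · simp [randSum, dilUnit, Matrix.sum_apply]
  · simp [randSum, dilUnit, Matrix.sum_apply, Matrix.single_apply, Fintype.sum_prod_type, ite_and]
  · simp [randSum, dilUnit, Matrix.sum_apply, Matrix.single_apply, Fintype.sum_prod_type, ite_and]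
  · simp [randSum, dilUnit, Matrix.sum_apply]

theorem specNorm_le_of_mulVec {E : Matrix (Fin m) (Fin n) ℝ} {τ : ℝ} (hτ : 0 ≤ τ)
    (h : ∀ w, (E *ᵥ w) ⬝ᵥ (E *ᵥ w) ≤ τ ^ 2 * (w ⬝ᵥ w)) : specNorm E ≤ τ := by
  refine ContinuousLinearMap.opNorm_le_bound _ hτ fun w => ?_
  refine le_of_sq_le_sq ?_ (by positivity)
  rw [mul_pow, EuclideanSpace.real_norm_sq_eq, EuclideanSpace.real_norm_sq_eq]
  have := h w
  simp only [dotProduct, ← pow_two] at this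
  simpa using this

theorem specNorm_le_of_trace_pow_le {E : Matrix (Fin m) (Fin n) ℝ} {τ : ℝ} (hτ : 0 ≤ τ) {p : ℕ}
    (hp : p ≠ 0) (h : trace (fromBlocks 0 E Eᵀ 0 ^ (2 * p)) ≤ τ ^ (2 * p)) : specNorm E ≤ τ := by
  refine specNorm_le_of_mulVec hτ fun w => ?_
  have := mulVec_sq_le_of_trace_pow_le (Z := fromBlocks 0 E Eᵀ 0)
    (by simp [fromBlocks_transpose]) hp h (Sum.elim 0 w)
  simpa [fromBlocks_mulVec, dotProduct] using this

open Classical in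
/-- Concentration of a matrix with independent centred entries: Markov's inequality for the trace
of an even power of its Hermitian dilation. -/
theorem finExp_specNorm_gt_le [Fintype α] {w : Fin m × Fin n → α → ℝ} (hw0 : ∀ q a, 0 ≤ w q a)
    (hw1 : ∀ q, ∑ a, w q a = 1) {x : Fin m × Fin n → α → ℝ}
    (hx : ∀ q, ∑ c, w q c * x q c = 0) {R σ τ : ℝ} (hR : 0 < R) (hτ : 0 < τ)
    (hxR : ∀ q a, w q a ≠ 0 → |x q a| ≤ R)
    (hrow : ∀ i, ∑ j, ∑ c, w (i, j) c * x (i, j) c ^ 2 ≤ σ)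
    (hcol : ∀ j, ∑ i, ∑ c, w (i, j) c * x (i, j) c ^ 2 ≤ σ) {p : ℕ} (hp : p ≠ 0) :
    finExp w (fun b => if specNorm (of fun i j => x (i, j) (b (i, j))) ≤ τ then 0 else 1) ≤
      (m + n) * (p * (Real.exp 3 * (σ + p * R ^ 2)) / τ ^ 2) ^ p := by
  have hτp : (0 : ℝ) < τ ^ (2 * p) := by positivity
  obtain ⟨r, rfl⟩ := Nat.exists_eq_succ_of_ne_zero hp
  have h1 : finExp w (fun b => if specNorm (of fun i j => x (i, j) (b (i, j))) ≤ τ then 0 else 1) ≤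
      finExp w (fun b => (τ ^ (2 * (r + 1)))⁻¹ * trace (randSum dilUnit x b ^ (2 * (r + 1)))) := by
    refine finExp_mono hw0 fun b _ => ?_
    rw [randSum_dilUnit]
    have nonneg : 0 ≤ trace (fromBlocks 0 (of fun i j => x (i, j) (b (i, j)))
        (of fun i j => x (i, j) (b (i, j)))ᵀ 0 ^ (2 * (r + 1))) := by
      rw [← randSum_dilUnit, trace]
      refine Finset.sum_nonneg fun v _ => ?_
      obtain ⟨U, d, -, -, hk⟩ := exists_diagonalization (randSum_transpose dilUnit_transpose x b)
      rw [diag_apply, pow_apply_self (hk _)]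
      exact Finset.sum_nonneg fun i _ => mul_nonneg (sq_nonneg _) ((even_two_mul _).pow_nonneg _)
    split_ifs with hs
    · exact mul_nonneg (by positivity) nonneg
    · rw [inv_mul_eq_div, one_le_div hτp]
      by_contra hlt
      exact hs (specNorm_le_of_trace_pow_le hτ.le hp (not_le.1 hlt).le)
  refine h1.trans ?_
  rw [finExp_const_mul]
  have h2 := finExp_trace_pow_le_diagVar hw0 hw1 hx dilUnit_transpose dilUnit_sq dilDiag_nonneg r
  have h3 : ∑ v, finExp w (fun b => diagVar w dilDiag x b v ^ (r + 1)) ≤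
      (m + n) * (Real.exp 3 * (σ + (r + 1 : ℕ) * R ^ 2)) ^ (r + 1) := by
    calc _ ≤ ∑ _v : Fin m ⊕ Fin n, (Real.exp 3 * (σ + (r + 1 : ℕ) * R ^ 2)) ^ (r + 1) := by
          refine Finset.sum_le_sum fun v _ => ?_
          refine finExp_diagVar_pow_le hw0 hw1 dilDiag_nonneg dilDiag_le_one hR hxR v ?_ hp
          rcases v with i | j
          · simp only [dilDiag, Sum.elim_inl]
            rw [Fintype.sum_prod_type, Finset.sum_comm]
            simpa [Pi.single_apply] using hrow i
          · simp only [dilDiag, Sum.elim_inr]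
            rw [Fintype.sum_prod_type]
            simpa [Pi.single_apply] using hcol j
      _ = _ := by simp
  have h4 : ((2 * (r : ℝ) + 1) / 2) ^ (r + 1) ≤ ((r + 1 : ℕ) : ℝ) ^ (r + 1) := by
    refine pow_le_pow_left₀ (by positivity) ?_ _
    push_cast; linarith
  have hσ : 0 ≤ σ + (r + 1 : ℕ) * R ^ 2 ∨ m + n = 0 := by
    rcases Nat.eq_zero_or_pos (m + n) with h0 | h0
    · exact Or.inr h0
    refine Or.inl (add_nonneg ?_ (by positivity))
    rcases Nat.eq_zero_or_pos m with hm | hm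
    · exact le_trans (Finset.sum_nonneg fun i _ => Finset.sum_nonneg fun c _ =>
        mul_nonneg (hw0 _ c) (sq_nonneg _)) (hcol ⟨0, by omega⟩)
    · exact le_trans (Finset.sum_nonneg fun i _ => Finset.sum_nonneg fun c _ =>
        mul_nonneg (hw0 _ c) (sq_nonneg _)) (hrow ⟨0, hm⟩)
  have h5 : finExp w (fun b => trace (randSum dilUnit x b ^ (2 * (r + 1)))) ≤
      ((r + 1 : ℕ) : ℝ) ^ (r + 1) *
        ((m + n) * (Real.exp 3 * (σ + (r + 1 : ℕ) * R ^ 2)) ^ (r + 1)) := by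
    refine h2.trans ((mul_le_mul_of_nonneg_left h3 (by positivity)).trans ?_)
    refine mul_le_mul_of_nonneg_right h4 ?_
    rcases hσ with hσ | h0
    · positivity
    · have : (m : ℝ) + n = 0 := by exact_mod_cast h0
      rw [this, zero_mul]
  refine (mul_le_mul_of_nonneg_left h5 (by positivity)).trans (le_of_eq ?_)
  simp only [Nat.succ_eq_add_one]
  generalize Real.exp 3 * (σ + (r + 1 : ℕ) * R ^ 2) = y
  rw [div_pow, mul_pow, ← pow_mul, div_eq_inv_mul]
  ring

end Concentration

/-! ### Threshold decisions made by the random source -/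

section Tape

open Finset

instance : IsProbabilityMeasure tapeMeasure := by
  unfold tapeMeasure; infer_instance

variable {ι : Type*}

/-- The Bernoulli weights with success probabilities `p`. -/
def bern (p : ι → ℝ) (q : ι) (b : Bool) : ℝ := if b then p q else 1 - p q

open Classical in
/-- Which of the independent events `ω (pos q) < p q` occur. -/
noncomputable def tapeBits (pos : ι → ℕ) (p : ι → ℝ) (ω : ℕ → unitInterval) (q : ι) : Bool :=
  decide ((ω (pos q) : ℝ) < p q)

theorem measurable_tapeBits (pos : ι → ℕ) (p : ι → ℝ) (q : ι) :
    Measurable fun ω => tapeBits pos p ω q := by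
  refine measurable_to_bool ?_
  have : (fun ω => tapeBits pos p ω q) ⁻¹' {true} =
      {ω : ℕ → unitInterval | (ω (pos q) : ℝ) < p q} := by
    ext ω; simp [tapeBits]
  rw [this]
  exact measurableSet_lt (by fun_prop) measurable_const

theorem tapeMeasure_real_lt (k : ℕ) {p : ℝ} (h0 : 0 ≤ p) (h1 : p ≤ 1) :
    tapeMeasure.real {ω | (ω k : ℝ) < p} = p := by
  have hm : MeasurableSet (Set.Iio (⟨p, h0, h1⟩ : unitInterval)) := measurableSet_Iio
  have := (measurePreserving_eval_infinitePi (fun _ : ℕ => (volume : Measure unitInterval)) k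
    ).measureReal_preimage hm.nullMeasurableSet
  have e : Function.eval k ⁻¹' (Set.Iio (⟨p, h0, h1⟩ : unitInterval)) =
      {ω : ℕ → unitInterval | (ω k : ℝ) < p} := by
    ext ω; exact Iff.rfl
  rw [e] at this
  rw [tapeMeasure, this, measureReal_def, unitInterval.volume_Iio, ENNReal.toReal_ofReal h0]

theorem iIndepFun_tapeBits {pos : ι → ℕ} (hpos : Function.Injective pos) (p : ι → ℝ) :
    iIndepFun (fun q ω => tapeBits pos p ω q) tapeMeasure := by
  have h1 : iIndepFun (fun (k : ℕ) (ω : ℕ → unitInterval) => ω k) tapeMeasure :=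
    iIndepFun_infinitePi (X := fun _ u => u) (fun _ => measurable_id)
  classical
  refine (h1.precomp hpos).comp (fun q (u : unitInterval) => decide ((u : ℝ) < p q)) fun q => ?_
  refine measurable_to_bool ?_
  have : (fun u : unitInterval => decide ((u : ℝ) < p q)) ⁻¹' {true} =
      {u : unitInterval | (u : ℝ) < p q} := by
    ext u; simp
  rw [this]
  exact measurableSet_lt (by fun_prop) measurable_const

theorem integrable_tapeBits [Finite ι] (pos : ι → ℕ) (p : ι → ℝ) (f : (ι → Bool) → ℝ) :
    Integrable (fun ω => f (tapeBits pos p ω)) tapeMeasure := by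
  have hm : Measurable (tapeBits pos p) := measurable_pi_lambda _ (measurable_tapeBits pos p)
  have : Integrable f (tapeMeasure.map (tapeBits pos p)) := by
    have := Measure.isProbabilityMeasure_map (μ := tapeMeasure) hm.aemeasurable
    exact Integrable.of_finite
  exact (integrable_map_measure (measurable_of_finite f).aestronglyMeasurable hm.aemeasurable).1
    this

theorem integral_tapeBits [Fintype ι] [DecidableEq ι] {pos : ι → ℕ} (hpos : Function.Injective pos) {p : ι → ℝ}
    (h0 : ∀ q, 0 ≤ p q) (h1 : ∀ q, p q ≤ 1) (f : (ι → Bool) → ℝ) :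
    ∫ ω, f (tapeBits pos p ω) ∂tapeMeasure = finExp (bern p) f := by
  have hm : Measurable (tapeBits pos p) := measurable_pi_lambda _ (measurable_tapeBits pos p)
  have hlaw := (iIndepFun_iff_map_fun_eq_pi_map
    (fun q => (measurable_tapeBits pos p q).aemeasurable)).1 (iIndepFun_tapeBits hpos p)
  have hone : ∀ q, tapeMeasure.real ((fun ω => tapeBits pos p ω q) ⁻¹' {true}) = p q := by
    intro q
    rw [← tapeMeasure_real_lt (pos q) (h0 q) (h1 q)]
    congr 1
    ext ω; simp [tapeBits]
  have hbern : ∀ q a, (tapeMeasure.map (fun ω => tapeBits pos p ω q)).real {a} = bern p q a := by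
    intro q a
    rw [map_measureReal_apply (measurable_tapeBits pos p q) (measurableSet_singleton a)]
    cases a with
    | true => rw [hone]; simp [bern]
    | false =>
      have : (fun ω => tapeBits pos p ω q) ⁻¹' {false} =
          ((fun ω => tapeBits pos p ω q) ⁻¹' {true})ᶜ := by ext ω; simp
      rw [this, probReal_compl_eq_one_sub
        (measurable_tapeBits pos p q (measurableSet_singleton true)), hone]
      simp [bern]
  have : ∀ q, IsProbabilityMeasure (tapeMeasure.map (fun ω => tapeBits pos p ω q)) := fun q =>
    Measure.isProbabilityMeasure_map (measurable_tapeBits pos p q).aemeasurable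
  rw [← integral_map (φ := tapeBits pos p) hm.aemeasurable
    (measurable_of_finite f).aestronglyMeasurable]
  have hlaw' : tapeMeasure.map (tapeBits pos p) =
      Measure.pi fun q => tapeMeasure.map (fun ω => tapeBits pos p ω q) := hlaw
  rw [hlaw', integral_fintype Integrable.of_finite, finExp]
  refine Finset.sum_congr rfl fun b _ => ?_
  rw [smul_eq_mul, prodWeight, measureReal_def, Measure.pi_singleton, ENNReal.toReal_prod]
  congr 1
  exact Finset.prod_congr rfl fun q _ => hbern q (b q)

theorem bern_nonneg {p : ι → ℝ} (h0 : ∀ q, 0 ≤ p q) (h1 : ∀ q, p q ≤ 1) (q : ι) (b : Bool) :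
    0 ≤ bern p q b := by
  cases b
  · simpa [bern] using h1 q
  · simpa [bern] using h0 q

theorem bern_sum (p : ι → ℝ) (q : ι) : ∑ b, bern p q b = 1 := by
  simp [bern]

theorem finExp_bit [Fintype ι] [DecidableEq ι] (p : ι → ℝ) (q : ι) :
    finExp (bern p) (fun b => if b q then 1 else 0) = p q := by
  have e : (fun b : ι → Bool => if b q then (1 : ℝ) else 0) =
      fun b => ∏ q', (fun (q' : ι) (a : Bool) =>
        if q' = q then (if a then (1 : ℝ) else 0) else 1) q' (b q') := by
    funext b
    simp
  rw [e, finExp_prod (bern p) (fun (q' : ι) (a : Bool) =>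
    if q' = q then (if a then (1 : ℝ) else 0) else 1), Finset.prod_eq_single q]
  · simp [bern]
  · intro q' _ hq
    simp [hq, bern]
  · simp

end Tape

/-! ### Numerical sparsity and the sampling distributions -/

section Norms

open Finset

theorem vecL1_nonneg {ι : Type*} [Fintype ι] (a : ι → ℝ) : 0 ≤ vecL1 a :=
  Finset.sum_nonneg fun _ _ => abs_nonneg _

theorem abs_le_vecL1 {ι : Type*} [Fintype ι] (a : ι → ℝ) (i : ι) : |a i| ≤ vecL1 a :=
  Finset.single_le_sum (f := fun i => |a i|) (fun _ _ => abs_nonneg _) (Finset.mem_univ i)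

theorem vecNs_nonneg {ι : Type*} [Fintype ι] (a : ι → ℝ) : 0 ≤ vecNs a :=
  Real.sInf_nonneg fun _ hk => hk.1

theorem vecL1_sq_le {ι : Type*} [Fintype ι] (a : ι → ℝ) :
    vecL1 a ^ 2 ≤ vecNs a * ∑ i, a i ^ 2 := by
  have h0 : 0 ≤ ∑ i, a i ^ 2 := Finset.sum_nonneg fun _ _ => sq_nonneg _
  rcases h0.eq_or_lt with h | h
  · have hz : ∀ i, a i = 0 := fun i => by
      have := (Finset.sum_eq_zero_iff_of_nonneg fun i _ => sq_nonneg (a i)).1 h.symm i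
        (Finset.mem_univ i)
      exact pow_eq_zero_iff two_ne_zero |>.1 this
    simp [vecL1, hz]
  · rw [← div_le_iff₀ h]
    have hl2 : 0 < vecL2 a := Real.sqrt_pos.2 h
    have hsq : vecL2 a ^ 2 = ∑ i, a i ^ 2 := Real.sq_sqrt h0
    refine le_csInf ⟨vecL1 a ^ 2 / vecL2 a ^ 2, by positivity, ?_⟩ ?_
    · rw [← div_pow, Real.sqrt_sq (div_nonneg (vecL1_nonneg a) hl2.le),
        div_mul_cancel₀ _ hl2.ne']
    · rintro k ⟨hk, hka⟩
      rw [div_le_iff₀ h, ← hsq, ← Real.sq_sqrt hk, ← mul_pow]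
      exact pow_le_pow_left₀ (vecL1_nonneg a) hka 2

variable {m n : ℕ}

theorem vecNs_row_le (A : Matrix (Fin m) (Fin n) ℝ) (i : Fin m) :
    vecNs (fun j => A i j) ≤ ns A :=
  le_trans (le_ciSup (f := fun i => vecNs fun j => A i j) (Set.finite_range _).bddAbove i)
    (le_max_left _ _)

theorem vecNs_col_le (A : Matrix (Fin m) (Fin n) ℝ) (j : Fin n) :
    vecNs (fun i => A i j) ≤ ns A :=
  le_trans (le_ciSup (f := fun j => vecNs fun i => A i j) (Set.finite_range _).bddAbove j)
    (le_max_right _ _)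

theorem ns_nonneg (A : Matrix (Fin m) (Fin n) ℝ) : 0 ≤ ns A :=
  le_trans (Real.iSup_nonneg fun _ => vecNs_nonneg _) (le_max_left _ _)

/-- The entrywise `ℓ₁` norm. -/
def sumAbs (A : Matrix (Fin m) (Fin n) ℝ) : ℝ := ∑ i, ∑ j, |A i j|

/-- The sum of the squared `ℓ₁` norms of the rows. -/
def rowSq (A : Matrix (Fin m) (Fin n) ℝ) : ℝ := ∑ i, vecL1 (fun j => A i j) ^ 2

/-- The sum of the squared `ℓ₁` norms of the columns. -/
def colSq (A : Matrix (Fin m) (Fin n) ℝ) : ℝ := ∑ j, vecL1 (fun i => A i j) ^ 2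

theorem sumAbs_nonneg (A : Matrix (Fin m) (Fin n) ℝ) : 0 ≤ sumAbs A :=
  Finset.sum_nonneg fun _ _ => vecL1_nonneg _

theorem rowSq_nonneg (A : Matrix (Fin m) (Fin n) ℝ) : 0 ≤ rowSq A :=
  Finset.sum_nonneg fun _ _ => sq_nonneg _

theorem colSq_nonneg (A : Matrix (Fin m) (Fin n) ℝ) : 0 ≤ colSq A :=
  Finset.sum_nonneg fun _ _ => sq_nonneg _

theorem abs_le_sumAbs (A : Matrix (Fin m) (Fin n) ℝ) (i : Fin m) (j : Fin n) :
    |A i j| ≤ sumAbs A :=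
  (abs_le_vecL1 (fun j => A i j) j).trans
    (Finset.single_le_sum (f := fun i => vecL1 fun j => A i j) (fun _ _ => vecL1_nonneg _)
      (Finset.mem_univ i))

theorem vecL1_row_sq_le (A : Matrix (Fin m) (Fin n) ℝ) (i : Fin m) :
    vecL1 (fun j => A i j) ^ 2 ≤ rowSq A :=
  Finset.single_le_sum (f := fun i => vecL1 (fun j => A i j) ^ 2) (fun _ _ => sq_nonneg _)
    (Finset.mem_univ i)

theorem vecL1_col_sq_le (A : Matrix (Fin m) (Fin n) ℝ) (j : Fin n) :
    vecL1 (fun i => A i j) ^ 2 ≤ colSq A :=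
  Finset.single_le_sum (f := fun j => vecL1 (fun i => A i j) ^ 2) (fun _ _ => sq_nonneg _)
    (Finset.mem_univ j)

theorem frobNorm_sq (A : Matrix (Fin m) (Fin n) ℝ) : frobNorm A ^ 2 = ∑ i, ∑ j, A i j ^ 2 :=
  Real.sq_sqrt (Finset.sum_nonneg fun _ _ => Finset.sum_nonneg fun _ _ => sq_nonneg _)

theorem frobNorm_nonneg (A : Matrix (Fin m) (Fin n) ℝ) : 0 ≤ frobNorm A := Real.sqrt_nonneg _

theorem rowSq_le (A : Matrix (Fin m) (Fin n) ℝ) : rowSq A ≤ ns A * frobNorm A ^ 2 := by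
  rw [frobNorm_sq, Finset.mul_sum]
  refine Finset.sum_le_sum fun i _ => (vecL1_sq_le _).trans ?_
  exact mul_le_mul_of_nonneg_right (vecNs_row_le A i) (Finset.sum_nonneg fun _ _ => sq_nonneg _)

theorem colSq_le (A : Matrix (Fin m) (Fin n) ℝ) : colSq A ≤ ns A * frobNorm A ^ 2 := by
  rw [frobNorm_sq, Finset.sum_comm, Finset.mul_sum]
  refine Finset.sum_le_sum fun j _ => (vecL1_sq_le _).trans ?_
  exact mul_le_mul_of_nonneg_right (vecNs_col_le A j) (Finset.sum_nonneg fun _ _ => sq_nonneg _)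

/-- Cauchy–Schwarz over the columns, of which there are fewer than rows in the application. -/
theorem sumAbs_le (A : Matrix (Fin m) (Fin n) ℝ) :
    sumAbs A ≤ Real.sqrt (ns A * n) * frobNorm A := by
  have e : sumAbs A = ∑ j, vecL1 fun i => A i j := Finset.sum_comm
  have h1 : sumAbs A ^ 2 ≤ n * colSq A := by
    rw [e]
    have := sq_sum_le_card_mul_sum_sq (s := Finset.univ) (f := fun j => vecL1 fun i => A i j)
    simpa [colSq] using this
  refine le_of_sq_le_sq ?_ (mul_nonneg (Real.sqrt_nonneg _) (frobNorm_nonneg A))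
  rw [mul_pow, Real.sq_sqrt (mul_nonneg (ns_nonneg A) (Nat.cast_nonneg _))]
  refine h1.trans ((mul_le_mul_of_nonneg_left (colSq_le A) (Nat.cast_nonneg _)).trans (le_of_eq ?_))
  ring

theorem specNorm_nonneg (A : Matrix (Fin m) (Fin n) ℝ) : 0 ≤ specNorm A := norm_nonneg _

theorem specNorm_zero : specNorm (0 : Matrix (Fin m) (Fin n) ℝ) = 0 := by
  simp [specNorm]

theorem specNorm_pos {A : Matrix (Fin m) (Fin n) ℝ} (hA : A ≠ 0) : 0 < specNorm A := by
  refine norm_pos_iff.2 fun h => hA ?_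
  simpa using h

theorem sr_nonneg (A : Matrix (Fin m) (Fin n) ℝ) : 0 ≤ sr A :=
  div_nonneg (sq_nonneg _) (sq_nonneg _)

theorem prob1_nonneg (A : Matrix (Fin m) (Fin n) ℝ) (i : Fin m) (j : Fin n) : 0 ≤ prob1 A i j :=
  div_nonneg (abs_nonneg _) (sumAbs_nonneg A)

theorem prob2_nonneg (A : Matrix (Fin m) (Fin n) ℝ) (i : Fin m) (j : Fin n) : 0 ≤ prob2 A i j :=
  mul_nonneg (div_nonneg (sq_nonneg _) (rowSq_nonneg A)) (div_nonneg (abs_nonneg _) (vecL1_nonneg _))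

theorem prob3_nonneg (A : Matrix (Fin m) (Fin n) ℝ) (i : Fin m) (j : Fin n) : 0 ≤ prob3 A i j :=
  mul_nonneg (div_nonneg (sq_nonneg _) (colSq_nonneg A)) (div_nonneg (abs_nonneg _) (vecL1_nonneg _))

theorem sum_prob1_le (A : Matrix (Fin m) (Fin n) ℝ) : ∑ i, ∑ j, prob1 A i j ≤ 1 := by
  simp only [prob1, ← Finset.sum_div]
  exact div_self_le_one _

theorem sum_prob2_le (A : Matrix (Fin m) (Fin n) ℝ) : ∑ i, ∑ j, prob2 A i j ≤ 1 := by
  simp only [prob2, ← Finset.mul_sum, ← Finset.sum_div]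
  refine le_trans (Finset.sum_le_sum fun i _ => mul_le_of_le_one_right
    (div_nonneg (sq_nonneg _) (rowSq_nonneg A)) (div_self_le_one _)) ?_
  rw [← Finset.sum_div]
  exact div_self_le_one _

theorem sum_prob3_le (A : Matrix (Fin m) (Fin n) ℝ) : ∑ i, ∑ j, prob3 A i j ≤ 1 := by
  rw [Finset.sum_comm]
  simp only [prob3, ← Finset.mul_sum, ← Finset.sum_div]
  refine le_trans (Finset.sum_le_sum fun i _ => mul_le_of_le_one_right
    (div_nonneg (sq_nonneg _) (colSq_nonneg A)) (div_self_le_one _)) ?_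
  rw [← Finset.sum_div]
  exact div_self_le_one _

theorem keepProb_le_one (A : Matrix (Fin m) (Fin n) ℝ) (s : ℝ) (i : Fin m) (j : Fin n) :
    keepProb A s i j ≤ 1 := min_le_left _ _

theorem keepProb_nonneg (A : Matrix (Fin m) (Fin n) ℝ) {s : ℝ} (hs : 0 ≤ s) (i : Fin m)
    (j : Fin n) : 0 ≤ keepProb A s i j :=
  le_min zero_le_one (mul_nonneg hs (le_max_of_le_left (prob1_nonneg A i j)))

theorem sum_keepProb_le (A : Matrix (Fin m) (Fin n) ℝ) {s : ℝ} (hs : 0 ≤ s) :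
    ∑ i, ∑ j, keepProb A s i j ≤ 3 * s := by
  calc _ ≤ ∑ i, ∑ j, s * (prob1 A i j + prob2 A i j + prob3 A i j) := by
        refine Finset.sum_le_sum fun i _ => Finset.sum_le_sum fun j _ => ?_
        refine (min_le_right _ _).trans (mul_le_mul_of_nonneg_left ?_ hs)
        have h1 := prob1_nonneg A i j
        have h2 := prob2_nonneg A i j
        have h3 := prob3_nonneg A i j
        exact max_le (by linarith) (max_le (by linarith) (by linarith))
    _ = s * (∑ i, ∑ j, prob1 A i j + ∑ i, ∑ j, prob2 A i j + ∑ i, ∑ j, prob3 A i j) := by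
        simp only [← Finset.mul_sum, Finset.sum_add_distrib]
    _ ≤ _ := by nlinarith [sum_prob1_le A, sum_prob2_le A, sum_prob3_le A]

end Norms

/-! ### The random sparsification -/

section Sample

open Finset

variable {m n : ℕ}

open Classical in
/-- Entry `(i, j)` is kept, and divided by `p i j`, if the random number at position `pos (i, j)`
is less than `p i j`. -/
noncomputable def sampleMat (A : Matrix (Fin m) (Fin n) ℝ) (p : Fin m → Fin n → ℝ) (pos : Fin m × Fin n → ℕ)
    (ω : ℕ → unitInterval) : Matrix (Fin m) (Fin n) ℝ :=
  Matrix.of fun i j => if (ω (pos (i, j)) : ℝ) < p i j then A i j / p i j else 0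

theorem isEntrywiseSample_sampleMat (A : Matrix (Fin m) (Fin n) ℝ) {p : Fin m → Fin n → ℝ}
    (h0 : ∀ i j, 0 ≤ p i j) (h1 : ∀ i j, p i j ≤ 1) {pos : Fin m × Fin n → ℕ}
    (hpos : Function.Injective pos) :
    IsEntrywiseSample tapeMeasure A p (sampleMat A p pos) := by
  set p' : Fin m × Fin n → ℝ := fun q => p q.1 q.2
  have e : ∀ q, {ω : ℕ → unitInterval | (ω (pos q) : ℝ) < p q.1 q.2} =
      (fun ω => tapeBits pos p' ω q) ⁻¹' {true} := by
    intro q; ext ω; simp [tapeBits, p']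
  have hm : ∀ q, MeasurableSet {ω : ℕ → unitInterval | (ω (pos q) : ℝ) < p q.1 q.2} := fun q => by
    rw [e]; exact measurable_tapeBits pos p' q (measurableSet_singleton _)
  refine ⟨fun q => {ω | (ω (pos q) : ℝ) < p q.1 q.2}, hm, ?_, fun q =>
    tapeMeasure_real_lt _ (h0 _ _) (h1 _ _), fun ω i j => ⟨fun h => ?_, fun h => ?_⟩⟩
  · rw [iIndepSet_iff_meas_biInter hm]
    intro s
    simp only [e]
    exact (iIndepFun_tapeBits hpos p').measure_inter_preimage_eq_mul s
      fun q _ => measurableSet_singleton _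
  · exact if_pos h
  · exact if_neg h

/-- The error of the sample at an entry with value `a`, keeping probability `p` and decision `b`. -/
noncomputable def entryErr (a p : ℝ) (b : Bool) : ℝ := a - if b then a / p else 0

theorem sub_sampleMat (A : Matrix (Fin m) (Fin n) ℝ) (p : Fin m → Fin n → ℝ)
    (pos : Fin m × Fin n → ℕ) (ω : ℕ → unitInterval) :
    A - sampleMat A p pos ω = Matrix.of fun i j => entryErr (A i j) (p i j)
      (tapeBits pos (fun q : Fin m × Fin n => p q.1 q.2) ω (i, j)) := by
  ext i j
  simp [sampleMat, entryErr, tapeBits]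

theorem entryErr_mean {a p : ℝ} (hp : a ≠ 0 → p ≠ 0) :
    p * entryErr a p true + (1 - p) * entryErr a p false = 0 := by
  rcases eq_or_ne a 0 with rfl | ha
  · simp [entryErr]
  · have := hp ha
    simp only [entryErr, if_true, Bool.false_eq_true, if_false]
    field_simp
    ring

/-- If the keeping probability is capped at `1` then an entry kept with certainty has no variance,
so the cap does not hurt. -/
theorem entryErr_var_le {a p t y : ℝ} (hp0 : a ≠ 0 → 0 < p) (hp1 : p ≤ 1) (hy : 0 ≤ y)
    (hpt : p < 1 → t ≤ p) (h : a ^ 2 ≤ t * y) :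
    p * entryErr a p true ^ 2 + (1 - p) * entryErr a p false ^ 2 ≤ y := by
  rcases eq_or_ne a 0 with rfl | ha
  · simpa [entryErr] using hy
  have hp := hp0 ha
  have e : p * entryErr a p true ^ 2 + (1 - p) * entryErr a p false ^ 2 = a ^ 2 / p * (1 - p) := by
    simp only [entryErr, if_true, Bool.false_eq_true, if_false]
    field_simp
    ring
  rw [e]
  rcases hp1.eq_or_lt with h1 | h1
  · simpa [h1] using hy
  · have h2 : a ^ 2 / p ≤ y := by
      rw [div_le_iff₀ hp, mul_comm]
      exact h.trans (mul_le_mul_of_nonneg_right (hpt h1) hy)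
    exact (mul_le_of_le_one_right (by positivity) (by linarith)).trans h2

theorem abs_entryErr_le {a p t y : ℝ} (hp0 : a ≠ 0 → 0 < p) (hp1 : p ≤ 1) (hy : 0 ≤ y)
    (hpt : p < 1 → t ≤ p) (h : |a| ≤ t * y) {b : Bool} (hb : (if b then p else 1 - p) ≠ 0) :
    |entryErr a p b| ≤ y := by
  rcases eq_or_ne a 0 with rfl | ha
  · simpa [entryErr] using hy
  have hp := hp0 ha
  rcases hp1.eq_or_lt with h1 | h1
  · cases b
    · simp [h1] at hb
    · simpa [entryErr, h1] using hy
  · have h2 : |a| / p ≤ y := by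
      rw [div_le_iff₀ hp, mul_comm]
      exact h.trans (mul_le_mul_of_nonneg_right (hpt h1) hy)
    have h3 : |a| ≤ |a| / p := by
      rw [le_div_iff₀ hp]; exact mul_le_of_le_one_right (abs_nonneg _) hp1
    cases b
    · simpa [entryErr] using h3.trans h2
    · have e : entryErr a p true = -(a / p * (1 - p)) := by
        simp only [entryErr, if_true]; field_simp; ring
      rw [e, abs_neg, abs_mul, abs_div, abs_of_pos hp, abs_of_nonneg (by linarith : 0 ≤ 1 - p)]
      exact (mul_le_of_le_one_right (by positivity) (by linarith)).trans h2

theorem le_keepProb {A : Matrix (Fin m) (Fin n) ℝ} {s : ℝ} {i : Fin m} {j : Fin n}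
    (h : keepProb A s i j < 1) :
    keepProb A s i j = s * max (prob1 A i j) (max (prob2 A i j) (prob3 A i j)) := by
  rcases min_choice 1 (s * max (prob1 A i j) (max (prob2 A i j) (prob3 A i j))) with h' | h'
  · rw [keepProb, h'] at h; exact absurd h (lt_irrefl _)
  · exact h'

theorem sumAbs_pos {A : Matrix (Fin m) (Fin n) ℝ} {i : Fin m} {j : Fin n} (h : A i j ≠ 0) :
    0 < sumAbs A := (abs_pos.2 h).trans_le (abs_le_sumAbs A i j)

theorem keepProb_pos {A : Matrix (Fin m) (Fin n) ℝ} {s : ℝ} (hs : 0 < s) {i : Fin m} {j : Fin n}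
    (h : A i j ≠ 0) : 0 < keepProb A s i j :=
  lt_min zero_lt_one (mul_pos hs (lt_max_of_lt_left (div_pos (abs_pos.2 h) (sumAbs_pos h))))

theorem sampleRow_var_le (A : Matrix (Fin m) (Fin n) ℝ) {s : ℝ} (hs : 0 < s) (i : Fin m) :
    ∑ j, (keepProb A s i j * entryErr (A i j) (keepProb A s i j) true ^ 2 +
      (1 - keepProb A s i j) * entryErr (A i j) (keepProb A s i j) false ^ 2) ≤ rowSq A / s := by
  set r := vecL1 (fun j => A i j) with hr
  have hr0 : 0 ≤ r := vecL1_nonneg _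
  have hS := rowSq_nonneg A
  calc _ ≤ ∑ j, |A i j| * (rowSq A / (s * r)) := by
        refine Finset.sum_le_sum fun j _ => ?_
        refine entryErr_var_le (t := s * prob2 A i j) (keepProb_pos hs) (keepProb_le_one _ _ _ _)
          (by positivity) (fun h => ?_) ?_
        · rw [le_keepProb h]
          exact mul_le_mul_of_nonneg_left (le_max_of_le_right (le_max_left _ _)) hs.le
        · rcases eq_or_ne (A i j) 0 with h | h
          · simp [h]
          have h1 : 0 < r := (abs_pos.2 h).trans_le (abs_le_vecL1 (fun j => A i j) j)
          have h2 : 0 < rowSq A := (pow_pos h1 2).trans_le (vecL1_row_sq_le A i)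
          have e : prob2 A i j = r ^ 2 / rowSq A * (|A i j| / r) := rfl
          rw [e, ← sq_abs]
          apply le_of_eq
          field_simp
    _ = r * (rowSq A / (s * r)) := by rw [← Finset.sum_mul]; rfl
    _ ≤ _ := by
        rcases hr0.eq_or_lt with h | h
        · rw [← h, zero_mul]; positivity
        · apply le_of_eq; field_simp

theorem sampleCol_var_le (A : Matrix (Fin m) (Fin n) ℝ) {s : ℝ} (hs : 0 < s) (j : Fin n) :
    ∑ i, (keepProb A s i j * entryErr (A i j) (keepProb A s i j) true ^ 2 +
      (1 - keepProb A s i j) * entryErr (A i j) (keepProb A s i j) false ^ 2) ≤ colSq A / s := by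
  set r := vecL1 (fun i => A i j) with hr
  have hr0 : 0 ≤ r := vecL1_nonneg _
  have hS := colSq_nonneg A
  calc _ ≤ ∑ i, |A i j| * (colSq A / (s * r)) := by
        refine Finset.sum_le_sum fun i _ => ?_
        refine entryErr_var_le (t := s * prob3 A i j) (keepProb_pos hs) (keepProb_le_one _ _ _ _)
          (by positivity) (fun h => ?_) ?_
        · rw [le_keepProb h]
          exact mul_le_mul_of_nonneg_left (le_max_of_le_right (le_max_right _ _)) hs.le
        · rcases eq_or_ne (A i j) 0 with h | h
          · simp [h]
          have h1 : 0 < r := (abs_pos.2 h).trans_le (abs_le_vecL1 (fun i => A i j) i)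
          have h2 : 0 < colSq A := (pow_pos h1 2).trans_le (vecL1_col_sq_le A j)
          have e : prob3 A i j = r ^ 2 / colSq A * (|A i j| / r) := rfl
          rw [e, ← sq_abs]
          apply le_of_eq
          field_simp
    _ = r * (colSq A / (s * r)) := by rw [← Finset.sum_mul]; rfl
    _ ≤ _ := by
        rcases hr0.eq_or_lt with h | h
        · rw [← h, zero_mul]; positivity
        · apply le_of_eq; field_simp

theorem measurableSet_sampleMat_le (A : Matrix (Fin m) (Fin n) ℝ) (p : Fin m → Fin n → ℝ)
    (pos : Fin m × Fin n → ℕ) (τ : ℝ) :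
    MeasurableSet {ω | specNorm (A - sampleMat A p pos ω) ≤ τ} := by
  have hm : Measurable (tapeBits pos (fun q : Fin m × Fin n => p q.1 q.2)) :=
    measurable_pi_lambda _ (measurable_tapeBits pos _)
  have : {ω | specNorm (A - sampleMat A p pos ω) ≤ τ} =
      tapeBits pos (fun q : Fin m × Fin n => p q.1 q.2) ⁻¹'
        {b | specNorm (Matrix.of fun i j => entryErr (A i j) (p i j) (b (i, j))) ≤ τ} := by
    ext ω
    rw [Set.mem_ofPred_eq, sub_sampleMat]
    rfl
  rw [this]
  exact hm (Set.toFinite _).measurableSet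

/-- The failure probability of the sample for an arbitrary sampling rate `s` and moment order
`2 * p`. -/
theorem one_sub_le_sampleMat (A : Matrix (Fin m) (Fin n) ℝ) (hA : A ≠ 0) {s τ : ℝ} (hs : 0 < s)
    (hτ : 0 < τ) {pos : Fin m × Fin n → ℕ} (hpos : Function.Injective pos) {p : ℕ} (hp : p ≠ 0) :
    1 - (m + n) * (p * (Real.exp 3 * ((rowSq A + colSq A) / s + p * (sumAbs A / s) ^ 2)) /
      τ ^ 2) ^ p ≤
      tapeMeasure.real {ω | specNorm (A - sampleMat A (keepProb A s) pos ω) ≤ τ} := by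
  classical
  obtain ⟨i₀, j₀, h₀⟩ : ∃ i j, A i j ≠ 0 := by
    by_contra! h
    exact hA (Matrix.ext h)
  have hS1 := sumAbs_pos h₀
  set k : Fin m × Fin n → ℝ := fun q => keepProb A s q.1 q.2 with hk
  have hk0 : ∀ q, 0 ≤ k q := fun q => keepProb_nonneg A hs.le _ _
  have hk1 : ∀ q, k q ≤ 1 := fun q => keepProb_le_one A _ _ _
  have conc := finExp_specNorm_gt_le (w := bern k) (bern_nonneg hk0 hk1) (bern_sum k)
    (x := fun q b => entryErr (A q.1 q.2) (k q) b) (R := sumAbs A / s)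
    (σ := (rowSq A + colSq A) / s) (τ := τ)
    (fun q => by
      simp only [Fintype.sum_bool, bern, if_true, Bool.false_eq_true, if_false]
      exact entryErr_mean fun h => (keepProb_pos hs h).ne')
    (by positivity) hτ
    (fun q b hb => by
      refine abs_entryErr_le (t := s * prob1 A q.1 q.2) (fun h => keepProb_pos hs h) (hk1 q)
        (by positivity) (fun h => ?_) (le_of_eq ?_) hb
      · rw [le_keepProb h]
        exact mul_le_mul_of_nonneg_left (le_max_left _ _) hs.le
      · have e : prob1 A q.1 q.2 = |A q.1 q.2| / sumAbs A := rfl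
        rw [e]
        field_simp)
    (fun i => by
      simp only [Fintype.sum_bool, bern, if_true, Bool.false_eq_true, if_false]
      refine (sampleRow_var_le A hs i).trans (div_le_div_of_nonneg_right ?_ hs.le)
      linarith [colSq_nonneg A])
    (fun j => by
      simp only [Fintype.sum_bool, bern, if_true, Bool.false_eq_true, if_false]
      refine (sampleCol_var_le A hs j).trans (div_le_div_of_nonneg_right ?_ hs.le)
      linarith [rowSq_nonneg A]) hp
  rw [← integral_tapeBits hpos hk0 hk1] at conc
  set G := {ω | specNorm (A - sampleMat A (keepProb A s) pos ω) ≤ τ} with hG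
  have hGm : MeasurableSet G := measurableSet_sampleMat_le A _ pos τ
  have hint : ∫ ω, (if specNorm (Matrix.of fun i j => entryErr (A i j) (k (i, j))
      (tapeBits pos k ω (i, j))) ≤ τ then (0 : ℝ) else 1) ∂tapeMeasure = tapeMeasure.real Gᶜ := by
    rw [← integral_indicator_one hGm.compl]
    refine integral_congr_ae (Filter.Eventually.of_forall fun ω => ?_)
    have : ω ∈ G ↔ specNorm (Matrix.of fun i j => entryErr (A i j) (k (i, j))
      (tapeBits pos k ω (i, j))) ≤ τ := by
      rw [hG, Set.mem_ofPred_eq, sub_sampleMat]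
    by_cases h : ω ∈ G
    · simp only [this.1 h, if_true]
      rw [Set.indicator_of_notMem (by simpa using h)]
    · refine (if_neg fun h' => h (this.2 h')).trans ?_
      rw [Set.indicator_of_mem (by simpa using h), Pi.one_apply]
  rw [hint, probReal_compl_eq_one_sub hGm] at conc
  linarith

theorem nnz_eq_sum (B : Matrix (Fin m) (Fin n) ℝ) [DecidableEq ℝ] :
    (nnz B : ℝ) = ∑ q : Fin m × Fin n, if B q.1 q.2 ≠ 0 then (1 : ℝ) else 0 := by
  rw [nnz, Nat.card_eq_fintype_card, Fintype.card_subtype, Finset.sum_boole]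

theorem nnz_sampleMat (A : Matrix (Fin m) (Fin n) ℝ) {p : Fin m → Fin n → ℝ}
    (h0 : ∀ i j, 0 ≤ p i j) (h1 : ∀ i j, p i j ≤ 1) {pos : Fin m × Fin n → ℕ}
    (hpos : Function.Injective pos) :
    Integrable (fun ω => (nnz (sampleMat A p pos ω) : ℝ)) tapeMeasure ∧
    ∫ ω, (nnz (sampleMat A p pos ω) : ℝ) ∂tapeMeasure ≤ ∑ i, ∑ j, p i j := by
  classical
  set k : Fin m × Fin n → ℝ := fun q => p q.1 q.2 with hk
  obtain ⟨g, hg⟩ : ∃ g : (Fin m × Fin n → Bool) → ℝ, g = fun b =>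
      (nnz (A - Matrix.of fun i j => entryErr (A i j) (p i j) (b (i, j))) : ℝ) := ⟨_, rfl⟩
  have e : (fun ω => (nnz (sampleMat A p pos ω) : ℝ)) = fun ω => g (tapeBits pos k ω) := by
    funext ω
    rw [hg]
    simp only [hk]
    rw [← sub_sampleMat, sub_sub_cancel]
  rw [e]
  refine ⟨integrable_tapeBits pos k _, ?_⟩
  rw [integral_tapeBits hpos (fun q => h0 _ _) (fun q => h1 _ _)]
  calc _ ≤ finExp (bern k) (fun b => ∑ q, if b q then 1 else 0) := by
        refine finExp_mono (bern_nonneg (fun q => h0 _ _) fun q => h1 _ _) fun b _ => ?_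
        rw [hg]
        beta_reduce
        rw [nnz_eq_sum]
        refine Finset.sum_le_sum fun q _ => ?_
        cases hb : b q
        · simp [entryErr, hb]
        · simp only [if_true]
          split_ifs <;> norm_num
    _ = _ := by
        rw [finExp_sum, Fintype.sum_prod_type]
        exact Finset.sum_congr rfl fun i _ => Finset.sum_congr rfl fun j _ => finExp_bit k (i, j)

/-- The sampling rate for the target accuracy `ε * ‖A‖`, computed with an estimate `L` of the
spectral norm. -/
noncomputable def sampleRate (K : ℝ) (A : Matrix (Fin m) (Fin n) ℝ) (ε L : ℝ) : ℝ :=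
  (sumAbs A / (ε * L) + (rowSq A + colSq A) / (ε * L * (ε * L))) * Real.log m * K

theorem sampleRate_nonneg {K : ℝ} (hK : 0 ≤ K) (A : Matrix (Fin m) (Fin n) ℝ) {ε L : ℝ}
    (hε : 0 < ε) (hL : 0 ≤ L) : 0 ≤ sampleRate K A ε L :=
  mul_nonneg (mul_nonneg (add_nonneg (div_nonneg (sumAbs_nonneg A) (by positivity))
    (div_nonneg (add_nonneg (rowSq_nonneg A) (colSq_nonneg A)) (by positivity)))
    (Real.log_natCast_nonneg m)) hK

/-- With `p` the least integer above `(c + 2) * log m`, the sampling rate makes the base of the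
failure probability at most `1 / e`, and the `p`-th power of this beats the dimension. -/
theorem one_sub_rpow_le_sampleMat {c κ K : ℝ} (hc : 0 < c) (hκ : 1 ≤ κ)
    (hK : 2 * Real.exp 4 * (c + 4) * κ ^ 2 ≤ K) (A : Matrix (Fin m) (Fin n) ℝ) (hA : A ≠ 0)
    (hnm : n ≤ m) (hm : 2 ≤ m) {ε L : ℝ} (hε : 0 < ε) (hL0 : 0 < L) (hL : L ≤ κ * specNorm A)
    {pos : Fin m × Fin n → ℕ} (hpos : Function.Injective pos) :
    0 < sampleRate K A ε L ∧ 1 - (m : ℝ) ^ (-c) ≤ tapeMeasure.real {ω | specNorm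
      (A - sampleMat A (keepProb A (sampleRate K A ε L)) pos ω) ≤ ε * specNorm A} := by
  obtain ⟨i₀, j₀, h₀⟩ : ∃ i j, A i j ≠ 0 := by
    by_contra! h
    exact hA (Matrix.ext h)
  have hS1 := sumAbs_pos h₀
  have hN := specNorm_pos hA
  have hm2 : (2 : ℝ) ≤ m := by exact_mod_cast hm
  have hl : 1 / 2 ≤ Real.log m := by
    have := Real.log_le_log (by norm_num) hm2
    have := Real.log_two_gt_d9
    linarith
  have hK0 : 0 < K := lt_of_lt_of_le (by positivity) hK
  have hS2 : 0 ≤ rowSq A + colSq A := add_nonneg (rowSq_nonneg A) (colSq_nonneg A)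
  set ℓ := Real.log m with hℓ
  have hℓ0 : 0 < ℓ := by linarith
  set S := rowSq A + colSq A with hS
  set s := sampleRate K A ε L with hs
  have hse : s = (sumAbs A / (ε * L) + S / (ε * L * (ε * L))) * ℓ * K := rfl
  have hs0 : 0 < s := by rw [hse]; positivity
  refine ⟨hs0, ?_⟩
  set τ := ε * specNorm A with hτ
  have hτ0 : 0 < τ := mul_pos hε hN
  have hεL : 0 < ε * L := mul_pos hε hL0
  have hLτ : ε * L ≤ κ * τ := by
    have := mul_le_mul_of_nonneg_left hL hε.le
    rw [hτ]; linarith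
  set p := ⌈(c + 2) * ℓ⌉₊ with hp
  have hp1 : (c + 2) * ℓ ≤ p := Nat.le_ceil _
  have hp2 : (p : ℝ) ≤ (c + 4) * ℓ := by
    have := Nat.ceil_lt_add_one (a := (c + 2) * ℓ) (by positivity)
    linarith
  have hp0 : p ≠ 0 := by
    have : (0 : ℝ) < p := lt_of_lt_of_le (by positivity) hp1
    exact fun h => by simp [h] at this
  refine le_trans ?_ (one_sub_le_sampleMat A hA hs0 hτ0 hpos hp0)
  -- the variance term
  have v1 : p * (S / s) * (2 * Real.exp 4) ≤ τ ^ 2 := by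
    have h1 : S * (ℓ * K) ≤ s * (κ * τ) ^ 2 := by
      have : S / (ε * L * (ε * L)) * (ℓ * K) ≤ s := by
        rw [hse, mul_assoc _ ℓ K]
        refine mul_le_mul_of_nonneg_right (le_add_of_nonneg_left ?_) (mul_pos hℓ0 hK0).le
        exact div_nonneg hS1.le hεL.le
      have h2 := mul_le_mul_of_nonneg_right this (mul_nonneg hεL.le hεL.le)
      have e : S / (ε * L * (ε * L)) * (ℓ * K) * (ε * L * (ε * L)) = S * (ℓ * K) := by
        field_simp
      rw [e] at h2
      refine h2.trans (mul_le_mul_of_nonneg_left ?_ hs0.le)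
      rw [pow_two]
      exact mul_le_mul hLτ hLτ (by positivity) (by positivity)
    have h3 : S / s * (ℓ * K) ≤ (κ * τ) ^ 2 := by
      rw [div_mul_eq_mul_div, div_le_iff₀ hs0]; linarith
    have h4 : p * (S / s) * (2 * Real.exp 4) * κ ^ 2 ≤ τ ^ 2 * κ ^ 2 := by
      calc _ = (S / s) * (p * (2 * Real.exp 4 * κ ^ 2)) := by ring
        _ ≤ (S / s) * ((c + 4) * ℓ * (2 * Real.exp 4 * κ ^ 2)) :=
            mul_le_mul_of_nonneg_left (mul_le_mul_of_nonneg_right hp2 (by positivity))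
              (by positivity)
        _ = (S / s) * (ℓ * (2 * Real.exp 4 * (c + 4) * κ ^ 2)) := by ring
        _ ≤ (S / s) * (ℓ * K) := by gcongr
        _ ≤ _ := h3.trans (le_of_eq (by ring))
    exact le_of_mul_le_mul_right h4 (by positivity)
  -- the term of the largest entry
  have v2 : p * (p * (sumAbs A / s) ^ 2) * (2 * Real.exp 4) ≤ τ ^ 2 := by
    have h1 : sumAbs A * (ℓ * K) ≤ s * (κ * τ) := by
      have : sumAbs A / (ε * L) * (ℓ * K) ≤ s := by
        rw [hse, mul_assoc _ ℓ K]
        exact mul_le_mul_of_nonneg_right (le_add_of_nonneg_right (by positivity))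
          (mul_pos hℓ0 hK0).le
      have h2 := mul_le_mul_of_nonneg_right this hεL.le
      have e : sumAbs A / (ε * L) * (ℓ * K) * (ε * L) = sumAbs A * (ℓ * K) := by field_simp
      rw [e] at h2
      exact h2.trans (mul_le_mul_of_nonneg_left hLτ hs0.le)
    have h3 : sumAbs A / s * (ℓ * K) ≤ κ * τ := by
      rw [div_mul_eq_mul_div, div_le_iff₀ hs0]; linarith
    have h4 : p * (sumAbs A / s) * (2 * Real.exp 4) * κ ≤ τ := by
      have : p * (sumAbs A / s) * (2 * Real.exp 4) * κ * κ ≤ τ * κ := by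
        calc _ = (sumAbs A / s) * (p * (2 * Real.exp 4 * κ ^ 2)) := by ring
          _ ≤ (sumAbs A / s) * ((c + 4) * ℓ * (2 * Real.exp 4 * κ ^ 2)) :=
              mul_le_mul_of_nonneg_left (mul_le_mul_of_nonneg_right hp2 (by positivity))
                (by positivity)
          _ = (sumAbs A / s) * (ℓ * (2 * Real.exp 4 * (c + 4) * κ ^ 2)) := by ring
          _ ≤ (sumAbs A / s) * (ℓ * K) := by gcongr
          _ ≤ _ := h3.trans (le_of_eq (by ring))
      exact le_of_mul_le_mul_right this (by positivity)
    have he : (1 : ℝ) ≤ Real.exp 4 := Real.one_le_exp (by norm_num)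
    set y := p * (sumAbs A / s) with hy
    have hy0 : 0 ≤ y := by positivity
    have h5 : y * (2 * Real.exp 4) ≤ τ :=
      (le_mul_of_one_le_right (by positivity) hκ).trans h4
    have h6 : y ≤ τ := (le_mul_of_one_le_right hy0 (by linarith)).trans h5
    calc _ = y * (y * (2 * Real.exp 4)) := by rw [hy]; ring
      _ ≤ τ * τ := mul_le_mul h6 h5 (by positivity) hτ0.le
      _ = _ := by ring
  have hbase : p * (Real.exp 3 * (S / s + p * (sumAbs A / s) ^ 2)) / τ ^ 2 ≤ Real.exp (-1) := by
    rw [div_le_iff₀ (by positivity)]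
    have e : Real.exp 3 = Real.exp (-1) * Real.exp 4 := by rw [← Real.exp_add]; norm_num
    have : Real.exp (-1) * ((p * (S / s) * (2 * Real.exp 4) +
        p * (p * (sumAbs A / s) ^ 2) * (2 * Real.exp 4)) / 2) ≤ Real.exp (-1) * τ ^ 2 :=
      mul_le_mul_of_nonneg_left (by linarith) (Real.exp_pos _).le
    refine le_trans (le_of_eq ?_) this
    rw [e]; ring
  have hpow : (p * (Real.exp 3 * (S / s + p * (sumAbs A / s) ^ 2)) / τ ^ 2) ^ p ≤
      (m : ℝ) ^ (-(c + 2)) := by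
    refine (pow_le_pow_left₀ (by positivity) hbase p).trans ?_
    rw [← Real.exp_nat_mul, Real.rpow_def_of_pos (by linarith)]
    exact Real.exp_le_exp.2 (by linarith)
  have hmn : (m + n : ℝ) ≤ (m : ℝ) ^ (2 : ℝ) := by
    have : (n : ℝ) ≤ m := by exact_mod_cast hnm
    rw [Real.rpow_two]; nlinarith
  have : (m + n : ℝ) * (p * (Real.exp 3 * (S / s + p * (sumAbs A / s) ^ 2)) / τ ^ 2) ^ p ≤
      (m : ℝ) ^ (-c) := by
    calc _ ≤ (m : ℝ) ^ (2 : ℝ) * (m : ℝ) ^ (-(c + 2)) :=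
          mul_le_mul hmn hpow (by positivity) (by positivity)
      _ = _ := by rw [← Real.rpow_add (by linarith)]; congr 1; ring
  linarith

theorem three_mul_sampleRate_le {κ K : ℝ} (hκ : 1 ≤ κ) (hK : 0 ≤ K)
    (A : Matrix (Fin m) (Fin n) ℝ) (hA : A ≠ 0) {ε L : ℝ} (hε : 0 < ε)
    (hL : specNorm A / κ ≤ L) :
    3 * sampleRate K A ε L ≤ 6 * K * κ ^ 2 * ((ε ^ 2)⁻¹ * ns A * sr A * Real.log m +
      ε⁻¹ * Real.sqrt (ns A * sr A * n) * Real.log m) := by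
  have hN := specNorm_pos hA
  have hκ0 : 0 < κ := by linarith
  have hF := frobNorm_nonneg A
  have hns := ns_nonneg A
  have hsqrt : Real.sqrt (ns A * sr A * n) = Real.sqrt (ns A * n) * (frobNorm A / specNorm A) := by
    have : ns A * sr A * n = ns A * n * (frobNorm A / specNorm A) ^ 2 := by
      rw [sr, div_pow]; ring
    rw [this, Real.sqrt_mul (by positivity), Real.sqrt_sq (by positivity)]
  have hLinv : (ε * L)⁻¹ ≤ κ * (ε * specNorm A)⁻¹ := by
    have h1 : ε * (specNorm A / κ) ≤ ε * L := mul_le_mul_of_nonneg_left hL hε.le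
    have := inv_anti₀ (by positivity) h1
    refine this.trans (le_of_eq ?_)
    field_simp
  have hLinv0 : 0 ≤ (ε * L)⁻¹ :=
    inv_nonneg.2 (mul_nonneg hε.le (le_trans (by positivity) hL))
  have b1 : sumAbs A / (ε * L) ≤ κ * (ε⁻¹ * Real.sqrt (ns A * sr A * n)) := by
    rw [div_eq_mul_inv, hsqrt]
    refine (mul_le_mul (sumAbs_le A) hLinv hLinv0 (by positivity)).trans (le_of_eq ?_)
    field_simp
  have b2 : (rowSq A + colSq A) / (ε * L * (ε * L)) ≤
      2 * κ ^ 2 * ((ε ^ 2)⁻¹ * ns A * sr A) := by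
    rw [div_eq_mul_inv, mul_inv]
    have h1 : rowSq A + colSq A ≤ 2 * (ns A * frobNorm A ^ 2) := by
      linarith [rowSq_le A, colSq_le A]
    refine (mul_le_mul h1 (mul_le_mul hLinv hLinv hLinv0 (by positivity)) (by positivity)
      (by positivity)).trans (le_of_eq ?_)
    rw [sr]
    field_simp
  have b3 : κ * (ε⁻¹ * Real.sqrt (ns A * sr A * n)) ≤
      2 * κ ^ 2 * (ε⁻¹ * Real.sqrt (ns A * sr A * n)) :=
    mul_le_mul_of_nonneg_right (by nlinarith) (by positivity)
  have hl : 0 ≤ Real.log m := Real.log_natCast_nonneg m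
  calc _ ≤ 3 * ((2 * κ ^ 2 * (ε⁻¹ * Real.sqrt (ns A * sr A * n)) +
        2 * κ ^ 2 * ((ε ^ 2)⁻¹ * ns A * sr A)) * Real.log m * K) := by
        rw [sampleRate]
        have := add_le_add (b1.trans b3) b2
        gcongr
    _ = _ := by ring

theorem sparsifier_bound_nonneg (A : Matrix (Fin m) (Fin n) ℝ) {ε : ℝ} (hε : 0 < ε) :
    0 ≤ (ε ^ 2)⁻¹ * ns A * sr A * Real.log m +
      ε⁻¹ * Real.sqrt (ns A * sr A * n) * Real.log m := by
  have h1 := ns_nonneg A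
  have h2 := sr_nonneg A
  have h3 : 0 ≤ Real.log m := Real.log_natCast_nonneg m
  positivity

theorem isGoodSparsifier_sampleMat {c κ K C : ℝ} (hc : 0 < c) (hκ : 1 ≤ κ)
    (hK : 2 * Real.exp 4 * (c + 4) * κ ^ 2 ≤ K) (hC : 6 * K * κ ^ 2 ≤ C)
    (A : Matrix (Fin m) (Fin n) ℝ) (hnm : n ≤ m) {ε L : ℝ} (hε : 0 < ε)
    (hL1 : specNorm A / κ ≤ L) (hL2 : L ≤ κ * specNorm A)
    {pos : Fin m × Fin n → ℕ} (hpos : Function.Injective pos) :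
    IsGoodSparsifier A ε c C (sampleMat A (keepProb A (sampleRate K A ε L)) pos) := by
  have hK0 : 0 ≤ K := le_trans (by positivity) hK
  have hbound := sparsifier_bound_nonneg A hε
  rcases eq_or_ne A 0 with rfl | hA
  · have hz : ∀ s ω, sampleMat (0 : Matrix (Fin m) (Fin n) ℝ) (keepProb 0 s) pos ω = 0 := by
      intro s ω; ext i j; simp [sampleMat]
    have he : sampleMat (0 : Matrix (Fin m) (Fin n) ℝ) (keepProb 0 (sampleRate K (0 : Matrix (Fin m) (Fin n) ℝ) ε L)) pos =
        sampleMat 0 (keepProb 0 1) pos := by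
      funext ω; rw [hz, hz]
    have hn0 : nnz (0 : Matrix (Fin m) (Fin n) ℝ) = 0 := by simp [nnz]
    refine ⟨⟨1, zero_le_one, fun _ => one_pos, ?_⟩, ?_, ?_, ?_⟩
    · rw [he]
      exact isEntrywiseSample_sampleMat _ (fun i j => keepProb_nonneg _ zero_le_one i j)
        (fun i j => keepProb_le_one _ _ i j) hpos
    · simp only [hz, sub_zero, specNorm_zero, mul_zero, le_refl, Set.ofPred_true, probReal_univ]
      linarith [Real.rpow_nonneg (Nat.cast_nonneg (α := ℝ) m) (-c)]
    · simp only [hz, hn0]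
      exact integrable_const _
    · simp only [hz, hn0, Nat.cast_zero, integral_zero]
      refine mul_nonneg (le_trans (by positivity) hC) hbound
  · have hN := specNorm_pos hA
    have hL0 : 0 < L := lt_of_lt_of_le (by positivity) hL1
    have hs := sampleRate_nonneg hK0 A hε hL0.le
    obtain ⟨hint, hexp⟩ := nnz_sampleMat A (fun i j => keepProb_nonneg A hs i j)
      (fun i j => keepProb_le_one A _ i j) hpos
    have main : (2 ≤ m → 0 < sampleRate K A ε L) ∧ 1 - (m : ℝ) ^ (-c) ≤ tapeMeasure.real {ω |
        specNorm (A - sampleMat A (keepProb A (sampleRate K A ε L)) pos ω) ≤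
          ε * specNorm A} := by
      rcases Nat.lt_or_ge m 2 with hm | hm
      · have hm1 : m = 1 := by
          rcases Nat.eq_zero_or_pos m with h | h
          · subst h
            exact absurd (Matrix.ext fun i => i.elim0) hA
          · omega
        refine ⟨fun h => absurd h (by omega), ?_⟩
        have h1 : (m : ℝ) ^ (-c) = 1 := by rw [hm1, Nat.cast_one, Real.one_rpow]
        rw [h1, sub_self]
        exact measureReal_nonneg
      · obtain ⟨h1, h2⟩ := one_sub_rpow_le_sampleMat hc hκ hK A hA hnm hm hε hL0 hL2 hpos
        exact ⟨fun _ => h1, h2⟩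
    refine ⟨⟨_, hs, main.1, isEntrywiseSample_sampleMat A (fun i j => keepProb_nonneg A hs i j)
      (fun i j => keepProb_le_one A _ i j) hpos⟩, main.2, hint, ?_⟩
    exact hexp.trans ((sum_keepProb_le A hs).trans
      ((three_mul_sampleRate_le hκ hK0 A hA hε hL1).trans
        (mul_le_mul_of_nonneg_right hC hbound)))

end Sample

/-! ### Straight-line code and counting loops -/

section Programs

variable {ω : ℕ → unitInterval}

/-- The straight-line program that executes a list of instructions. -/
def block : List Instr → Prog
  | [] => .skip
  | c :: cs => .seq (.instr c) (block cs)

theorem exec_block (cs : List Instr) (σ : State) :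
    Exec ω (block cs) σ (cs.foldl (Instr.step ω) σ) (cs.length + 1) := by
  induction cs generalizing σ with
  | nil => exact .skip σ
  | cons c cs ih =>
    rw [List.length_cons, add_comm (cs.length + 1) 1, List.foldl_cons]
    exact .seq (.instr c σ) (ih _)

/-- Loop rule for a loop whose counter is register `i` and whose bound is register `r`.  The
invariant also sees the number of steps made so far. -/
theorem exec_loop {i r N : ℕ} {body : Prog} (Inv : ℕ → State → ℕ → Prop)
    (hreg : ∀ k σ u, Inv k σ u → σ.nreg i = k ∧ σ.nreg r = N)
    (hstep : ∀ k σ u, k < N → Inv k σ u → ∃ σ' t, Exec ω body σ σ' t ∧ Inv (k + 1) σ' (u + t + 1))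
    {k₀ : ℕ} (hk₀ : k₀ ≤ N) {σ : State} {u : ℕ} (h0 : Inv k₀ σ u) :
    ∃ σ' t, Exec ω (.loop (.nlt i r) body) σ σ' (t + 1) ∧ Inv N σ' (u + t) := by
  suffices H : ∀ d k σ u, k + d = N → Inv k σ u →
      ∃ σ' t, Exec ω (.loop (.nlt i r) body) σ σ' (t + 1) ∧ Inv N σ' (u + t) from
    H (N - k₀) k₀ σ u (by omega) h0
  intro d
  induction d with
  | zero =>
    intro k σ u hk h
    have hr := hreg k σ u h
    rw [add_zero] at hk
    subst hk
    refine ⟨σ, 0, ?_, h⟩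
    have hend : ¬ (Test.nlt i r).holds σ := by simp [Test.holds, hr]
    rw [zero_add]
    constructor
    exact hend
  | succ d ih =>
    intro k σ u hk h
    have hr := hreg k σ u h
    obtain ⟨σ₁, t₁, he₁, hi₁⟩ := hstep k σ u (by omega) h
    obtain ⟨σ₂, t₂, he₂, hi₂⟩ := ih (k + 1) σ₁ _ (by omega) hi₁
    refine ⟨σ₂, t₁ + (t₂ + 1), .loop_step ?_ he₁ he₂, ?_⟩
    · simp only [Test.holds, hr]; omega
    · convert hi₂ using 1; omega

/-- Loop rule for loops without a time bound. -/
theorem exec_loop_untimed {i r N : ℕ} {body : Prog} (Inv : ℕ → State → Prop)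
    (hreg : ∀ k σ, Inv k σ → σ.nreg i = k ∧ σ.nreg r = N)
    (hstep : ∀ k σ, k < N → Inv k σ → ∃ σ' t, Exec ω body σ σ' t ∧ Inv (k + 1) σ')
    {k₀ : ℕ} (hk₀ : k₀ ≤ N) {σ : State} (h0 : Inv k₀ σ) :
    ∃ σ' t, Exec ω (.loop (.nlt i r) body) σ σ' t ∧ Inv N σ' := by
  obtain ⟨σ', t, h⟩ := exec_loop (ω := ω) (fun k σ _ => Inv k σ) (fun k σ _ => hreg k σ)
    (fun k σ _ => hstep k σ) hk₀ (u := 0) h0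
  exact ⟨σ', _, h⟩

/-- Loop rule for a body that takes at most `T` steps. -/
theorem exec_loop_timed {i r N : ℕ} {body : Prog} (T : ℕ) (Inv : ℕ → State → Prop)
    (hreg : ∀ k σ, Inv k σ → σ.nreg i = k ∧ σ.nreg r = N)
    (hstep : ∀ k σ, k < N → Inv k σ → ∃ σ' t, Exec ω body σ σ' t ∧ t ≤ T ∧ Inv (k + 1) σ')
    {σ : State} (h0 : Inv 0 σ) :
    ∃ σ' t, Exec ω (.loop (.nlt i r) body) σ σ' t ∧ t ≤ N * (T + 1) + 1 ∧ Inv N σ' := by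
  obtain ⟨σ', t, he, hi, ht⟩ := exec_loop (ω := ω) (fun k σ u => Inv k σ ∧ u ≤ k * (T + 1))
    (fun k σ _ h => hreg k σ h.1) (fun k σ u hk h => by
      obtain ⟨σ', t, he, ht, hi⟩ := hstep k σ hk h.1
      refine ⟨σ', t, he, hi, ?_⟩
      rw [add_mul, one_mul]; linarith [h.2]) (Nat.zero_le N) (u := 0) ⟨h0, by simp⟩
  exact ⟨σ', _, he, by omega, hi⟩

/-- Real register `d` becomes the maximum of `a` and `b`, as `(a + b + √((a - b)²)) / 2`; register
`t` is scratch. -/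
def maxBlock (d a b t : ℕ) : List Instr :=
  [.rsub t a b, .rmul t t t, .rsqrt t t, .radd d a b, .radd d d t, .rconst t (1 / 2), .rmul d d t]

/-- Real register `d` becomes the minimum of `a` and `b`; register `t` is scratch. -/
def minBlock (d a b t : ℕ) : List Instr :=
  [.rsub t a b, .rmul t t t, .rsqrt t t, .radd d a b, .rsub d d t, .rconst t (1 / 2), .rmul d d t]

theorem max_eq_half (x y : ℝ) : (x + y + |x - y|) * (1 / 2) = max x y := by
  rcases le_total x y with h | h
  · rw [max_eq_right h, abs_of_nonpos (sub_nonpos.2 h)]; ring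
  · rw [max_eq_left h, abs_of_nonneg (sub_nonneg.2 h)]; ring

theorem min_eq_half (x y : ℝ) : (x + y - |x - y|) * (1 / 2) = min x y := by
  rcases le_total x y with h | h
  · rw [min_eq_left h, abs_of_nonpos (sub_nonpos.2 h)]; ring
  · rw [min_eq_right h, abs_of_nonneg (sub_nonneg.2 h)]; ring

theorem foldl_maxBlock {d a b t : ℕ} (ha : a ≠ t) (hb : b ≠ t) (hd : d ≠ t) (σ : State) :
    (maxBlock d a b t).foldl (Instr.step ω) σ =
      (σ.setR t (1 / 2)).setR d (max (σ.rreg a) (σ.rreg b)) := by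
  simp only [maxBlock, List.foldl_cons, List.foldl_nil, Instr.step, State.setR]
  congr 1
  funext x
  simp only [Function.update_apply, ha, hb, hd, hd.symm, if_true, if_false,
    Real.sqrt_mul_self_eq_abs]
  by_cases hx : x = d
  · simp only [hx, if_true]
    rw [← max_eq_half]
    norm_num
  · by_cases hxt : x = t <;> simp [hx, hxt, hd.symm]

theorem foldl_minBlock {d a b t : ℕ} (ha : a ≠ t) (hb : b ≠ t) (hd : d ≠ t) (σ : State) :
    (minBlock d a b t).foldl (Instr.step ω) σ =
      (σ.setR t (1 / 2)).setR d (min (σ.rreg a) (σ.rreg b)) := by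
  simp only [minBlock, List.foldl_cons, List.foldl_nil, Instr.step, State.setR]
  congr 1
  funext x
  simp only [Function.update_apply, ha, hb, hd, hd.symm, if_true, if_false,
    Real.sqrt_mul_self_eq_abs]
  by_cases hx : x = d
  · simp only [hx, if_true]
    rw [← min_eq_half]
    norm_num
  · by_cases hxt : x = t <;> simp [hx, hxt, hd.symm]

end Programs

/-! ### The sampling program -/

section Sampler

open Finset

variable {ω : ℕ → unitInterval}

/-- The registers and arrays that hold the input, for a list of `N` triples `(r k, c k, v k)`.
Natural register `4` holds the constant `1`. -/
structure HasInput (m N : ℕ) (r c : ℕ → ℕ) (v : ℕ → ℝ) (ε L : ℝ) (σ : State) : Prop where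
  rows : σ.nreg 0 = m
  size : σ.nreg 2 = N
  one : σ.nreg 4 = 1
  row : ∀ k < N, σ.narr 0 k = r k
  col : ∀ k < N, σ.narr 1 k = c k
  val : ∀ k < N, σ.rarr 0 k = v k
  eps : σ.rreg 0 = ε
  est : σ.rreg 1 = L

/-- Natural registers `6`, `7` and real registers `2`, `3` receive the row, the column, the value
and the absolute value of the current entry. -/
def loadEntry : List Instr :=
  [.nload 6 0 5, .nload 7 1 5, .rload 2 0 5, .rmul 3 2 2, .rsqrt 3 3]

/-- Adds the current entry to the `ℓ₁` norms of the matrix (real register `4`), of its row (real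
array `2`) and of its column (real array `3`). -/
def accumulateL1 : List Instr :=
  loadEntry ++ [.radd 4 4 3, .rload 7 2 6, .radd 7 7 3, .rstore 2 6 7, .rload 7 3 7, .radd 7 7 3,
    .rstore 3 7 7, .nadd 5 5 4]

/-- Adds the contributions `|a| ‖A_i‖₁` and `|a| ‖A^j‖₁` of the current entry `a` to the sums of the
squared `ℓ₁` norms of the rows (real register `5`) and of the columns (real register `6`). -/
def accumulateSq : List Instr :=
  loadEntry ++ [.rload 7 2 6, .rmul 7 3 7, .radd 5 5 7, .rload 7 3 7, .rmul 7 3 7, .radd 6 6 7,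
    .nadd 5 5 4]

/-- Real register `8` receives the sampling rate. -/
def computeRate (K : ℚ) : List Instr :=
  [.rmul 7 0 1, .rdiv 8 4 7, .radd 9 5 6, .rmul 7 7 7, .rdiv 9 9 7, .radd 8 8 9, .rcast 9 0,
    .rlog 9 9, .rmul 8 8 9, .rconst 9 K, .rmul 8 8 9]

/-- Real register `7` receives the keeping probability of the current entry. -/
def computeProb : List Instr :=
  loadEntry ++ [.rdiv 7 3 4, .rload 9 3 7, .rmul 9 3 9, .rdiv 9 9 6, .rload 10 2 6, .rmul 10 3 10,
    .rdiv 10 10 5] ++ maxBlock 9 10 9 11 ++ maxBlock 7 7 9 11 ++ [.rmul 7 8 7, .rconst 9 1] ++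
    minBlock 7 9 7 11

/-- Writes the current entry, divided by its keeping probability, behind the end of the output
list; real register `9` receives a random number. -/
def writeEntry : List Instr :=
  [.rrand 9, .rdiv 12 2 7, .nstore 2 3 6, .nstore 3 3 7, .rstore 1 3 12, .nadd 5 5 4]

/-- The body of the sampling loop; the output list is extended by the written entry if the random
number is less than the keeping probability. -/
def sampleStep : Prog :=
  .seq (block computeProb) (.seq (block writeEntry) (.cond (.rlt 9 7) (.instr (.nadd 3 3 4)) .skip))

/-- The sampling program.  It makes three passes over the list of the entries. -/
def sampler (K : ℚ) : Prog :=
  .seq (block [.nconst 4 1, .nconst 5 0, .rconst 4 0, .rconst 5 0, .rconst 6 0])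
  (.seq (.loop (.nlt 5 2) (block accumulateL1))
  (.seq (.instr (.nconst 5 0))
  (.seq (.loop (.nlt 5 2) (block accumulateSq))
  (.seq (block (computeRate K))
  (.seq (block [.nconst 5 0, .nconst 3 0])
  (.loop (.nlt 5 2) sampleStep))))))

/-- The sum of the absolute values of the entries `k < N` of a list with `f k = i`. -/
noncomputable def lineSum (f : ℕ → ℕ) (v : ℕ → ℝ) (N i : ℕ) : ℝ :=
  ∑ k ∈ range N, if f k = i then |v k| else 0

/-- The keeping probability of entry `x` of the list `(r k, c k, v k)`, `k < N`. -/
noncomputable def listProb (N : ℕ) (r c : ℕ → ℕ) (v : ℕ → ℝ) (s : ℝ) (x : ℕ) : ℝ :=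
  min 1 (s * max (|v x| / ∑ k ∈ range N, |v k|)
    (max (|v x| * lineSum r v N (r x) / ∑ k ∈ range N, |v k| * lineSum r v N (r k))
      (|v x| * lineSum c v N (c x) / ∑ k ∈ range N, |v k| * lineSum c v N (c k))))

/-- The sampling rate of the list `(r k, c k, v k)`, `k < N`, in a matrix with `m` rows. -/
noncomputable def listRate (K : ℝ) (m N : ℕ) (r c : ℕ → ℕ) (v : ℕ → ℝ) (ε L : ℝ) : ℝ :=
  ((∑ k ∈ range N, |v k|) / (ε * L) +
    (∑ k ∈ range N, |v k| * lineSum r v N (r k) + ∑ k ∈ range N, |v k| * lineSum c v N (c k)) /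
      (ε * L * (ε * L))) * Real.log m * K

variable {m N : ℕ} {r c : ℕ → ℕ} {v : ℕ → ℝ} {ε L : ℝ}

theorem accumulateL1_loop {σ : State} (h : HasInput m N r c v ε L σ) (h5 : σ.nreg 5 = 0)
    (hS : σ.rreg 4 = 0) (hR : ∀ i, σ.rarr 2 i = 0) (hC : ∀ i, σ.rarr 3 i = 0) (hpos : σ.pos = 0)
    (z5 : σ.rreg 5 = 0) (z6 : σ.rreg 6 = 0) :
    ∃ σ' t, Exec ω (.loop (.nlt 5 2) (block accumulateL1)) σ σ' t ∧ t ≤ N * 15 + 1 ∧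
      HasInput m N r c v ε L σ' ∧ σ'.rreg 4 = ∑ k ∈ range N, |v k| ∧
      (∀ i, σ'.rarr 2 i = lineSum r v N i) ∧ (∀ i, σ'.rarr 3 i = lineSum c v N i) ∧
      σ'.pos = 0 ∧ σ'.rreg 5 = 0 ∧ σ'.rreg 6 = 0 := by
  obtain ⟨σ', t, he, ht, h⟩ := exec_loop_timed (ω := ω) (i := 5) (r := 2) (N := N)
    (body := block accumulateL1) 14
    (fun k σ => σ.nreg 5 = k ∧ HasInput m N r c v ε L σ ∧ σ.rreg 4 = ∑ k ∈ range k, |v k| ∧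
      (∀ i, σ.rarr 2 i = lineSum r v k i) ∧ (∀ i, σ.rarr 3 i = lineSum c v k i) ∧
      σ.pos = 0 ∧ σ.rreg 5 = 0 ∧ σ.rreg 6 = 0)
    (fun k σ h => ⟨h.1, h.2.1.size⟩)
    (fun k σ hk h => by
      obtain ⟨h5, hi, hS, hR, hC, hpos, z5, z6⟩ := h
      refine ⟨_, _, exec_block _ _, le_refl _, ?_⟩
      have e1 := hi.row k hk
      have e2 := hi.col k hk
      have e3 := hi.val k hk
      simp only [accumulateL1, loadEntry, List.cons_append, List.nil_append, List.foldl_cons,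
        List.foldl_nil, Instr.step, State.setN, State.setR]
      refine ⟨?_, ⟨?_, ?_, ?_, ?_, ?_, ?_, ?_, ?_⟩, ?_, ?_, ?_, ?_, ?_, ?_⟩
      all_goals simp [Function.update_apply, h5, hi.rows, hi.size, hi.one, hi.eps, hi.est, hpos,
        z5, z6, e1, e2, e3, hS, Finset.sum_range_succ, hR, hC, Real.sqrt_mul_self_eq_abs]
      · exact hi.row
      · exact hi.col
      · exact hi.val
      · intro i
        simp only [lineSum, Finset.sum_range_succ]
        by_cases hx : i = r k
        · simp [hx]
        · simp [hx, Ne.symm hx]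
      · intro i
        simp only [lineSum, Finset.sum_range_succ]
        by_cases hx : i = c k
        · simp [hx]
        · simp [hx, Ne.symm hx])
    (σ := σ) ⟨h5, h, by simp [hS], by simp [hR, lineSum], by simp [hC, lineSum], hpos, z5, z6⟩
  exact ⟨σ', t, he, ht, h.2⟩

theorem accumulateSq_loop {S : ℝ} {R C : ℕ → ℝ} {σ : State} (h : HasInput m N r c v ε L σ)
    (h5 : σ.nreg 5 = 0) (hS : σ.rreg 4 = S) (hR : ∀ i, σ.rarr 2 i = R i)
    (hC : ∀ i, σ.rarr 3 i = C i) (hpos : σ.pos = 0) (z5 : σ.rreg 5 = 0) (z6 : σ.rreg 6 = 0) :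
    ∃ σ' t, Exec ω (.loop (.nlt 5 2) (block accumulateSq)) σ σ' t ∧ t ≤ N * 14 + 1 ∧
      HasInput m N r c v ε L σ' ∧ σ'.rreg 4 = S ∧ (∀ i, σ'.rarr 2 i = R i) ∧
      (∀ i, σ'.rarr 3 i = C i) ∧ σ'.pos = 0 ∧ σ'.rreg 5 = ∑ k ∈ range N, |v k| * R (r k) ∧
      σ'.rreg 6 = ∑ k ∈ range N, |v k| * C (c k) := by
  obtain ⟨σ', t, he, ht, h⟩ := exec_loop_timed (ω := ω) (i := 5) (r := 2) (N := N)
    (body := block accumulateSq) 13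
    (fun k σ => σ.nreg 5 = k ∧ HasInput m N r c v ε L σ ∧ σ.rreg 4 = S ∧
      (∀ i, σ.rarr 2 i = R i) ∧ (∀ i, σ.rarr 3 i = C i) ∧
      σ.pos = 0 ∧ σ.rreg 5 = ∑ k ∈ range k, |v k| * R (r k) ∧
      σ.rreg 6 = ∑ k ∈ range k, |v k| * C (c k))
    (fun k σ h => ⟨h.1, h.2.1.size⟩)
    (fun k σ hk h => by
      obtain ⟨h5, hi, hS, hR, hC, hpos, z5, z6⟩ := h
      refine ⟨_, _, exec_block _ _, le_refl _, ?_⟩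
      have e1 := hi.row k hk
      have e2 := hi.col k hk
      have e3 := hi.val k hk
      simp only [accumulateSq, loadEntry, List.cons_append, List.nil_append, List.foldl_cons,
        List.foldl_nil, Instr.step, State.setN, State.setR]
      refine ⟨?_, ⟨?_, ?_, ?_, ?_, ?_, ?_, ?_, ?_⟩, ?_, ?_, ?_, ?_, ?_, ?_⟩
      all_goals simp [h5, hi.rows, hi.size, hi.one, hi.eps, hi.est, hpos,
        z5, z6, e1, e2, e3, hS, Finset.sum_range_succ, hR, hC, Real.sqrt_mul_self_eq_abs]
      · exact hi.row
      · exact hi.col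
      · exact hi.val)
    (σ := σ) ⟨h5, h, hS, hR, hC, hpos, by simp [z5], by simp [z6]⟩
  exact ⟨σ', t, he, ht, h.2⟩

open Classical in
/-- The sampling loop.  After `k` rounds the output list consists of the kept entries among the
first `k`, in their order. -/
theorem sampleStep_loop {S S2 S3 s : ℝ} {R C : ℕ → ℝ} {σ : State}
    (h : HasInput m N r c v ε L σ) (h5 : σ.nreg 5 = 0) (hS : σ.rreg 4 = S)
    (hR : ∀ i, σ.rarr 2 i = R i) (hC : ∀ i, σ.rarr 3 i = C i) (hpos : σ.pos = 0)
    (z5 : σ.rreg 5 = S2) (z6 : σ.rreg 6 = S3) (z8 : σ.rreg 8 = s) (h3 : σ.nreg 3 = 0)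
    {p : ℕ → ℝ} (hp : ∀ x, p x = min 1 (s * max (|v x| / S)
      (max (|v x| * R (r x) / S2) (|v x| * C (c x) / S3)))) :
    ∃ σ' t, Exec ω (.loop (.nlt 5 2) sampleStep) σ σ' t ∧ t ≤ N * 48 + 1 ∧
      σ'.nreg 3 = Nat.count (fun x => (ω x : ℝ) < p x) N ∧
      ∀ x < N, (ω x : ℝ) < p x →
        σ'.narr 2 (Nat.count (fun x => (ω x : ℝ) < p x) x) = r x ∧
        σ'.narr 3 (Nat.count (fun x => (ω x : ℝ) < p x) x) = c x ∧
        σ'.rarr 1 (Nat.count (fun x => (ω x : ℝ) < p x) x) = v x / p x := by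
  set P : ℕ → Prop := fun x => (ω x : ℝ) < p x with hP
  obtain ⟨σ', t, he, ht, h⟩ := exec_loop_timed (ω := ω) (i := 5) (r := 2) (N := N)
    (body := sampleStep) 47
    (fun k σ => σ.nreg 5 = k ∧ HasInput m N r c v ε L σ ∧ σ.rreg 4 = S ∧
      (∀ i, σ.rarr 2 i = R i) ∧ (∀ i, σ.rarr 3 i = C i) ∧
      σ.pos = k ∧ σ.rreg 5 = S2 ∧ σ.rreg 6 = S3 ∧ σ.rreg 8 = s ∧ σ.nreg 3 = Nat.count P k ∧
      ∀ x < k, P x → σ.narr 2 (Nat.count P x) = r x ∧ σ.narr 3 (Nat.count P x) = c x ∧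
        σ.rarr 1 (Nat.count P x) = v x / p x)
    (fun k σ h => ⟨h.1, h.2.1.size⟩)
    (fun k σ hk h => by
      obtain ⟨h5, hi, hS, hR, hC, hpos, z5, z6, z8, h3, hout⟩ := h
      have e1 := hi.row k hk
      have e2 := hi.col k hk
      have e3 := hi.val k hk
      -- after the computation of the keeping probability
      obtain ⟨σ₁, hσ₁⟩ : ∃ σ₁, σ₁ = computeProb.foldl (Instr.step ω) σ := ⟨_, rfl⟩
      have hp7 : σ₁.rreg 7 = p k ∧ σ₁.nreg 5 = k ∧ σ₁.nreg 6 = r k ∧ σ₁.nreg 7 = c k ∧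
          σ₁.rreg 2 = v k ∧ HasInput m N r c v ε L σ₁ ∧ σ₁.rreg 4 = S ∧
          (∀ i, σ₁.rarr 2 i = R i) ∧ (∀ i, σ₁.rarr 3 i = C i) ∧ σ₁.pos = k ∧ σ₁.rreg 5 = S2 ∧
          σ₁.rreg 6 = S3 ∧ σ₁.rreg 8 = s ∧ σ₁.nreg 3 = Nat.count P k ∧ σ₁.narr = σ.narr ∧
          σ₁.rarr = σ.rarr := by
        rw [hσ₁]
        simp only [computeProb, loadEntry, List.foldl_append, List.foldl_cons, List.foldl_nil,
          Instr.step]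
        rw [foldl_maxBlock (by norm_num) (by norm_num) (by norm_num),
          foldl_maxBlock (by norm_num) (by norm_num) (by norm_num),
          foldl_minBlock (by norm_num) (by norm_num) (by norm_num)]
        simp only [State.setN, State.setR]
        refine ⟨?_, ?_, ?_, ?_, ?_, ⟨?_, ?_, ?_, ?_, ?_, ?_, ?_, ?_⟩, ?_, ?_, ?_, ?_, ?_, ?_, ?_,
          ?_, trivial, trivial⟩
        all_goals simp [h5, hi.rows, hi.size, hi.one, hi.eps, hi.est, hpos,
          z5, z6, z8, h3, e1, e2, e3, hS, hR, hC, Real.sqrt_mul_self_eq_abs]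
        · rw [hp, min_comm]
        · exact hi.row
        · exact hi.col
        · exact hi.val
      have hexec₁ : Exec ω (block computeProb) σ σ₁ 36 := by
        rw [hσ₁]; exact exec_block computeProb σ
      clear hσ₁ h5 hi hS hR hC hpos z5 z6 z8 h3
      obtain ⟨hp7, h5, h6, h7, h2, hi, hS, hR, hC, hpos, z5, z6, z8, h3, hn, hr⟩ := hp7
      rw [← hn, ← hr] at hout
      -- after the entry is written
      obtain ⟨σ₂, hσ₂⟩ : ∃ σ₂, σ₂ = writeEntry.foldl (Instr.step ω) σ₁ := ⟨_, rfl⟩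
      have h2' : σ₂.rreg 7 = p k ∧ σ₂.rreg 9 = ω k ∧ σ₂.nreg 5 = k + 1 ∧
          HasInput m N r c v ε L σ₂ ∧ σ₂.rreg 4 = S ∧
          (∀ i, σ₂.rarr 2 i = R i) ∧ (∀ i, σ₂.rarr 3 i = C i) ∧ σ₂.pos = k + 1 ∧ σ₂.rreg 5 = S2 ∧
          σ₂.rreg 6 = S3 ∧ σ₂.rreg 8 = s ∧ σ₂.nreg 3 = Nat.count P k ∧
          (∀ y, σ₂.narr 2 y = if y = Nat.count P k then r k else σ₁.narr 2 y) ∧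
          (∀ y, σ₂.narr 3 y = if y = Nat.count P k then c k else σ₁.narr 3 y) ∧
          (∀ y, σ₂.rarr 1 y = if y = Nat.count P k then v k / p k else σ₁.rarr 1 y) := by
        rw [hσ₂]
        simp only [writeEntry, List.foldl_cons, List.foldl_nil, Instr.step, State.setN, State.setR]
        refine ⟨?_, ?_, ?_, ⟨?_, ?_, ?_, ?_, ?_, ?_, ?_, ?_⟩, ?_, ?_, ?_, ?_, ?_, ?_, ?_,
          ?_, ?_, ?_, ?_⟩
        all_goals simp [Function.update_apply, h5, hi.rows, hi.size, hi.one, hi.eps, hi.est, hpos,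
          z5, z6, z8, h3, hS, hR, hC, hp7, h6, h7, h2]
        · exact hi.row
        · exact hi.col
        · exact hi.val
      have hexec₂ : Exec ω (block writeEntry) σ₁ σ₂ 7 := by
        rw [hσ₂]; exact exec_block writeEntry σ₁
      clear hσ₂ h5 hi hS hR hC hpos z5 z6 z8 h3 hp7
      obtain ⟨hp7, h9, h5, hi, hS, hR, hC, hpos, z5, z6, z8, h3, o1, o2, o3⟩ := h2'
      have hout' : ∀ x < k, P x → σ₂.narr 2 (Nat.count P x) = r x ∧
          σ₂.narr 3 (Nat.count P x) = c x ∧ σ₂.rarr 1 (Nat.count P x) = v x / p x := by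
        intro x hx hPx
        have hne : Nat.count P x ≠ Nat.count P k := (Nat.count_strict_mono hPx hx).ne
        rw [o1, o2, o3, if_neg hne, if_neg hne, if_neg hne]
        exact hout x hx hPx
      have htest : (Test.rlt 9 7).holds σ₂ ↔ P k := by
        simp only [Test.holds, h9, hp7, hP]
      by_cases hPk : P k
      · refine ⟨_, _, .seq hexec₁ (.seq hexec₂ (.cond_pos (htest.2 hPk) (.instr _ _))),
          by norm_num, ?_⟩
        simp only [Instr.step, State.setN]
        refine ⟨?_, ⟨?_, ?_, ?_, ?_, ?_, ?_, ?_, ?_⟩, hS, hR, hC, hpos, z5, z6, z8, ?_, ?_⟩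
        rotate_right
        · intro x hx hPx
          rcases Nat.lt_succ_iff_lt_or_eq.1 hx with hx | rfl
          · exact hout' x hx hPx
          · rw [o1, o2, o3]; simp
        all_goals simp [h5, hi.rows, hi.size, hi.one, hi.eps, hi.est, h3,
          Nat.count_succ, hPk]
        · exact hi.row
        · exact hi.col
        · exact hi.val
      · refine ⟨_, _, .seq hexec₁ (.seq hexec₂ (.cond_neg (fun h => hPk (htest.1 h)) (.skip _))),
          by norm_num, h5, hi, hS, hR, hC, hpos, z5, z6, z8, ?_, ?_⟩
        · rw [h3, Nat.count_succ, if_neg hPk, add_zero]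
        · intro x hx hPx
          rcases Nat.lt_succ_iff_lt_or_eq.1 hx with hx | rfl
          · exact hout' x hx hPx
          · exact absurd hPx hPk)
    (σ := σ) ⟨h5, h, hS, hR, hC, hpos, z5, z6, z8, by simp [h3],
      fun x hx => absurd hx (Nat.not_lt_zero x)⟩
  exact ⟨σ', t, he, ht, h.2.2.2.2.2.2.2.2.2.1, h.2.2.2.2.2.2.2.2.2.2⟩

open Classical in
theorem exec_sampler (K : ℚ) {σ : State} (hm : σ.nreg 0 = m) (hN : σ.nreg 2 = N)
    (hr : ∀ k < N, σ.narr 0 k = r k) (hc : ∀ k < N, σ.narr 1 k = c k)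
    (hv : ∀ k < N, σ.rarr 0 k = v k) (hε : σ.rreg 0 = ε) (hL : σ.rreg 1 = L)
    (h2 : ∀ i, σ.rarr 2 i = 0) (h3 : ∀ i, σ.rarr 3 i = 0) (hpos : σ.pos = 0)
    {p : ℕ → ℝ} (hp : p = listProb N r c v (listRate K m N r c v ε L)) :
    ∃ σ' t, Exec ω (sampler K) σ σ' t ∧ t ≤ 100 * (N + 1) ∧
      σ'.nreg 3 = Nat.count (fun x => (ω x : ℝ) < p x) N ∧
      ∀ x < N, (ω x : ℝ) < p x →
        σ'.narr 2 (Nat.count (fun x => (ω x : ℝ) < p x) x) = r x ∧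
        σ'.narr 3 (Nat.count (fun x => (ω x : ℝ) < p x) x) = c x ∧
        σ'.rarr 1 (Nat.count (fun x => (ω x : ℝ) < p x) x) = v x / p x := by
  have e1 := exec_block (ω := ω)
    [.nconst 4 1, .nconst 5 0, .rconst 4 0, .rconst 5 0, .rconst 6 0] σ
  obtain ⟨σ₁, hσ₁⟩ : ∃ σ₁, σ₁ = [Instr.nconst 4 1, .nconst 5 0, .rconst 4 0, .rconst 5 0,
    .rconst 6 0].foldl (Instr.step ω) σ := ⟨_, rfl⟩
  rw [← hσ₁] at e1
  obtain ⟨σ₂, t₂, e2, ht₂, i2, s2, R2, C2, pos2, a2, b2⟩ :=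
    accumulateL1_loop (ω := ω) (m := m) (N := N) (r := r) (c := c) (v := v) (ε := ε) (L := L)
      (σ := σ₁) (by
        rw [hσ₁]
        simp only [List.foldl_cons, List.foldl_nil, Instr.step, State.setN, State.setR]
        refine ⟨?_, ?_, ?_, hr, hc, hv, ?_, ?_⟩ <;> simp [hm, hN, hε, hL])
      (by rw [hσ₁]; simp [Instr.step, State.setN, State.setR])
      (by rw [hσ₁]; simp [Instr.step, State.setN, State.setR])
      (by rw [hσ₁]; exact h2) (by rw [hσ₁]; exact h3) (by rw [hσ₁]; exact hpos)
      (by rw [hσ₁]; simp [Instr.step, State.setN, State.setR])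
      (by rw [hσ₁]; simp [Instr.step, State.setN, State.setR])
  have i2' : HasInput m N r c v ε L (σ₂.setN 5 0) := by
    refine ⟨?_, ?_, ?_, i2.row, i2.col, i2.val, i2.eps, i2.est⟩ <;>
      simp [State.setN, i2.rows, i2.size, i2.one]
  obtain ⟨σ₃, t₃, e3, ht₃, i3, s3, R3, C3, pos3, a3, b3⟩ :=
    accumulateSq_loop (ω := ω) i2' (by simp [State.setN]) s2 R2 C2 pos2 a2 b2
  have e4 := exec_block (ω := ω) (computeRate K) σ₃
  obtain ⟨σ₄, hσ₄⟩ : ∃ σ₄, σ₄ = (computeRate K).foldl (Instr.step ω) σ₃ := ⟨_, rfl⟩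
  rw [← hσ₄] at e4
  have e5 := exec_block (ω := ω) [.nconst 5 0, .nconst 3 0] σ₄
  obtain ⟨σ₅, hσ₅⟩ : ∃ σ₅, σ₅ = [Instr.nconst 5 0, .nconst 3 0].foldl (Instr.step ω) σ₄ :=
    ⟨_, rfl⟩
  rw [← hσ₅] at e5
  have h5 : HasInput m N r c v ε L σ₅ ∧ σ₅.nreg 5 = 0 ∧ σ₅.nreg 3 = 0 ∧
      σ₅.rreg 4 = ∑ k ∈ range N, |v k| ∧ σ₅.rarr = σ₃.rarr ∧ σ₅.pos = σ₃.pos ∧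
      σ₅.rreg 5 = σ₃.rreg 5 ∧ σ₅.rreg 6 = σ₃.rreg 6 ∧
      σ₅.rreg 8 = listRate K m N r c v ε L := by
    rw [hσ₅, hσ₄]
    simp only [computeRate, List.foldl_cons, List.foldl_nil, Instr.step, State.setN, State.setR]
    refine ⟨⟨?_, ?_, ?_, ?_, ?_, ?_, ?_, ?_⟩, ?_, ?_, ?_, trivial, trivial, ?_, ?_, ?_⟩
    all_goals simp [i3.rows, i3.size, i3.one, i3.eps, i3.est, s3, a3, b3]
    · exact i3.row
    · exact i3.col
    · exact i3.val
    · rfl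
  obtain ⟨i5, n5, n3, s5, r5, pos5, a5, b5, rate5⟩ := h5
  obtain ⟨σ₆, t₆, e6, ht₆, hcount, hout⟩ := sampleStep_loop (ω := ω) i5 n5 s5
    (by rw [r5]; exact R3) (by rw [r5]; exact C3) (by rw [pos5, pos3]) (a5.trans a3) (b5.trans b3)
    rate5 n3 (p := p) (by rw [hp]; exact fun x => rfl)
  refine ⟨σ₆, _, .seq e1 (.seq e2 (.seq (.instr _ _) (.seq e3 (.seq e4 (.seq e5 e6))))), ?_,
    hcount, hout⟩
  simp only [computeRate, List.length_cons, List.length_nil]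
  omega

end Sampler

/-! ### The list of the non-zero entries -/

section EntryList

open Finset

variable {m n : ℕ} (A : Matrix (Fin m) (Fin n) ℝ) (e : Fin (nnz A) ≃ Supp A)

/-- The rows in the input list. -/
noncomputable def entryRow (k : ℕ) : ℕ := if h : k < nnz A then ((e ⟨k, h⟩).1.1 : ℕ) else 0

/-- The columns in the input list. -/
noncomputable def entryCol (k : ℕ) : ℕ := if h : k < nnz A then ((e ⟨k, h⟩).1.2 : ℕ) else 0

/-- The values in the input list. -/
noncomputable def entryVal (k : ℕ) : ℝ := if h : k < nnz A then A (e ⟨k, h⟩).1.1 (e ⟨k, h⟩).1.2 else 0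

theorem sum_range_nnz {G : ℕ → ℝ} {F : Fin m → Fin n → ℝ}
    (hG : ∀ k (h : k < nnz A), G k = F (e ⟨k, h⟩).1.1 (e ⟨k, h⟩).1.2)
    (hF : ∀ i j, A i j = 0 → F i j = 0) :
    ∑ k ∈ range (nnz A), G k = ∑ i, ∑ j, F i j := by
  classical
  rw [Finset.sum_range, Finset.sum_congr rfl fun k _ => hG k.1 k.2]
  simp only [Fin.eta]
  rw [e.sum_comp (fun q : Supp A => F q.1.1 q.1.2),
    ← Finset.sum_subtype (univ.filter fun q : Fin m × Fin n => A q.1 q.2 ≠ 0) (by simp)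
      (fun q => F q.1 q.2), Finset.sum_filter_of_ne, Fintype.sum_prod_type]
  exact fun q _ h h' => h (hF _ _ h')

theorem sum_abs_entryVal : ∑ k ∈ range (nnz A), |entryVal A e k| = sumAbs A :=
  sum_range_nnz A e (fun k h => by simp [entryVal, h]) fun i j h => by simp [h]

theorem lineSum_entryRow (i : Fin m) :
    lineSum (entryRow A e) (entryVal A e) (nnz A) i = vecL1 fun j => A i j := by
  rw [lineSum, sum_range_nnz A e (F := fun i' j => if i' = i then |A i' j| else 0)
    (fun k h => by simp [entryVal, entryRow, h, Fin.ext_iff]) fun i j h => by simp [h]]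
  rw [Finset.sum_eq_single i]
  · simp [vecL1]
  · intro i' _ h; simp [h]
  · simp

theorem lineSum_entryCol (j : Fin n) :
    lineSum (entryCol A e) (entryVal A e) (nnz A) j = vecL1 fun i => A i j := by
  rw [lineSum, sum_range_nnz A e (F := fun i j' => if j' = j then |A i j'| else 0)
    (fun k h => by simp [entryVal, entryCol, h, Fin.ext_iff]) fun i j h => by simp [h]]
  rw [Finset.sum_comm, Finset.sum_eq_single j]
  · simp [vecL1]
  · intro i' _ h; simp [h]
  · simp

theorem sum_lineSum_entryRow : ∑ k ∈ range (nnz A), |entryVal A e k| *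
    lineSum (entryRow A e) (entryVal A e) (nnz A) (entryRow A e k) = rowSq A := by
  rw [sum_range_nnz A e (F := fun i j => |A i j| * vecL1 fun j => A i j) (fun k h => by
    rw [entryVal, entryRow, dif_pos h, dif_pos h, lineSum_entryRow]) fun i j h => by simp [h]]
  simp only [← Finset.sum_mul, rowSq, pow_two]
  rfl

theorem sum_lineSum_entryCol : ∑ k ∈ range (nnz A), |entryVal A e k| *
    lineSum (entryCol A e) (entryVal A e) (nnz A) (entryCol A e k) = colSq A := by
  rw [sum_range_nnz A e (F := fun i j => |A i j| * vecL1 fun i => A i j) (fun k h => by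
    rw [entryVal, entryCol, dif_pos h, dif_pos h, lineSum_entryCol]) fun i j h => by simp [h]]
  rw [Finset.sum_comm]
  simp only [← Finset.sum_mul, colSq, pow_two]
  rfl

theorem listRate_entry (K ε L : ℝ) :
    listRate K m (nnz A) (entryRow A e) (entryCol A e) (entryVal A e) ε L =
      sampleRate K A ε L := by
  rw [listRate, sum_abs_entryVal, sum_lineSum_entryRow, sum_lineSum_entryCol, sampleRate]

theorem listProb_entry (s : ℝ) (k : ℕ) (h : k < nnz A) :
    listProb (nnz A) (entryRow A e) (entryCol A e) (entryVal A e) s k =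
      keepProb A s (e ⟨k, h⟩).1.1 (e ⟨k, h⟩).1.2 := by
  have hne := (e ⟨k, h⟩).2
  rw [listProb, sum_abs_entryVal, sum_lineSum_entryRow, sum_lineSum_entryCol, entryVal, entryRow,
    entryCol, dif_pos h, dif_pos h, dif_pos h, lineSum_entryRow, lineSum_entryCol, keepProb]
  generalize (e ⟨k, h⟩).1.1 = i at *
  generalize (e ⟨k, h⟩).1.2 = j at *
  have h1 : 0 < vecL1 fun j => A i j := (abs_pos.2 hne).trans_le (abs_le_vecL1 (fun j => A i j) j)
  have h2 : 0 < vecL1 fun i => A i j := (abs_pos.2 hne).trans_le (abs_le_vecL1 (fun i => A i j) i)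
  have e2 : prob2 A i j = |A i j| * vecL1 (fun j => A i j) / rowSq A := by
    have : prob2 A i j = vecL1 (fun j => A i j) ^ 2 / rowSq A *
      (|A i j| / vecL1 (fun j => A i j)) := rfl
    rw [this]
    field_simp
  have e3 : prob3 A i j = |A i j| * vecL1 (fun i => A i j) / colSq A := by
    have : prob3 A i j = vecL1 (fun i => A i j) ^ 2 / colSq A *
      (|A i j| / vecL1 (fun i => A i j)) := rfl
    rw [this]
    field_simp
  rw [e2, e3]
  rfl

open Classical in
/-- The position of the random number that decides about an entry.  For a non-zero entry it is the
index in the input list; the zero entries get distinct positions behind it, which are never read. -/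
noncomputable def samplePos (q : Fin m × Fin n) : ℕ :=
  if h : A q.1 q.2 ≠ 0 then (e.symm ⟨q, h⟩ : ℕ) else nnz A + finProdFinEquiv q

theorem samplePos_injective : Function.Injective (samplePos A e) := by
  intro q q' h
  simp only [samplePos] at h
  split_ifs at h with h1 h2 h2
  · have := e.symm.injective (Fin.ext h)
    exact congrArg Subtype.val this
  · have := (e.symm ⟨q, h1⟩).2; omega
  · have := (e.symm ⟨q', h2⟩).2; omega
  · exact finProdFinEquiv.injective (Fin.ext (by omega))

theorem samplePos_entry (k : Fin (nnz A)) : samplePos A e (e k).1 = k := by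
  rw [samplePos, dif_pos (e k).2]
  simp

open Classical in
/-- The result of the sampling loop is a list of the non-zero entries of the sampled matrix. -/
theorem outputs_sampleMat {p : Fin m → Fin n → ℝ} {p' : ℕ → ℝ}
    (hp : ∀ k (h : k < nnz A), p' k = p (e ⟨k, h⟩).1.1 (e ⟨k, h⟩).1.2) {ω : ℕ → unitInterval}
    {σ : State} (hcount : σ.nreg 3 = Nat.count (fun x => (ω x : ℝ) < p' x) (nnz A))
    (hout : ∀ x < nnz A, (ω x : ℝ) < p' x →
        σ.narr 2 (Nat.count (fun x => (ω x : ℝ) < p' x) x) = entryRow A e x ∧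
        σ.narr 3 (Nat.count (fun x => (ω x : ℝ) < p' x) x) = entryCol A e x ∧
        σ.rarr 1 (Nat.count (fun x => (ω x : ℝ) < p' x) x) = entryVal A e x / p' x) :
    Outputs σ (sampleMat A p (samplePos A e) ω) := by
  set P : ℕ → Prop := fun x => (ω x : ℝ) < p' x with hP
  set B := sampleMat A p (samplePos A e) ω with hB
  have hsupp : ∀ q : Supp A, B q.1.1 q.1.2 ≠ 0 ↔ P (e.symm q) := by
    intro q
    obtain ⟨k, rfl⟩ := e.surjective q
    have hval : B (e k).1.1 (e k).1.2 =
        if P k then A (e k).1.1 (e k).1.2 / p (e k).1.1 (e k).1.2 else 0 := by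
      simp only [hB, sampleMat, Matrix.of_apply, Prod.mk.eta, samplePos_entry, hP, hp k.1 k.2,
        Fin.eta]
    rw [hval, Equiv.symm_apply_apply]
    constructor
    · intro h
      by_contra hPk
      exact h (if_neg hPk)
    · intro hPk
      rw [if_pos hPk]
      refine div_ne_zero (e k).2 (ne_of_gt ?_)
      rw [← hp k.1 k.2]
      exact (ω k).2.1.trans_lt hPk
  have hA0 : ∀ q : Supp B, A q.1.1 q.1.2 ≠ 0 := by
    intro q h
    exact q.2 (by simp [hB, sampleMat, h])
  set f : Supp B → ℕ := fun q => e.symm ⟨q.1, hA0 q⟩ with hf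
  have hfP : ∀ q, P (f q) := fun q => (hsupp ⟨q.1, hA0 q⟩).1 q.2
  have hflt : ∀ q, f q < nnz A := fun q => (e.symm ⟨q.1, hA0 q⟩).2
  have hfinj : Function.Injective f := by
    intro q q' h
    have := e.symm.injective (Fin.ext h)
    exact Subtype.ext (congrArg (fun x : Supp A => x.1) this)
  have hcard : nnz B = Nat.count P (nnz A) := by
    rw [Nat.count_eq_card_filter_range, nnz, Nat.card_eq_fintype_card, ← Finset.card_univ]
    refine Finset.card_bij (fun q _ => f q) (fun q _ => by simp [hflt q, hfP q])
      (fun q _ q' _ h => hfinj h) fun k hk => ?_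
    rw [Finset.mem_filter, Finset.mem_range] at hk
    refine ⟨⟨(e ⟨k, hk.1⟩).1, (hsupp _).2 (by simpa using hk.2)⟩, Finset.mem_univ _, ?_⟩
    simp [hf]
  have hglt : ∀ q, Nat.count P (f q) < nnz B := fun q => by
    rw [hcard]; exact Nat.count_strict_mono (hfP q) (hflt q)
  set g : Supp B → Fin (nnz B) := fun q => ⟨Nat.count P (f q), hglt q⟩ with hg
  have hginj : Function.Injective g := fun q q' h =>
    hfinj (Nat.count_injective (hfP q) (hfP q') (Fin.ext_iff.1 h))
  have hgbij : Function.Bijective g := by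
    rw [Fintype.bijective_iff_injective_and_card]
    exact ⟨hginj, by rw [Fintype.card_fin, nnz, Nat.card_eq_fintype_card]⟩
  refine ⟨hcount.trans hcard.symm, (Equiv.ofBijective g hgbij).symm, fun k => ?_⟩
  obtain ⟨q, rfl⟩ := hgbij.2 k
  rw [Equiv.ofBijective_symm_apply_apply]
  have hq : e ⟨f q, hflt q⟩ = ⟨q.1, hA0 q⟩ := by simp [hf]
  have h1 := hout (f q) (hflt q) (hfP q)
  rw [entryRow, entryCol, entryVal, dif_pos (hflt q), dif_pos (hflt q), dif_pos (hflt q),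
    hp _ (hflt q), hq] at h1
  refine ⟨h1.1, h1.2.1, h1.2.2.trans ?_⟩
  have h2 := hfP q
  have hpos : samplePos A e q.1 = f q := by rw [samplePos, dif_pos (hA0 q)]
  rw [hP] at h2
  simp only [hp _ (hflt q), hq] at h2
  simp only [hB, sampleMat, Matrix.of_apply, Prod.mk.eta, hpos]
  rw [if_pos h2]

/-- The sampling program is correct for every memory that agrees with the input on what it
reads. -/
theorem exec_sampler_outputs (K : ℚ) {ω : ℕ → unitInterval} {ε L : ℝ} {σ : State}
    (hm : σ.nreg 0 = m) (hN : σ.nreg 2 = nnz A)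
    (hr : ∀ k < nnz A, σ.narr 0 k = entryRow A e k) (hc : ∀ k < nnz A, σ.narr 1 k = entryCol A e k)
    (hv : ∀ k < nnz A, σ.rarr 0 k = entryVal A e k) (hε : σ.rreg 0 = ε) (hL : σ.rreg 1 = L)
    (h2 : ∀ i, σ.rarr 2 i = 0) (h3 : ∀ i, σ.rarr 3 i = 0) (hpos : σ.pos = 0) :
    ∃ σ' t, Exec ω (sampler K) σ σ' t ∧ t ≤ 100 * (nnz A + 1) ∧
      Outputs σ' (sampleMat A (keepProb A (sampleRate K A ε L)) (samplePos A e) ω) := by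
  obtain ⟨σ', t, he, ht, hcount, hout⟩ := exec_sampler (ω := ω) K hm hN hr hc hv hε hL h2 h3 hpos
    rfl
  refine ⟨σ', t, he, ht, outputs_sampleMat A e (fun k h => ?_) hcount hout⟩
  rw [listRate_entry, listProb_entry]

end EntryList

/-! ### Estimating the spectral norm -/

section Gram

open Matrix Finset
open scoped Matrix.Norms.L2Operator

variable {m d : ℕ}

theorem specNorm_transpose (M : Matrix (Fin m) (Fin d) ℝ) : specNorm Mᵀ = specNorm M := by
  have := l2_opNorm_conjTranspose M
  rwa [conjTranspose_eq_transpose_of_trivial] at this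

theorem specNorm_mul_transpose (M : Matrix (Fin m) (Fin d) ℝ) :
    specNorm (M * Mᵀ) = specNorm M ^ 2 := by
  have := l2_opNorm_conjTranspose_mul_self Mᵀ
  rw [conjTranspose_eq_transpose_of_trivial, transpose_transpose] at this
  rw [pow_two, ← specNorm_transpose M]
  exact this

theorem specNorm_le_frobNorm (M : Matrix (Fin m) (Fin d) ℝ) : specNorm M ≤ frobNorm M := by
  refine specNorm_le_of_mulVec (frobNorm_nonneg M) fun w => ?_
  rw [frobNorm_sq, dotProduct, Finset.sum_mul]
  refine Finset.sum_le_sum fun i _ => ?_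
  have := Finset.sum_mul_sq_le_sq_mul_sq Finset.univ (fun j => M i j) w
  simpa [mulVec, dotProduct, pow_two] using this

theorem frobNorm_sq_le (M : Matrix (Fin m) (Fin d) ℝ) :
    frobNorm M ^ 2 ≤ m * specNorm M ^ 2 := by
  have h : ∀ i, ∑ j, M i j ^ 2 ≤ specNorm M ^ 2 := by
    intro i
    have h1 := l2_opNorm_mulVec Mᵀ (EuclideanSpace.single i (1 : ℝ))
    have h2 : ‖Mᵀ‖ = specNorm M := specNorm_transpose M
    rw [h2, PiLp.norm_single, norm_one, mul_one] at h1
    have h3 := pow_le_pow_left₀ (norm_nonneg _) h1 2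
    rw [EuclideanSpace.real_norm_sq_eq] at h3
    simpa using h3
  rw [frobNorm_sq]
  refine (Finset.sum_le_sum fun i _ => h i).trans (le_of_eq ?_)
  simp

theorem trace_mul_transpose (M : Matrix (Fin m) (Fin d) ℝ) :
    trace (M * Mᵀ) = frobNorm M ^ 2 := by
  rw [frobNorm_sq, trace]
  exact Finset.sum_congr rfl fun i _ => by simp [mul_apply, pow_two]

end Gram

section Lists

open Finset

/-- The sum of the entries `x ∈ [lo, hi)` of a list of triples `(r x, c x, v x)` with weights that
depend on their positions. -/
noncomputable def weightedSum (r c : ℕ → ℕ) (v : ℕ → ℝ) (lo hi : ℕ) (W : ℕ → ℕ → ℝ) : ℝ :=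
  ∑ x ∈ Ico lo hi, W (r x) (c x) * v x

/-- The triples `(r x, c x, v x)`, `x ∈ [lo, hi)`, add up to the matrix `M`: as functionals on
weights they agree.  A position may occur in several triples. -/
def Represents {m d : ℕ} (r c : ℕ → ℕ) (v : ℕ → ℝ) (lo hi : ℕ) (M : Matrix (Fin m) (Fin d) ℝ) :
    Prop :=
  ∀ W, weightedSum r c v lo hi W = ∑ i : Fin m, ∑ j : Fin d, W i j * M i j

theorem weightedSum_congr {r r' c c' : ℕ → ℕ} {v v' : ℕ → ℝ} {lo hi : ℕ}
    (hr : ∀ x < hi, r' x = r x) (hc : ∀ x < hi, c' x = c x) (hv : ∀ x < hi, v' x = v x)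
    (W : ℕ → ℕ → ℝ) : weightedSum r' c' v' lo hi W = weightedSum r c v lo hi W := by
  refine Finset.sum_congr rfl fun x hx => ?_
  have := (Finset.mem_Ico.1 hx).2
  rw [hr x this, hc x this, hv x this]

theorem weightedSum_update (r c : ℕ → ℕ) (v : ℕ → ℝ) {lo p : ℕ} (hp : lo ≤ p) (a b : ℕ) (y : ℝ)
    (W : ℕ → ℕ → ℝ) :
    weightedSum (Function.update r p a) (Function.update c p b) (Function.update v p y) lo (p + 1) W
      = weightedSum r c v lo p W + W a b * y := by
  have := weightedSum_congr (lo := lo) (hi := p) (r := r) (r' := Function.update r p a) (c := c)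
    (c' := Function.update c p b) (v := v) (v' := Function.update v p y)
    (fun x hx => Function.update_of_ne hx.ne _ _) (fun x hx => Function.update_of_ne hx.ne _ _)
    (fun x hx => Function.update_of_ne hx.ne _ _) W
  rw [← this, weightedSum, Finset.sum_Ico_succ_top hp, Function.update_self, Function.update_self,
    Function.update_self]
  rfl

/-- The weighted contribution of the pair of triples `k`, `l` to the product of a list with its
transpose. -/
noncomputable def pairTerm (r c : ℕ → ℕ) (v : ℕ → ℝ) (W : ℕ → ℕ → ℝ) (k l : ℕ) : ℝ :=
  W (r k) (r l) * (v k * v l * if c k = c l then 1 else 0)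

theorem Represents.sum_pairTerm {m d : ℕ} {r c : ℕ → ℕ} {v : ℕ → ℝ} {lo hi : ℕ}
    {M : Matrix (Fin m) (Fin d) ℝ} (h : Represents r c v lo hi M) (W : ℕ → ℕ → ℝ) :
    ∑ k ∈ Ico lo hi, ∑ l ∈ Ico lo hi, pairTerm r c v W k l =
      ∑ i : Fin m, ∑ i' : Fin m, W i i' * (M * M.transpose) i i' := by
  have h1 : ∀ a b : ℕ, ∑ l ∈ Ico lo hi, W a (r l) * (if b = c l then 1 else 0) * v l =
      ∑ i' : Fin m, ∑ j' : Fin d, W a i' * (if b = (j' : ℕ) then 1 else 0) * M i' j' := fun a b =>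
    h (fun a' b' => W a a' * if b = b' then 1 else 0)
  have h2 := h (fun a b => ∑ i' : Fin m, ∑ j' : Fin d,
    W a i' * (if b = (j' : ℕ) then 1 else 0) * M i' j')
  calc _ = ∑ k ∈ Ico lo hi, (∑ l ∈ Ico lo hi, W (r k) (r l) * (if c k = c l then 1 else 0) * v l) *
        v k := by
        refine Finset.sum_congr rfl fun k _ => ?_
        rw [Finset.sum_mul]
        exact Finset.sum_congr rfl fun l _ => by rw [pairTerm]; ring
    _ = _ := by
        simp only [h1]
        refine h2.trans (Finset.sum_congr rfl fun i _ => ?_)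
        simp only [Finset.sum_mul, Matrix.mul_apply, Matrix.transpose_apply, Finset.mul_sum]
        rw [Finset.sum_comm]
        refine Finset.sum_congr rfl fun i' _ => Finset.sum_congr rfl fun j _ => ?_
        rw [Finset.sum_eq_single j]
        · simp; ring
        · intro j' _ hj
          have : (j : ℕ) ≠ j' := fun h => hj (Fin.ext h.symm)
          simp [this]
        · simp

end Lists

section Estimate

open Finset

variable {ω : ℕ → unitInterval}

/-- Appends to the list in natural arrays `0`, `1` and real array `0` the product of the triples
whose indices are in registers `16` and `17`, with value `0` if their columns differ, and adds it
to real register `1` if it is on the diagonal.  Equality of natural numbers is tested by truncated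
subtraction. -/
def pushPair : List Instr :=
  [.nload 6 0 16, .nload 7 0 17, .nload 8 1 16, .nload 9 1 17, .rload 2 0 16, .rload 3 0 17,
    .rmul 2 2 3, .nsub 10 8 9, .nsub 11 9 8, .nadd 10 10 11, .nsub 10 4 10, .rcast 3 10,
    .rmul 2 2 3, .nstore 0 14 6, .nstore 1 14 7, .rstore 0 14 2, .nsub 10 6 7, .nsub 11 7 6,
    .nadd 10 10 11, .nsub 10 4 10, .rcast 3 10, .rmul 2 3 2, .radd 1 1 2, .nadd 14 14 4,
    .nadd 17 17 4]

/-- Appends the product `M * Mᵀ` of the current list `M`, which then becomes the current list; its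
bounds are in natural registers `12` and `13`.  Real register `1` receives the trace. -/
def squareStep : Prog :=
  .seq (block [.rconst 1 0, .nadd 14 13 18, .nadd 16 12 18])
  (.seq (.loop (.nlt 16 13)
    (.seq (.instr (.nadd 17 12 18))
    (.seq (.loop (.nlt 17 13) (block pushPair)) (.instr (.nadd 16 16 4)))))
  (block [.nadd 12 13 18, .nadd 13 14 18]))

/-- Real register `1` receives an estimate of the spectral norm: `m + 1` squarings, the last of
which leaves a trace, followed by `m + 1` square roots. -/
def normEstimate : Prog :=
  .seq (block [.nconst 4 1, .nconst 18 0, .nadd 13 2 18, .nconst 12 0, .nconst 15 0])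
  (.seq (.loop (.nlt 15 0) (.seq squareStep (.instr (.nadd 15 15 4))))
  (.seq squareStep
  (.seq (block [.nconst 15 0, .rsqrt 1 1])
  (.loop (.nlt 15 0) (block [.rsqrt 1 1, .nadd 15 15 4])))))

/-- What the sampling program reads, apart from the estimate, and the constants `1` and `0`. -/
structure EstFrame (m N : ℕ) (r c : ℕ → ℕ) (v : ℕ → ℝ) (ε : ℝ) (σ : State) : Prop where
  rows : σ.nreg 0 = m
  size : σ.nreg 2 = N
  one : σ.nreg 4 = 1
  zero : σ.nreg 18 = 0
  row : ∀ k < N, σ.narr 0 k = r k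
  col : ∀ k < N, σ.narr 1 k = c k
  val : ∀ k < N, σ.rarr 0 k = v k
  eps : σ.rreg 0 = ε
  arr2 : ∀ i, σ.rarr 2 i = 0
  arr3 : ∀ i, σ.rarr 3 i = 0
  pos : σ.pos = 0

theorem cast_truncated_eq (a b : ℕ) :
    ((1 - (a - b + (b - a)) : ℕ) : ℝ) = if a = b then 1 else 0 := by
  split_ifs with h
  · simp [h]
  · have : 1 - (a - b + (b - a)) = 0 := by omega
    rw [this, Nat.cast_zero]

variable {m N : ℕ} {r c : ℕ → ℕ} {v : ℕ → ℝ} {ε : ℝ}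

/-- The weights that extract the trace. -/
noncomputable def traceWeight (a b : ℕ) : ℝ := if a = b then 1 else 0

/-- The invariant of the two loops of `squareStep`: the pairs that have been processed are
described by the functional `Φ` on weights. -/
structure SquareInv (m N : ℕ) (r c : ℕ → ℕ) (v : ℕ → ℝ) (ε : ℝ) (r' c' : ℕ → ℕ) (v' : ℕ → ℝ)
    (lo hi y : ℕ) (Φ : (ℕ → ℕ → ℝ) → ℝ) (σ : State) : Prop where
  frame : EstFrame m N r c v ε σ
  lo_eq : σ.nreg 12 = lo
  hi_eq : σ.nreg 13 = hi
  outer : σ.nreg 15 = y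
  le_ptr : hi ≤ σ.nreg 14
  row' : ∀ x < hi, σ.narr 0 x = r' x
  col' : ∀ x < hi, σ.narr 1 x = c' x
  val' : ∀ x < hi, σ.rarr 0 x = v' x
  sum : ∀ W, weightedSum (σ.narr 0) (σ.narr 1) (σ.rarr 0) hi (σ.nreg 14) W = Φ W
  trace : σ.rreg 1 = Φ traceWeight

theorem squareInv_pushPair {r' c' : ℕ → ℕ} {v' : ℕ → ℝ} {lo hi y k l : ℕ}
    {Φ : (ℕ → ℕ → ℝ) → ℝ} {σ : State} (hN : N ≤ hi) (hk : k < hi) (hl : l < hi)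
    (h : SquareInv m N r c v ε r' c' v' lo hi y Φ σ) (h16 : σ.nreg 16 = k) (h17 : σ.nreg 17 = l) :
    SquareInv m N r c v ε r' c' v' lo hi y (fun W => Φ W + pairTerm r' c' v' W k l)
      (pushPair.foldl (Instr.step ω) σ) ∧
    (pushPair.foldl (Instr.step ω) σ).nreg 16 = k ∧
    (pushPair.foldl (Instr.step ω) σ).nreg 17 = l + 1 := by
  have hf := h.frame
  have hp := h.le_ptr
  have n1 : ∀ x, x < N → x ≠ σ.nreg 14 := fun x hx => by omega
  have n2 : ∀ x, x < hi → x ≠ σ.nreg 14 := fun x hx => by omega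
  have rk := h.row' k hk
  have rl := h.row' l hl
  have ck := h.col' k hk
  have cl := h.col' l hl
  have vk := h.val' k hk
  have vl := h.val' l hl
  simp only [pushPair, List.foldl_cons, List.foldl_nil, Instr.step, State.setN, State.setR]
  refine ⟨⟨⟨?_, ?_, ?_, ?_, ?_, ?_, ?_, ?_, ?_, ?_, ?_⟩, ?_, ?_, ?_, ?_, ?_, ?_, ?_, ?_, ?_⟩, ?_, ?_⟩
  all_goals simp [hf.rows, hf.size, hf.one, hf.zero, hf.eps, hf.arr2, hf.arr3, hf.pos, h.lo_eq,
    h.hi_eq, h.outer, h16, h17, rk, rl, ck, cl, vk, vl, h.trace, -Nat.cast_sub]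
  · exact fun x hx => (Function.update_of_ne (n1 x hx) _ _).trans (hf.row x hx)
  · exact fun x hx => (Function.update_of_ne (n1 x hx) _ _).trans (hf.col x hx)
  · exact fun x hx => (Function.update_of_ne (n1 x hx) _ _).trans (hf.val x hx)
  · omega
  · exact fun x hx => (Function.update_of_ne (n2 x hx) _ _).trans (h.row' x hx)
  · exact fun x hx => (Function.update_of_ne (n2 x hx) _ _).trans (h.col' x hx)
  · exact fun x hx => (Function.update_of_ne (n2 x hx) _ _).trans (h.val' x hx)
  · intro W
    rw [weightedSum_update _ _ _ hp, h.sum, cast_truncated_eq, pairTerm]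
  · rw [cast_truncated_eq, cast_truncated_eq, pairTerm, traceWeight]

theorem EstFrame.setN {σ : State} (h : EstFrame m N r c v ε σ) {d : ℕ} (h0 : d ≠ 0) (h2 : d ≠ 2)
    (h4 : d ≠ 4) (h18 : d ≠ 18) (x : ℕ) : EstFrame m N r c v ε (σ.setN d x) := by
  refine ⟨?_, ?_, ?_, ?_, h.row, h.col, h.val, h.eps, h.arr2, h.arr3, h.pos⟩
  · simp [State.setN, Function.update_of_ne h0.symm, h.rows]
  · simp [State.setN, Function.update_of_ne h2.symm, h.size]
  · simp [State.setN, Function.update_of_ne h4.symm, h.one]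
  · simp [State.setN, Function.update_of_ne h18.symm, h.zero]

theorem EstFrame.setR {σ : State} (h : EstFrame m N r c v ε σ) {d : ℕ} (h0 : d ≠ 0) (x : ℝ) :
    EstFrame m N r c v ε (σ.setR d x) := by
  refine ⟨h.rows, h.size, h.one, h.zero, h.row, h.col, h.val, ?_, h.arr2, h.arr3, h.pos⟩
  simp [State.setR, Function.update_of_ne h0.symm, h.eps]

theorem SquareInv.setN {r' c' : ℕ → ℕ} {v' : ℕ → ℝ} {lo hi y : ℕ} {Φ : (ℕ → ℕ → ℝ) → ℝ}
    {σ : State} (h : SquareInv m N r c v ε r' c' v' lo hi y Φ σ) {d : ℕ} (hd : d = 16 ∨ d = 17)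
    (x : ℕ) : SquareInv m N r c v ε r' c' v' lo hi y Φ (σ.setN d x) := by
  have e : ∀ z, z < 16 → (σ.setN d x).nreg z = σ.nreg z := fun z hz =>
    Function.update_of_ne (by omega) _ _
  refine ⟨h.frame.setN (by omega) (by omega) (by omega) (by omega) x, ?_, ?_, ?_, ?_, h.row', h.col',
    h.val', ?_, h.trace⟩
  · rw [e 12 (by norm_num), h.lo_eq]
  · rw [e 13 (by norm_num), h.hi_eq]
  · rw [e 15 (by norm_num), h.outer]
  · rw [e 14 (by norm_num)]; exact h.le_ptr
  · rw [e 14 (by norm_num)]; exact h.sum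

theorem exec_squareLoops {r' c' : ℕ → ℕ} {v' : ℕ → ℝ} {lo hi y : ℕ} (hN : N ≤ hi) (hlo : lo ≤ hi)
    {σ : State} (h : SquareInv m N r c v ε r' c' v' lo hi y (fun _ => 0) σ)
    (h16 : σ.nreg 16 = lo) :
    ∃ σ' t, Exec ω (.loop (.nlt 16 13) (.seq (.instr (.nadd 17 12 18))
      (.seq (.loop (.nlt 17 13) (block pushPair)) (.instr (.nadd 16 16 4))))) σ σ' t ∧
      SquareInv m N r c v ε r' c' v' lo hi y
        (fun W => ∑ k ∈ Ico lo hi, ∑ l ∈ Ico lo hi, pairTerm r' c' v' W k l) σ' := by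
  obtain ⟨σ', t, he, hi'⟩ := exec_loop_untimed (ω := ω) (i := 16) (r := 13) (N := hi)
    (body := .seq (.instr (.nadd 17 12 18))
      (.seq (.loop (.nlt 17 13) (block pushPair)) (.instr (.nadd 16 16 4))))
    (fun k σ => lo ≤ k ∧ σ.nreg 16 = k ∧ SquareInv m N r c v ε r' c' v' lo hi y
      (fun W => ∑ k' ∈ Ico lo k, ∑ l ∈ Ico lo hi, pairTerm r' c' v' W k' l) σ)
    (fun k σ h => ⟨h.2.1, h.2.2.hi_eq⟩)
    (fun k σ hk h => by
      obtain ⟨hlk, h16, h⟩ := h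
      have e17 : (σ.setN 17 lo).nreg 17 = lo := by simp [State.setN]
      have e16 : (σ.setN 17 lo).nreg 16 = k := by simp [State.setN, h16]
      obtain ⟨σ₁, t₁, he₁, -, h16₁, -, h₁⟩ := exec_loop_untimed (ω := ω) (i := 17) (r := 13)
        (N := hi) (body := block pushPair)
        (fun l σ => lo ≤ l ∧ σ.nreg 16 = k ∧ σ.nreg 17 = l ∧ SquareInv m N r c v ε r' c' v' lo hi y
          (fun W => ∑ k' ∈ Ico lo k, ∑ l ∈ Ico lo hi, pairTerm r' c' v' W k' l +
            ∑ l' ∈ Ico lo l, pairTerm r' c' v' W k l') σ)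
        (fun l σ h => ⟨h.2.2.1, h.2.2.2.hi_eq⟩)
        (fun l σ hl h => by
          obtain ⟨hll, h16, h17, h⟩ := h
          obtain ⟨h1, h2, h3⟩ := squareInv_pushPair (ω := ω) hN hk hl h h16 h17
          refine ⟨_, _, exec_block _ _, hll.trans (Nat.le_succ l), h2, h3, ?_⟩
          simpa only [Finset.sum_Ico_succ_top hll, add_assoc] using h1)
        hlo (σ := σ.setN 17 lo)
        ⟨le_refl _, e16, e17, by simpa using h.setN (Or.inr rfl) lo⟩
      have hinit : Exec ω (.instr (.nadd 17 12 18)) σ (σ.setN 17 lo) 1 := by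
        have := Exec.instr (ω := ω) (.nadd 17 12 18) σ
        simpa only [Instr.step, h.lo_eq, h.frame.zero, add_zero] using this
      have hend : Exec ω (.instr (.nadd 16 16 4)) σ₁ (σ₁.setN 16 (k + 1)) 1 := by
        have := Exec.instr (ω := ω) (.nadd 16 16 4) σ₁
        simpa only [Instr.step, h16₁, h₁.frame.one] using this
      refine ⟨_, _, .seq hinit (.seq he₁ hend), hlk.trans (Nat.le_succ k),
        by simp [State.setN], ?_⟩
      simpa only [Finset.sum_Ico_succ_top hlk] using h₁.setN (Or.inl rfl) (k + 1))
    hlo (σ := σ) ⟨le_refl _, h16, by simpa using h⟩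
  exact ⟨σ', t, he, hi'.2.2⟩

/-- The current list, whose bounds are in natural registers `12` and `13`, represents `M`. -/
def HoldsList {m d : ℕ} (N : ℕ) (σ : State) (M : Matrix (Fin m) (Fin d) ℝ) : Prop :=
  N ≤ σ.nreg 13 ∧ σ.nreg 12 ≤ σ.nreg 13 ∧
    Represents (σ.narr 0) (σ.narr 1) (σ.rarr 0) (σ.nreg 12) (σ.nreg 13) M

theorem exec_squareStep {d : ℕ} {M : Matrix (Fin m) (Fin d) ℝ} {σ : State}
    (hf : EstFrame m N r c v ε σ) (hM : HoldsList N σ M) :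
    ∃ σ' t, Exec ω squareStep σ σ' t ∧ EstFrame m N r c v ε σ' ∧
      HoldsList N σ' (M * M.transpose) ∧ σ'.rreg 1 = frobNorm M ^ 2 ∧
      σ'.nreg 15 = σ.nreg 15 := by
  obtain ⟨hN, hlo, hrep⟩ := hM
  set lo := σ.nreg 12 with hlo_def
  set hi := σ.nreg 13 with hhi_def
  have e1 := exec_block (ω := ω) [.rconst 1 0, .nadd 14 13 18, .nadd 16 12 18] σ
  have s1 : [Instr.rconst 1 0, .nadd 14 13 18, .nadd 16 12 18].foldl (Instr.step ω) σ =
      ((σ.setR 1 0).setN 14 hi).setN 16 lo := by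
    simp [Instr.step, State.setR, State.setN, hf.zero, ← hlo_def, ← hhi_def]
  rw [s1] at e1
  have inv : SquareInv m N r c v ε (σ.narr 0) (σ.narr 1) (σ.rarr 0) lo hi (σ.nreg 15)
      (fun _ => 0) (((σ.setR 1 0).setN 14 hi).setN 16 lo) := by
    refine ⟨((hf.setR (by norm_num) 0).setN (by norm_num) (by norm_num) (by norm_num)
      (by norm_num) hi).setN (by norm_num) (by norm_num) (by norm_num) (by norm_num) lo,
      ?_, ?_, ?_, ?_, fun x _ => rfl, fun x _ => rfl, fun x _ => rfl, fun W => ?_, ?_⟩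
    all_goals simp [State.setR, State.setN, hlo_def, hhi_def, weightedSum]
  obtain ⟨σ₂, t₂, e2, h2⟩ := exec_squareLoops (ω := ω) hN hlo inv (by simp [State.setN])
  have e3 := exec_block (ω := ω) [.nadd 12 13 18, .nadd 13 14 18] σ₂
  have s3 : [Instr.nadd 12 13 18, .nadd 13 14 18].foldl (Instr.step ω) σ₂ =
      (σ₂.setN 12 hi).setN 13 (σ₂.nreg 14) := by
    simp [Instr.step, State.setN, h2.frame.zero, h2.hi_eq]
  rw [s3] at e3
  refine ⟨_, _, .seq e1 (.seq e2 e3), ?_, ⟨?_, ?_, fun W => ?_⟩, ?_, ?_⟩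
  · exact ((h2.frame.setN (by norm_num) (by norm_num) (by norm_num) (by norm_num) _).setN
      (by norm_num) (by norm_num) (by norm_num) (by norm_num) _)
  · have := h2.le_ptr
    simp [State.setN]; omega
  · have := h2.le_ptr
    simp [State.setN]; omega
  · have := (h2.sum W).trans (hrep.sum_pairTerm W)
    simpa [State.setN] using this
  · have := h2.trace.trans (hrep.sum_pairTerm traceWeight)
    rw [← trace_mul_transpose]
    simpa [State.setN, traceWeight, Matrix.trace, ← Fin.ext_iff] using this
  · simp [State.setN, h2.outer]

theorem exec_sqrtLoop {T : ℝ} {σ : State} (hf : EstFrame m N r c v ε σ)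
    (h15 : σ.nreg 15 = 0) (h1 : σ.rreg 1 = Real.sqrt T) :
    ∃ σ' t, Exec ω (.loop (.nlt 15 0) (block [.rsqrt 1 1, .nadd 15 15 4])) σ σ' t ∧
      EstFrame m N r c v ε σ' ∧ σ'.rreg 1 = Real.sqrt^[m + 1] T := by
  obtain ⟨σ', t, he, -, h⟩ := exec_loop_untimed (ω := ω) (i := 15) (r := 0) (N := m)
    (body := block [.rsqrt 1 1, .nadd 15 15 4])
    (fun k σ => σ.nreg 15 = k ∧ EstFrame m N r c v ε σ ∧ σ.rreg 1 = Real.sqrt^[k + 1] T)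
    (fun k σ h => ⟨h.1, h.2.1.rows⟩)
    (fun k σ _ h => by
      obtain ⟨h15, hf, h1⟩ := h
      have e : [Instr.rsqrt 1 1, .nadd 15 15 4].foldl (Instr.step ω) σ =
          (σ.setR 1 (Real.sqrt (σ.rreg 1))).setN 15 (k + 1) := by
        simp [Instr.step, State.setN, State.setR, h15, hf.one]
      refine ⟨_, _, exec_block _ _, ?_⟩
      rw [e]
      refine ⟨by simp [State.setN], (hf.setR (by norm_num) _).setN (by norm_num) (by norm_num)
        (by norm_num) (by norm_num) _, ?_⟩
      rw [Function.iterate_succ_apply', ← h1]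
      simp [State.setN, State.setR])
    (Nat.zero_le m) (σ := σ) ⟨h15, hf, by rw [h1, zero_add, Function.iterate_one]⟩
  exact ⟨σ', t, he, h⟩

theorem iterate_sqrt_nonneg {T : ℝ} (hT : 0 ≤ T) (k : ℕ) : 0 ≤ Real.sqrt^[k] T := by
  cases k with
  | zero => simpa using hT
  | succ k => rw [Function.iterate_succ_apply']; exact Real.sqrt_nonneg _

theorem iterate_sqrt_pow {T : ℝ} (hT : 0 ≤ T) (k : ℕ) : (Real.sqrt^[k] T) ^ 2 ^ k = T := by
  induction k with
  | zero => simp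
  | succ k ih =>
    rw [Function.iterate_succ_apply', pow_succ' 2 k, pow_mul, Real.sq_sqrt (iterate_sqrt_nonneg hT k),
      ih]

/-- The matrices obtained from `A` by iterating `M ↦ M * Mᵀ`.  The number of columns changes from `n`
to `m` at the first step, so it is carried along. -/
def squareSeq {m n : ℕ} (A : Matrix (Fin m) (Fin n) ℝ) : ℕ → Σ d, Matrix (Fin m) (Fin d) ℝ
  | 0 => ⟨n, A⟩
  | y + 1 => ⟨m, (squareSeq A y).2 * (squareSeq A y).2.transpose⟩

theorem specNorm_squareSeq {n : ℕ} (A : Matrix (Fin m) (Fin n) ℝ) (y : ℕ) :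
    specNorm (squareSeq A y).2 = specNorm A ^ 2 ^ y := by
  induction y with
  | zero => simp [squareSeq]
  | succ y ih =>
    rw [pow_succ 2 y, pow_mul, ← ih]
    exact specNorm_mul_transpose _

/-- The `2 ^ (m + 1)`-th root of the squared Frobenius norm of `A` after `m` squarings. -/
noncomputable def normEst {m n : ℕ} (A : Matrix (Fin m) (Fin n) ℝ) : ℝ :=
  Real.sqrt^[m + 1] (frobNorm (squareSeq A m).2 ^ 2)

theorem specNorm_le_normEst {n : ℕ} (A : Matrix (Fin m) (Fin n) ℝ) : specNorm A ≤ normEst A := by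
  have hne : 2 ^ (m + 1) ≠ 0 := by positivity
  refine le_of_pow_le_pow_left₀ hne (iterate_sqrt_nonneg (sq_nonneg _) _) ?_
  rw [normEst, iterate_sqrt_pow (sq_nonneg _), pow_succ 2 m, pow_mul, ← specNorm_squareSeq]
  exact pow_le_pow_left₀ (specNorm_nonneg _) (specNorm_le_frobNorm _) 2

/-- The squared Frobenius norm exceeds the squared spectral norm by a factor of at most `m`, and the
`2 ^ (m + 1)`-th root brings this factor below `2`. -/
theorem normEst_le {n : ℕ} (A : Matrix (Fin m) (Fin n) ℝ) : normEst A ≤ 2 * specNorm A := by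
  have hA := specNorm_nonneg A
  have hne : 2 ^ (m + 1) ≠ 0 := by positivity
  refine le_of_pow_le_pow_left₀ hne (by positivity) ?_
  have hsq : specNorm A ^ 2 ^ (m + 1) = specNorm (squareSeq A m).2 ^ 2 := by
    rw [specNorm_squareSeq, ← pow_mul, pow_succ]
  rw [normEst, iterate_sqrt_pow (sq_nonneg _), mul_pow, hsq]
  refine (frobNorm_sq_le _).trans (mul_le_mul_of_nonneg_right ?_ (sq_nonneg _))
  have h1 : m ≤ 2 ^ 2 ^ (m + 1) :=
    (Nat.lt_succ_self m).le.trans (Nat.lt_two_pow_self.le.trans Nat.lt_two_pow_self.le)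
  exact_mod_cast h1

/-- The state that follows the norm estimate has the value `normEst A` in its real register `1`,
whatever the random source, and the registers and arrays that the sampler reads are untouched. -/
theorem exec_normEstimate {n : ℕ} (A : Matrix (Fin m) (Fin n) ℝ) (e : Fin (nnz A) ≃ Supp A)
    (ε : ℝ) :
    ∃ σ' t, Exec ω normEstimate (inputState A e ε 0) σ' t ∧
      EstFrame m (nnz A) (entryRow A e) (entryCol A e) (entryVal A e) ε σ' ∧
      σ'.rreg 1 = normEst A := by
  set σ := inputState A e ε 0 with hσ
  have e1 := exec_block (ω := ω)
    [.nconst 4 1, .nconst 18 0, .nadd 13 2 18, .nconst 12 0, .nconst 15 0] σ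
  obtain ⟨σ₁, hσ₁⟩ : ∃ σ₁, σ₁ = [Instr.nconst 4 1, .nconst 18 0, .nadd 13 2 18, .nconst 12 0,
    .nconst 15 0].foldl (Instr.step ω) σ := ⟨_, rfl⟩
  rw [← hσ₁] at e1
  have f1 : EstFrame m (nnz A) (entryRow A e) (entryCol A e) (entryVal A e) ε σ₁ := by
    rw [hσ₁]
    simp only [List.foldl_cons, List.foldl_nil, Instr.step, State.setN, hσ, inputState]
    refine ⟨?_, ?_, ?_, ?_, ?_, ?_, ?_, ?_, ?_, ?_, ?_⟩
    all_goals simp [entryRow, entryCol, entryVal]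
  have h15 : σ₁.nreg 15 = 0 := by rw [hσ₁]; simp [Instr.step, State.setN]
  have l1 : HoldsList (nnz A) σ₁ A := by
    have h12 : σ₁.nreg 12 = 0 := by rw [hσ₁]; simp [Instr.step, State.setN]
    have h13 : σ₁.nreg 13 = nnz A := by
      rw [hσ₁]; simp [Instr.step, State.setN, hσ, inputState]
    refine ⟨h13.ge, by rw [h12]; exact Nat.zero_le _, fun W => ?_⟩
    rw [h12, h13, weightedSum, ← Finset.range_eq_Ico]
    refine sum_range_nnz A e (F := fun i j => W i j * A i j) (fun k hk => ?_) fun i j h => by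
      simp [h]
    rw [f1.row k hk, f1.col k hk, f1.val k hk, entryRow, entryCol, entryVal, dif_pos hk, dif_pos hk,
      dif_pos hk]
  obtain ⟨σ₂, t₂, e2, -, f2, l2⟩ := exec_loop_untimed (ω := ω) (i := 15) (r := 0)
    (N := m) (body := .seq squareStep (.instr (.nadd 15 15 4)))
    (fun y σ => σ.nreg 15 = y ∧
      EstFrame m (nnz A) (entryRow A e) (entryCol A e) (entryVal A e) ε σ ∧
      HoldsList (nnz A) σ (squareSeq A y).2)
    (fun y σ h => ⟨h.1, h.2.1.rows⟩)
    (fun y σ _ h => by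
      obtain ⟨h15, hf, hl⟩ := h
      obtain ⟨σ', t, he, hf', hl', -, h15'⟩ := exec_squareStep (ω := ω) hf hl
      have hend : Exec ω (.instr (.nadd 15 15 4)) σ' (σ'.setN 15 (y + 1)) 1 := by
        have := Exec.instr (ω := ω) (.nadd 15 15 4) σ'
        simpa only [Instr.step, h15', h15, hf'.one] using this
      refine ⟨_, _, .seq he hend, by simp [State.setN], hf'.setN (by norm_num) (by norm_num)
        (by norm_num) (by norm_num) _, ?_⟩
      simpa [HoldsList, State.setN, squareSeq] using hl')
    (Nat.zero_le m) (σ := σ₁) ⟨h15, f1, l1⟩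
  obtain ⟨σ₃, t₃, e3, f3, -, h1, -⟩ := exec_squareStep (ω := ω) f2 l2
  have e4 := exec_block (ω := ω) [.nconst 15 0, .rsqrt 1 1] σ₃
  have s4 : [Instr.nconst 15 0, .rsqrt 1 1].foldl (Instr.step ω) σ₃ =
      (σ₃.setN 15 0).setR 1 (Real.sqrt (frobNorm (squareSeq A m).2 ^ 2)) := by
    simp [Instr.step, State.setN, State.setR, h1]
  rw [s4] at e4
  obtain ⟨σ₅, t₅, e5, f5, h5⟩ := exec_sqrtLoop (ω := ω)
    (T := frobNorm (squareSeq A m).2 ^ 2)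
    (σ := (σ₃.setN 15 0).setR 1 (Real.sqrt (frobNorm (squareSeq A m).2 ^ 2)))
    ((f3.setN (by norm_num) (by norm_num) (by norm_num) (by norm_num) 0).setR (by norm_num) _)
    (by simp [State.setN, State.setR]) (by simp [State.setR])
  exact ⟨σ₅, _, .seq e1 (.seq e2 (.seq e3 (.seq e4 e5))), f5, h5⟩

end Estimate

end Sparsify

open Sparsify in
theorem mainTheorem1 (c : ℝ) (hc : 0 < c) :
    -- an algorithm whose only input is `A` and `ε` (it always halts)
    (∃ (P : Prog) (C : ℝ), 0 < C ∧
      ∀ (m n : ℕ) (A : Matrix (Fin m) (Fin n) ℝ) (ε : ℝ), n ≤ m → 0 < ε →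
      ∀ e : Fin (nnz A) ≃ Supp A,
      ∃ B : (ℕ → unitInterval) → Matrix (Fin m) (Fin n) ℝ,
        IsGoodSparsifier A ε c C B ∧
        ∀ ω, ∃ (σ : State) (t : ℕ), Exec ω P (inputState A e ε 0) σ t ∧ Outputs σ (B ω)) ∧
    -- linear running time when an estimate `L` of the spectral norm, within a factor `κ`, is given
    (∀ κ : ℝ, 1 ≤ κ → ∃ (P : Prog) (C : ℝ), 0 < C ∧
      ∀ (m n : ℕ) (A : Matrix (Fin m) (Fin n) ℝ) (ε L : ℝ), n ≤ m → 0 < ε →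
      specNorm A / κ ≤ L → L ≤ κ * specNorm A →
      ∀ e : Fin (nnz A) ≃ Supp A,
      ∃ B : (ℕ → unitInterval) → Matrix (Fin m) (Fin n) ℝ,
        IsGoodSparsifier A ε c C B ∧
        ∀ ω, ∃ (σ : State) (t : ℕ), Exec ω P (inputState A e ε L) σ t ∧ Outputs σ (B ω) ∧
          (t : ℝ) ≤ C * (nnz A + 1)) := by
  have key : ∀ κ : ℝ, 1 ≤ κ → ∃ (K : ℚ) (C : ℝ), 100 ≤ C ∧
      2 * Real.exp 4 * (c + 4) * κ ^ 2 ≤ K ∧ 6 * K * κ ^ 2 ≤ C := by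
    intro κ _
    obtain ⟨K, hK⟩ := exists_rat_gt (2 * Real.exp 4 * (c + 4) * κ ^ 2)
    exact ⟨K, max 100 (6 * K * κ ^ 2), le_max_left _ _, hK.le, le_max_right _ _⟩
  refine ⟨?_, fun κ hκ => ?_⟩
  · obtain ⟨K, C, hC, hK, hKC⟩ := key 2 (by norm_num)
    refine ⟨.seq normEstimate (sampler K), C, by linarith, fun m n A ε hnm hε e => ?_⟩
    refine ⟨_, isGoodSparsifier_sampleMat hc (by norm_num) hK hKC A hnm hε
      (le_trans (by linarith [specNorm_nonneg A]) (specNorm_le_normEst A)) (normEst_le A)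
      (samplePos_injective A e), fun ω => ?_⟩
    obtain ⟨σ₁, t₁, he₁, hf, h1⟩ := exec_normEstimate (ω := ω) A e ε
    obtain ⟨σ₂, t₂, he₂, -, hout⟩ := exec_sampler_outputs A e K (ω := ω) hf.rows hf.size hf.row
      hf.col hf.val hf.eps h1 hf.arr2 hf.arr3 hf.pos
    exact ⟨σ₂, _, .seq he₁ he₂, hout⟩
  · obtain ⟨K, C, hC, hK, hKC⟩ := key κ hκ
    refine ⟨sampler K, C, by linarith, fun m n A ε L hnm hε hL1 hL2 e => ?_⟩
    refine ⟨_, isGoodSparsifier_sampleMat hc hκ hK hKC A hnm hε hL1 hL2 (samplePos_injective A e),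
      fun ω => ?_⟩
    obtain ⟨σ, t, he, ht, hout⟩ := exec_sampler_outputs A e K (ω := ω)
      (σ := inputState A e ε L) (ε := ε) (L := L) (by simp [inputState]) (by simp [inputState])
      (by simp [inputState, entryRow]) (by simp [inputState, entryCol])
      (by simp [inputState, entryVal]) (by simp [inputState]) (by simp [inputState])
      (by simp [inputState]) (by simp [inputState]) rfl
    refine ⟨σ, t, he, hout, ?_⟩
    have : (t : ℝ) ≤ 100 * (nnz A + 1) := by exact_mod_cast ht
    exact this.trans (mul_le_mul_of_nonneg_right hC (by positivity))
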